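/- Let $d\ge 1$, $H\in(\tfrac12,1)$, $0<\alpha<d$, $T>0$. Let $\mu$ be a non-negative tempered Borel measure on $\mathbb{R}^d$ (i.e. $\int(1+|\xi|^2)^{-l}\mu(d\xi)<\infty$ for some $l>0$) whose Fourier transform is a function $f$, i.e. $\int f\varphi\,dx=\int\mathcal F\varphi\,d\mu$ for all Schwartz functions $\varphi$, where $\mathcal F\varphi(\xi)=\int e^{-i\langle\xi,x\rangle}\varphi(x)\,dx$. Assume $\mu(d\xi)\asymp|\xi|^{-\alpha}d\xi$, in the sense that for every measurable $h:\mathbb{R}^d\to[0,\infty)$ with $\int h(\xi)|\xi|^{-\alpha}d\xi<\infty$ there are constants $C,C'\in(0,\infty)$, possibly depending on $h$, with $$C'\int h(\xi)|\xi|^{-\alpha}d\xi\le\int h\,d\mu\le C\int h(\xi)|\xi|^{-\alpha}d\xi .$$ Let $W$ be a fractional-colored noise: a centered Gaussian field $\{W(t,A)\}$ indexed by $t\in[0,T]$ and bounded Borel sets $A\subset\mathbb{R}^d$, with $$\mathbb E[W(t,A)W(s,B)]=\tfrac12\big(t^{2H}+s^{2H}-|t-s|^{2H}\big)\int_A\int_B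 f(z-z')\,dz'\,dz .$$ Let $u(t,x)=\int_0^t\int_{\mathbb{R}^d}G(t-r,x-y)\,W(dr,dy)$ (Wiener integral) be the mild solution on $[0,T]\times\mathbb{R}^d$ of $\partial_t u=\tfrac12\Delta u+\dot W$, $u(0,\cdot)=0$, where $G(t,x)=(2\pi t)^{-d/2}e^{-|x|^2/(2t)}$ for $t>0$ and $G(t,x)=0$ for $t\le0$. Fix $t\in(0,T]$ and suppose that $2H-\frac{d-\alpha}{2}>1$. Then $\{u(t,x),x\in\mathbb{R}^d\}$ has a modification, still denoted by $u(t,\cdot)$, such that almost surely $x\mapsto u(t,x)$ is continuously differentiable on $\mathbb{R}^d$. Moreover, for every $M>0$ and every $\varepsilon_0\in(0,1)$ there is a positive random variable $K$ with finite moments of all orders such that, almost surely, for every $j=1,\dots,d$ and every $\varepsilon\in(0,\varepsilon_0]$, $$\sup_{x,y\in[-M,M]^d,\ |x-y|\le\varepsilon}\Big|\frac{\partial u}{\partial x_j}(t,x)-\frac{\partial u}{\partial x_j}(t,y)\Big|\le K\,\varepsilon^{2H-\frac{d-\alpha}{2}-1}\sqrt{\log\frac1\varepsilon}.$$ -/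

import Mathlib

open MeasureTheory ProbabilityTheory Filter Topology
open scoped NNReal ENNReal

noncomputable section

namespace FracHeat

/-- The space `ℝ^d` with its Euclidean norm. -/
abbrev Space (d : ℕ) : Type := EuclideanSpace ℝ (Fin d)

/-- The Fourier transform `(ℱ g)(ξ) = ∫ e^{-i⟨ξ,x⟩} g(x) dx`. -/
def fourier {d : ℕ} (g : Space d → ℂ) (ξ : Space d) : ℂ :=
  ∫ x, Complex.exp (-(Complex.I * ((inner ℝ ξ x : ℝ) : ℂ))) * g x

/-- `μ` is tempered: `∫ (1 + |ξ|²)^{-l} μ(dξ) < ∞` for some `l > 0`. -/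
def IsTempered {d : ℕ} (μ : Measure (Space d)) : Prop :=
  ∃ l : ℝ, 0 < l ∧ ∫⁻ ξ, ENNReal.ofReal ((1 / (1 + ‖ξ‖ ^ 2)) ^ l) ∂μ < ∞

/-- The function `f` is the Fourier transform of the measure `μ`:
`∫ f φ dx = ∫ ℱφ dμ` for every Schwartz function `φ`. -/
def IsFourierTransformOf {d : ℕ} (f : Space d → ℝ) (μ : Measure (Space d)) : Prop :=
  ∀ φ : SchwartzMap (Space d) ℂ,
    Integrable (fun x => (f x : ℂ) * φ x) ∧
      ∫ x, (f x : ℂ) * φ x = ∫ ξ, fourier (fun x => φ x) ξ ∂μ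

/-- `μ(dξ) ≍ |ξ|^{-α} dξ`: for every non-negative measurable function `h` which is integrable for
`|ξ|^{-α} dξ`, the integrals of `h` for the two measures agree up to positive finite constants
(which may depend on `h`). -/
def IsComparableRiesz {d : ℕ} (α : ℝ) (μ : Measure (Space d)) : Prop :=
  ∀ h : Space d → ℝ≥0, Measurable h →
    ∫⁻ ξ, (h ξ : ℝ≥0∞) * ENNReal.ofReal (‖ξ‖ ^ (-α)) < ∞ →
      ∃ C' C : ℝ≥0, 0 < C' ∧ 0 < C ∧
        (C' : ℝ≥0∞) * ∫⁻ ξ, (h ξ : ℝ≥0∞) * ENNReal.ofReal (‖ξ‖ ^ (-α))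
            ≤ ∫⁻ ξ, (h ξ : ℝ≥0∞) ∂μ ∧
        ∫⁻ ξ, (h ξ : ℝ≥0∞) ∂μ
            ≤ (C : ℝ≥0∞) * ∫⁻ ξ, (h ξ : ℝ≥0∞) * ENNReal.ofReal (‖ξ‖ ^ (-α))

/-- The covariance of the fractional Brownian motion with Hurst index `H`. -/
def fbmCov (H t s : ℝ) : ℝ := (t ^ (2 * H) + s ^ (2 * H) - |t - s| ^ (2 * H)) / 2

/-- Indices of the noise: a time in `[0,T]` and a bounded Borel subset of `ℝ^d`. -/
structure NoiseIndex (d : ℕ) (T : ℝ) where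
  time : ℝ
  set : Set (Space d)
  time_mem : time ∈ Set.Icc 0 T
  measurableSet : MeasurableSet set
  isBounded : Bornology.IsBounded set

/-- `W` is a fractional-colored noise on `[0,T] × ℝ^d` with Hurst index `H` and spatial kernel `f`:
a centered Gaussian field with `E[W(t,A) W(s,B)] = R_H(t,s) ∫_A ∫_B f(z - z') dz' dz`. -/
structure IsFracColoredNoise {d : ℕ} {T : ℝ} {Ω : Type*} [MeasurableSpace Ω]
    (H : ℝ) (f : Space d → ℝ) (W : NoiseIndex d T → Ω → ℝ) (P : Measure Ω) : Prop where
  isGaussian : IsGaussianProcess W P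
  centered : ∀ i, ∫ ω, W i ω ∂P = 0
  covariance : ∀ i j, ∫ ω, W i ω * W j ω ∂P =
    fbmCov H i.time j.time * ∫ z in i.set, ∫ z' in j.set, f (z - z')

/-- The elementary integrand `∑ cᵢ 1_{[0,tᵢ] × Aᵢ}`. -/
def elemFun {d : ℕ} {T : ℝ} (c : NoiseIndex d T →₀ ℝ) (r : ℝ) (y : Space d) : ℝ :=
  c.sum fun i a => a * (Set.Icc 0 i.time ×ˢ i.set).indicator (fun _ => (1 : ℝ)) (r, y)

/-- The Wiener integral `∑ cᵢ W(tᵢ,Aᵢ)` of the elementary integrand `∑ cᵢ 1_{[0,tᵢ] × Aᵢ}`. -/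
def elemIntegral {d : ℕ} {T : ℝ} {Ω : Type*} (W : NoiseIndex d T → Ω → ℝ)
    (c : NoiseIndex d T →₀ ℝ) (ω : Ω) : ℝ :=
  c.sum fun i a => a * W i ω

/-- The squared norm, in absolute-value form, of the space of deterministic integrands on
`[0,T] × ℝ^d`:
`H(2H-1) ∫ μ(dξ) ∫₀ᵀ ∫₀ᵀ |r-s|^{2H-2} |ℱg(r,·)(ξ)| |ℱg(s,·)(ξ)| ds dr`. It dominates a constant
multiple of the variance of the Wiener integral. -/
def integrandNormSq {d : ℕ} (H T : ℝ) (μ : Measure (Space d)) (g : ℝ → Space d → ℝ) : ℝ≥0∞ :=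
  ENNReal.ofReal (H * (2 * H - 1)) *
    ∫⁻ ξ, (∫⁻ r in Set.Icc 0 T, ∫⁻ s in Set.Icc 0 T,
      ENNReal.ofReal (|r - s| ^ (2 * H - 2)) *
        (‖fourier (fun y => (g r y : ℂ)) ξ‖ₑ * ‖fourier (fun y => (g s y : ℂ)) ξ‖ₑ)) ∂μ

/-- `X = ∫_0^T ∫ g(r,y) W(dr,dy)`: the random variable `X` is the `L²(P)` limit of the Wiener
integrals of elementary integrands which converge to `g`. -/
def IsWienerIntegral {d : ℕ} {T : ℝ} {Ω : Type*} [MeasurableSpace Ω] (H : ℝ)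
    (μ : Measure (Space d)) (W : NoiseIndex d T → Ω → ℝ) (P : Measure Ω)
    (g : ℝ → Space d → ℝ) (X : Ω → ℝ) : Prop :=
  MemLp X 2 P ∧
  ∃ c : ℕ → (NoiseIndex d T →₀ ℝ),
    Tendsto (fun n => integrandNormSq H T μ (fun r y => elemFun (c n) r y - g r y))
      atTop (𝓝 0) ∧
    Tendsto (fun n => eLpNorm (fun ω => elemIntegral W (c n) ω - X ω) 2 P) atTop (𝓝 0)

/-- The fundamental solution of `∂u/∂t = ½ Δu`, extended by `0` to `t ≤ 0`. -/
def heatKernel {d : ℕ} (t : ℝ) (x : Space d) : ℝ :=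
  if 0 < t then (2 * Real.pi * t) ^ (-(d : ℝ) / 2) * Real.exp (-(‖x‖ ^ 2 / (2 * t))) else 0

/-- `u` is the mild solution on `[0,T] × ℝ^d` of `∂u/∂t = ½ Δu + Ẇ`, `u(0,·) = 0`:
`u(t,x) = ∫_0^t ∫ G(t-r,x-y) W(dr,dy)`. The integrand vanishes for `r ≥ t`. -/
def IsMildSolution {d : ℕ} {T : ℝ} {Ω : Type*} [MeasurableSpace Ω] (H : ℝ)
    (μ : Measure (Space d)) (W : NoiseIndex d T → Ω → ℝ) (P : Measure Ω)
    (u : ℝ → Space d → Ω → ℝ) : Prop :=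
  ∀ t ∈ Set.Icc 0 T, ∀ x,
    IsWienerIntegral H μ W P (fun r y => heatKernel (t - r) (x - y)) (u t x)

/-- The partial derivative `∂g/∂x_j`. -/
def partialDeriv {d : ℕ} (j : Fin d) (g : Space d → ℝ) (x : Space d) : ℝ :=
  lineDeriv ℝ g x (EuclideanSpace.single j 1)

/-- The cube `[-M,M]^d`. -/
def cube (d : ℕ) (M : ℝ) : Set (Space d) := {x | ∀ i, x i ∈ Set.Icc (-M) M}

end FracHeat

end

open MeasureTheory ProbabilityTheory Filter Topology
open scoped NNReal ENNReal

noncomputable section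

namespace FracHeat

/-! One variance estimate drives everything. The integrand defining `u t x` has spatial Fourier
transform e^{-i⟨ξ,x⟩} 1_{r<t} e^{-(t-r)|ξ|²/2}, so a linear combination of values of `u t` has an
integrand whose transform is the heat factor times a symbol m(ξ), the same combination of
characters. At frequency ξ the fractional time kernel integrates the heat factor to O(|ξ|^{-4H})
(`timeEnergy_heatFactor_le`), and the spectral measure is at most a multiple of |ξ|^{-α} dξ
(`IsComparableRiesz.exists_le_smul`). The variance is therefore at most a multiple of ∫ |m(ξ)|²
|ξ|^{-4H-α} dξ. For a mixed second difference of step δ one has |m(ξ)| ≤ min(2, δ|ξ|)², and scaling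
gives δ^{4H+α-d} = δ^{2+2θ} with θ = 2H-(d-α)/2-1 > 0 (`exists_integrandNormSq_heat_le`).

Wiener integrals are L² limits of centered Gaussian variables, so E exp(X²/(12b)) ≤ 2 whenever b > 0
bounds the squared norm of the integrand (`IsWienerIntegral.lintegral_exp_sq_le`). A cube carries at
most a^{n+1} second differences of step 2^{-n}, each of typical size 2^{-n} 2^{-nθ}. A union bound
in exponential form costs a factor √(n+1) and yields one random constant κ with all moments, such
that all of them are at most κ w_n 2^{-n}, where w_n = 2^{-nθ} √(n+1) (`exists_array_bound`,
`exists_secondDiffBound`).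

The rest is deterministic. Second differences of this size change the difference quotients by O(κ
w_n) between neighbours and between successive scales. Since w is summable and w_{n+m} ≤ w_n w_m,
the quotients converge, and their limits oscillate by O(κ w_n) at scale 2^{-n}, with no loss in the
logarithm. These limits are the partial derivatives of the extension of the field from the dyadic
grids (`exists_contDiff_of_secondDiffBound`). First differences serve only to give continuity in
probability, which identifies the extension with `u t x` at every x
(`exists_contDiff_modification`). No derivative field is ever built as a Wiener integral. -/

/-! ### Domination of the spectral measure by the Riesz measure -/

/-- The measure `|ξ|^{-α} dξ`. -/
def rieszMeasure (d : ℕ) (α : ℝ) : Measure (Space d) :=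
  volume.withDensity fun ξ => ENNReal.ofReal (‖ξ‖ ^ (-α))

lemma measurable_ofReal_norm_rpow {d : ℕ} (p : ℝ) :
    Measurable fun ξ : Space d => ENNReal.ofReal (‖ξ‖ ^ p) :=
  (measurable_norm.pow_const p).ennreal_ofReal

lemma lintegral_rieszMeasure {d : ℕ} (α : ℝ) {g : Space d → ℝ≥0∞} (hg : Measurable g) :
    ∫⁻ ξ, g ξ ∂(rieszMeasure d α) = ∫⁻ ξ, g ξ * ENNReal.ofReal (‖ξ‖ ^ (-α)) := by
  rw [rieszMeasure, lintegral_withDensity_eq_lintegral_mul _ (measurable_ofReal_norm_rpow _) hg]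
  exact lintegral_congr fun ξ => mul_comm _ _

lemma IsComparableRiesz.exists_lintegral_le {d : ℕ} {α : ℝ} {μ : Measure (Space d)}
    (h : IsComparableRiesz α μ) {g : Space d → ℝ≥0} (hg : Measurable g)
    (hfin : ∫⁻ ξ, (g ξ : ℝ≥0∞) ∂(rieszMeasure d α) < ∞) :
    ∃ C : ℝ≥0, ∫⁻ ξ, (g ξ : ℝ≥0∞) ∂μ ≤ C * ∫⁻ ξ, (g ξ : ℝ≥0∞) ∂(rieszMeasure d α) := by
  rw [lintegral_rieszMeasure α hg.coe_nnreal_ennreal] at hfin ⊢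
  obtain ⟨-, C, -, -, -, hC⟩ := h g hg hfin
  exact ⟨C, hC⟩

/-- Comparability applied to the indicator of a null set: whatever the constant, the upper bound is
zero. -/
lemma IsComparableRiesz.absolutelyContinuous {d : ℕ} {α : ℝ} {μ : Measure (Space d)}
    (h : IsComparableRiesz α μ) : μ ≪ rieszMeasure d α := by
  refine Measure.AbsolutelyContinuous.mk fun s hs h0 => ?_
  have e : ∀ m : Measure (Space d),
      ∫⁻ ξ, ((s.indicator (fun _ => (1 : ℝ≥0)) ξ : ℝ≥0) : ℝ≥0∞) ∂m = m s := by
    intro m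
    simp_rw [ENNReal.coe_indicator]
    rw [lintegral_indicator hs]
    simp
  obtain ⟨C, hC⟩ := h.exists_lintegral_le
    (g := s.indicator fun _ => 1) (measurable_const.indicator hs) (by rw [e, h0]; simp)
  rw [e, e, h0, mul_zero] at hC
  exact le_antisymm hC zero_le

/-- The pointwise comparability constants can be chosen uniformly. -/
lemma IsComparableRiesz.exists_le_smul {d : ℕ} {α : ℝ} {μ : Measure (Space d)}
    (h : IsComparableRiesz α μ) : ∃ C : ℝ≥0, μ ≤ C • rieszMeasure d α := by
  set ν := rieszMeasure d α with hν
  by_contra! hcon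
  -- Constants that depend on h are automatically uniform: otherwise sets with ratio μ/ν above 4^n
  -- can be piled up into a single h that violates comparability.
  have key : ∀ n : ℕ, ∃ A, MeasurableSet A ∧ (4 : ℝ≥0∞) ^ n * ν A < μ A := by
    intro n
    have := hcon (4 ^ n)
    rw [Measure.le_iff] at this
    push Not at this
    obtain ⟨s, hs, hlt⟩ := this
    exact ⟨s, hs, by simpa [Measure.smul_apply, ENNReal.smul_def] using hlt⟩
  choose A hA hlt using key
  have hpos : ∀ n, ν (A n) ≠ 0 := fun n h0 => by
    have := h.absolutelyContinuous h0
    simpa [this] using hlt n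
  have hfin : ∀ n, ν (A n) ≠ ∞ := fun n h0 => by
    have := hlt n
    rw [h0, ENNReal.mul_top (by positivity)] at this
    exact absurd this not_top_lt
  -- With the weight 1/(2^n ν(A_n)) the n-th term has ν-integral 2^{-n}, but μ-integral above 2^n.
  set g : Space d → ℝ≥0∞ :=
    fun ξ => ∑' n, (A n).indicator (fun _ => ((2 : ℝ≥0∞) ^ n * ν (A n))⁻¹) ξ with hg
  have gm : Measurable g := Measurable.tsum fun n => measurable_const.indicator (hA n)
  have gν : ∫⁻ ξ, g ξ ∂ν < ∞ := by
    rw [hg, lintegral_tsum fun n => (measurable_const.indicator (hA n)).aemeasurable]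
    have : ∀ n, ∫⁻ ξ, (A n).indicator (fun _ => ((2 : ℝ≥0∞) ^ n * ν (A n))⁻¹) ξ ∂ν
        = (2⁻¹ : ℝ≥0∞) ^ n := by
      intro n
      rw [lintegral_indicator (hA n), lintegral_const, Measure.restrict_apply_univ,
        ENNReal.mul_inv (by simp) (by simp), mul_assoc,
        ENNReal.inv_mul_cancel (hpos n) (hfin n), mul_one, ENNReal.inv_pow]
    simp_rw [this]
    rw [ENNReal.tsum_geometric]
    simp
  -- Comparability concerns finite-valued functions, while g may be infinite on a ν-null set;
  -- absolute continuity makes that set μ-null too.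
  have gae : ∀ᵐ ξ ∂μ, g ξ < ∞ := h.absolutelyContinuous (ae_lt_top gm gν.ne)
  have e : ∀ᵐ ξ ∂μ, (((g ξ).toNNReal : ℝ≥0) : ℝ≥0∞) = g ξ := by
    filter_upwards [gae] with ξ hξ
    exact ENNReal.coe_toNNReal hξ.ne
  have hlt' : ∫⁻ ξ, (((g ξ).toNNReal : ℝ≥0) : ℝ≥0∞) ∂ν < ∞ :=
    (lintegral_mono fun ξ => ENNReal.coe_toNNReal_le_self).trans_lt gν
  obtain ⟨C, hC⟩ := h.exists_lintegral_le gm.ennreal_toNNReal hlt'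
  rw [lintegral_congr_ae e] at hC
  have hB : ∫⁻ ξ, g ξ ∂μ < ∞ := hC.trans_lt (ENNReal.mul_lt_top ENNReal.coe_lt_top hlt')
  have hlow : ∀ n : ℕ, (2 : ℝ≥0∞) ^ n ≤ ∫⁻ ξ, g ξ ∂μ := by
    intro n
    calc (2 : ℝ≥0∞) ^ n = ((2 : ℝ≥0∞) ^ n * ν (A n))⁻¹ * (4 ^ n * ν (A n)) := by
          have h2 : (2 : ℝ≥0∞) ^ n ≠ 0 := by positivity
          have h2' : (2 : ℝ≥0∞) ^ n ≠ ∞ := by simp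
          have h4 : (4 : ℝ≥0∞) ^ n = 2 ^ n * 2 ^ n := by
            rw [← mul_pow]; norm_num
          rw [ENNReal.mul_inv (by simp) (by simp), h4]
          calc (2 : ℝ≥0∞) ^ n = 2 ^ n * (((2 ^ n)⁻¹ * 2 ^ n) * ((ν (A n))⁻¹ * ν (A n))) := by
                rw [ENNReal.inv_mul_cancel h2 h2', ENNReal.inv_mul_cancel (hpos n) (hfin n)]
                simp
            _ = _ := by ring
      _ ≤ ((2 : ℝ≥0∞) ^ n * ν (A n))⁻¹ * μ (A n) := by gcongr; exact (hlt n).le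
      _ = ∫⁻ ξ, (A n).indicator (fun _ => ((2 : ℝ≥0∞) ^ n * ν (A n))⁻¹) ξ ∂μ := by
          rw [lintegral_indicator (hA n), lintegral_const, Measure.restrict_apply_univ]
      _ ≤ ∫⁻ ξ, g ξ ∂μ := lintegral_mono fun ξ =>
          ENNReal.le_tsum (f := fun n =>
            (A n).indicator (fun _ => ((2 : ℝ≥0∞) ^ n * ν (A n))⁻¹) ξ) n
  have ht : Tendsto (fun n : ℕ => (2 : ℝ≥0∞) ^ n) atTop (𝓝 ∞) :=
    ENNReal.tendsto_pow_atTop_nhds_top_iff.2 (by norm_num)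
  exact absurd (top_le_iff.1 (le_of_tendsto' ht hlow)) hB.ne

/-! ### Functions on dyadic grids with controlled second differences -/

/-- The grid point `z / 2^n`. -/
def gridPoint {d : ℕ} (n : ℕ) (z : Fin d → ℤ) : Space d :=
  WithLp.toLp 2 fun i => (z i : ℝ) / 2 ^ n

/-- The integer coordinates of the grid point of level `n` below `x`. -/
def gridFloor {d : ℕ} (n : ℕ) (x : Space d) : Fin d → ℤ := fun i => ⌊x i * 2 ^ n⌋

/-- The unit vector of `ℤ^d`. -/
def unitVec {d : ℕ} (j : Fin d) : Fin d → ℤ := Pi.single j 1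

/-- The mixed second difference of `g` at level `n`. -/
def secondDiff {d : ℕ} (g : Space d → ℝ) (n : ℕ) (j k : Fin d) (z : Fin d → ℤ) : ℝ :=
  g (gridPoint n (z + unitVec j + unitVec k)) - g (gridPoint n (z + unitVec j))
    - g (gridPoint n (z + unitVec k)) + g (gridPoint n z)

/-- The difference quotient of `g` at level `n`. -/
def diffQuot {d : ℕ} (g : Space d → ℝ) (n : ℕ) (j : Fin d) (z : Fin d → ℤ) : ℝ :=
  2 ^ n * (g (gridPoint n (z + unitVec j)) - g (gridPoint n z))

/-- The integer points of `[-M 2^n, M 2^n]^d`. -/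
def gridBox (d : ℕ) (M n : ℕ) : Set (Fin d → ℤ) := {z | ∀ i, |z i| ≤ M * 2 ^ n}

/-- All second differences of `g` in the box `[-M,M]^d` at level `n` are at most `κ w_n 2^{-n}`. -/
def SecondDiffBound {d : ℕ} (g : Space d → ℝ) (w : ℕ → ℝ) (M : ℕ) (κ : ℝ) : Prop :=
  ∀ n, ∀ z ∈ gridBox d M n, ∀ j k, |secondDiff g n j k z| ≤ κ * w n / 2 ^ n

section Grid

variable {d : ℕ}

@[simp] lemma gridPoint_apply (n : ℕ) (z : Fin d → ℤ) (i : Fin d) :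
    gridPoint n z i = (z i : ℝ) / 2 ^ n := rfl

@[simp] lemma gridFloor_gridPoint (n : ℕ) (z : Fin d → ℤ) : gridFloor n (gridPoint n z) = z := by
  ext i
  simp [gridFloor]

lemma gridPoint_succ_double (n : ℕ) (z : Fin d → ℤ) : gridPoint (n + 1) (z + z) = gridPoint n z := by
  ext i
  simp only [gridPoint_apply, Pi.add_apply, Int.cast_add, pow_succ]
  field_simp
  ring

lemma gridFloor_mem_gridBox {M : ℕ} {x : Space d} (hx : x ∈ cube d M) (n : ℕ) :
    gridFloor n x ∈ gridBox d M n := by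
  intro i
  obtain ⟨h1, h2⟩ := hx i
  have h3 : (0 : ℝ) < 2 ^ n := by positivity
  rw [abs_le]
  constructor
  · rw [gridFloor, Int.le_floor]
    push_cast
    nlinarith
  · have : (⌊x i * 2 ^ n⌋ : ℝ) ≤ M * 2 ^ n := (Int.floor_le _).trans (by nlinarith)
    rw [gridFloor]
    exact_mod_cast this

lemma gridPoint_mem_cube {M n : ℕ} {z : Fin d → ℤ} (hz : z ∈ gridBox d M n) :
    gridPoint n z ∈ cube d M := by
  intro i
  have h3 : (0 : ℝ) < 2 ^ n := by positivity
  have := hz i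
  have h : |(z i : ℝ)| ≤ M * 2 ^ n := by exact_mod_cast this
  rw [abs_le] at h
  rw [gridPoint_apply, Set.mem_Icc, le_div_iff₀ h3, div_le_iff₀ h3]
  constructor <;> linarith [h.1, h.2]

lemma gridBox_of_mem_uIcc {M n : ℕ} {z z₁ z₂ : Fin d → ℤ} (h₁ : z₁ ∈ gridBox d M n)
    (h₂ : z₂ ∈ gridBox d M n) (h : z ∈ Set.uIcc z₁ z₂) : z ∈ gridBox d M n := by
  intro i
  have a := abs_le.1 (h₁ i)
  have b := abs_le.1 (h₂ i)
  have c := h.1 i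
  have e := h.2 i
  simp only [Pi.inf_apply, Pi.sup_apply] at c e
  rw [abs_le]
  constructor
  · exact (le_inf a.1 b.1).trans c
  · exact e.trans (sup_le a.2 b.2)

/-- Telescoping along a lattice path from z₁ to z₂ that moves one coordinate at a time towards its
target, hence never leaves the order interval; the induction is on the ℓ¹ distance. The slopes c are
zero for comparing difference quotients, and are the candidate derivatives for the first-order
expansion. -/
lemma abs_sub_le_of_path (F : (Fin d → ℤ) → ℝ) (c : Fin d → ℝ) {b : ℝ} {z₁ z₂ : Fin d → ℤ}
    (h : ∀ z j, z ∈ Set.uIcc z₁ z₂ → |F (z + unitVec j) - F z - c j| ≤ b) :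
    |F z₂ - F z₁ - ∑ j, c j * ((z₂ j : ℝ) - z₁ j)| ≤ b * ∑ j, |(z₂ j : ℝ) - z₁ j| := by
  obtain ⟨N, hN⟩ : ∃ N : ℕ, N = ∑ j, (z₂ j - z₁ j).natAbs := ⟨_, rfl⟩
  induction N generalizing z₁ with
  | zero =>
    have : z₁ = z₂ := by
      ext j
      have := (Finset.sum_eq_zero_iff.1 hN.symm) j (Finset.mem_univ j)
      lia
    subst this
    simp
  | succ N ih =>
    obtain ⟨j, hj⟩ : ∃ j, z₁ j ≠ z₂ j := by
      by_contra! hcon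
      have : ∑ j, (z₂ j - z₁ j).natAbs = 0 := Finset.sum_eq_zero fun j _ => by simp [hcon j]
      omega
    -- `s` is the step towards `z₂`
    have step : ∀ s : ℤ, (z₂ j - z₁ j).natAbs = (z₂ j - (z₁ j + s)).natAbs + 1 → s.natAbs = 1 →
        |F (z₁ + Pi.single j s) - F z₁ - c j * s| ≤ b →
        |F z₂ - F z₁ - ∑ j, c j * ((z₂ j : ℝ) - z₁ j)| ≤ b * ∑ j, |(z₂ j : ℝ) - z₁ j| := by
      intro s hs hs1 hF
      set z' := z₁ + Pi.single j s with hz'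
      have hz'j : z' j = z₁ j + s := by simp [hz']
      have hz'i : ∀ i, i ≠ j → z' i = z₁ i := fun i hi => by simp [hz', hi]
      have hmem : z' ∈ Set.uIcc z₁ z₂ := by
        refine ⟨fun i => ?_, fun i => ?_⟩ <;> by_cases hi : i = j
        · subst hi; simp only [Pi.inf_apply]; rw [hz'j]; rw [inf_le_iff]; omega
        · simp only [Pi.inf_apply]; rw [hz'i i hi]; exact inf_le_left
        · subst hi; simp only [Pi.sup_apply]; rw [hz'j]; rw [le_sup_iff]; omega
        · simp only [Pi.sup_apply]; rw [hz'i i hi]; exact le_sup_left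
      have h1 : ∀ F' : Fin d → ℤ → ℝ, ∑ i, F' i (z₁ i) = ∑ i, F' i (z' i) + (F' j (z₁ j) - F' j (z' j)) := by
        intro F'
        rw [← Finset.add_sum_erase _ _ (Finset.mem_univ j),
          ← Finset.add_sum_erase _ (fun i => F' i (z' i)) (Finset.mem_univ j),
          Finset.sum_congr rfl (fun i hi => by rw [← hz'i i (Finset.ne_of_mem_erase hi)])]
        ring
      have hN' : N = ∑ i, (z₂ i - z' i).natAbs := by
        have e : ∑ i, (z₂ i - z₁ i).natAbs = ∑ i, (z₂ i - z' i).natAbs + 1 := by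
          rw [← Finset.add_sum_erase _ _ (Finset.mem_univ j),
            ← Finset.add_sum_erase _ (fun i => (z₂ i - z' i).natAbs) (Finset.mem_univ j),
            Finset.sum_congr rfl (fun i hi => by rw [← hz'i i (Finset.ne_of_mem_erase hi)]),
            hs, hz'j]
          ring
        omega
      -- The first step lands inside the interval, so the remaining interval is a subset of the
      -- original one and the hypothesis is inherited.
      have hrec := ih (z₁ := z') (fun z i hz => h z i (Set.uIcc_subset_uIcc_right hmem hz)) hN'
      rw [h1 fun i a => c i * ((z₂ i : ℝ) - a), h1 fun i a => |(z₂ i : ℝ) - a|]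
      have e1 : |(z₂ j : ℝ) - z₁ j| - |(z₂ j : ℝ) - z' j| = 1 := by
        rw [hz'j]
        have := hs
        zify at this
        have t : |(z₂ j : ℝ) - z₁ j| = |(z₂ j : ℝ) - ((z₁ j + s : ℤ) : ℝ)| + 1 := by
          exact_mod_cast this
        linarith
      rw [e1, mul_add, mul_one]
      have e2 : c j * ((z₂ j : ℝ) - z₁ j) - c j * ((z₂ j : ℝ) - z' j) = c j * s := by
        rw [hz'j]; push_cast; ring
      rw [e2]
      calc _ = |(F z₂ - F z' - ∑ i, c i * ((z₂ i : ℝ) - z' i)) + (F z' - F z₁ - c j * s)| := by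
              congr 1; ring
        _ ≤ _ := abs_add_le _ _
        _ ≤ _ := add_le_add hrec hF
    rcases lt_or_gt_of_ne hj with hlt | hlt
    · refine step 1 (by omega) rfl ?_
      have := h z₁ j Set.left_mem_uIcc
      simpa [unitVec] using this
    -- A downward step is an upward step read backwards: the hypothesis is used at the lower
    -- endpoint z₁ - e_j.
    · refine step (-1) (by omega) rfl ?_
      have hm : z₁ + Pi.single j (-1) ∈ Set.uIcc z₁ z₂ := by
        refine ⟨fun i => ?_, fun i => ?_⟩ <;> by_cases hi : i = j
        · subst hi; simp only [Pi.inf_apply, Pi.add_apply, Pi.single_eq_same]; rw [inf_le_iff]; omega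
        · simp [hi]
        · subst hi; simp only [Pi.sup_apply, Pi.add_apply, Pi.single_eq_same]; rw [le_sup_iff]; omega
        · simp [hi]
      have := h _ j hm
      have e : z₁ + Pi.single j (-1) + unitVec j = z₁ := by
        rw [unitVec, add_assoc, ← Pi.single_add]; simp
      rw [e] at this
      rw [abs_le] at this ⊢
      push_cast
      constructor <;> linarith [this.1, this.2]

lemma abs_sub_le_of_path_zero (F : (Fin d → ℤ) → ℝ) {b : ℝ} {z₁ z₂ : Fin d → ℤ}
    (h : ∀ z j, z ∈ Set.uIcc z₁ z₂ → |F (z + unitVec j) - F z| ≤ b) (hb : 0 ≤ b)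
    (h1 : ∀ i, |z₂ i - z₁ i| ≤ 1) : |F z₂ - F z₁| ≤ d * b := by
  have := abs_sub_le_of_path F 0 (b := b) (z₁ := z₁) (z₂ := z₂) (by simpa using h)
  simp only [Pi.zero_apply, zero_mul, Finset.sum_const_zero, sub_zero] at this
  refine this.trans ?_
  rw [mul_comm]
  refine mul_le_mul_of_nonneg_right ?_ hb
  calc ∑ j, |(z₂ j : ℝ) - z₁ j| ≤ ∑ _j : Fin d, (1 : ℝ) :=
        Finset.sum_le_sum fun i _ => by exact_mod_cast h1 i
    _ = d := by simp

lemma diffQuot_step (g : Space d → ℝ) (n : ℕ) (j k : Fin d) (z : Fin d → ℤ) :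
    diffQuot g n k (z + unitVec j) - diffQuot g n k z = 2 ^ n * secondDiff g n j k z := by
  simp only [diffQuot, secondDiff]; ring

/-- The quotient at level n is the mean of the two quotients at level n+1 over the halves of its
interval, so it differs from the first of them by half of their difference. -/
lemma diffQuot_double (g : Space d → ℝ) (n : ℕ) (k : Fin d) (z : Fin d → ℤ) :
    diffQuot g (n + 1) k (z + z) - diffQuot g n k z
      = - (2 ^ n * secondDiff g (n + 1) k k (z + z)) := by
  simp only [diffQuot, secondDiff]
  rw [← gridPoint_succ_double n z, ← gridPoint_succ_double n (z + unitVec k),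
    show z + unitVec k + (z + unitVec k) = z + z + unitVec k + unitVec k by abel]
  ring

end Grid

/-! ### From second differences on dyadic grids to a C¹ function -/

section Limit

variable {d : ℕ} {g : Space d → ℝ} {w r : ℕ → ℝ}

lemma two_pow_mul_secondDiff_le {M n : ℕ} {κ : ℝ} (h : SecondDiffBound g w M κ)
    {z : Fin d → ℤ} (hz : z ∈ gridBox d M n) (j k : Fin d) :
    2 ^ n * |secondDiff g n j k z| ≤ κ * w n := by
  have := h n z hz j k
  rwa [le_div_iff₀ (by positivity), mul_comm] at this

lemma double_mem_gridBox {M n : ℕ} {z : Fin d → ℤ} (hz : z ∈ gridBox d M n) :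
    z + z ∈ gridBox d M (n + 1) := by
  intro i
  have := abs_le.1 (hz i)
  rw [Pi.add_apply, abs_le, pow_succ]
  constructor <;> linarith [this.1, this.2]

/-- Refining the grid adds one binary digit to each coordinate. -/
lemma gridFloor_succ_sub_double (n : ℕ) (x : Space d) (i : Fin d) :
    |gridFloor (n + 1) x i - (gridFloor n x + gridFloor n x) i| ≤ 1 := by
  simp only [gridFloor, Pi.add_apply, pow_succ]
  have h1 := Int.floor_le (x i * 2 ^ n)
  have h2 := Int.lt_floor_add_one (x i * 2 ^ n)
  have h3 : 2 * ⌊x i * 2 ^ n⌋ ≤ ⌊x i * (2 ^ n * 2)⌋ := by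
    rw [Int.le_floor]; push_cast; linarith
  have h4 : ⌊x i * (2 ^ n * 2)⌋ < 2 * ⌊x i * 2 ^ n⌋ + 2 := by
    rw [Int.floor_lt]; push_cast; linarith
  rw [abs_le]
  constructor <;> linarith

/-- Passing from level n to n+1 costs one doubling and at most d unit steps on the finer grid, each
at most κ w (n+1). -/
lemma abs_diffQuot_succ_sub {M : ℕ} {κ : ℝ} (hκ : 0 ≤ κ) (hw : ∀ n, 0 ≤ w n)
    (h : SecondDiffBound g w M κ) {x : Space d} (hx : x ∈ cube d M) (n : ℕ) (k : Fin d) :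
    |diffQuot g (n + 1) k (gridFloor (n + 1) x) - diffQuot g n k (gridFloor n x)|
      ≤ (d + 1) * κ * w (n + 1) := by
  have hm := double_mem_gridBox (gridFloor_mem_gridBox hx n)
  have hm' := gridFloor_mem_gridBox hx (n + 1)
  have hκw : 0 ≤ κ * w (n + 1) := mul_nonneg hκ (hw _)
  have h1 : |diffQuot g (n + 1) k (gridFloor (n + 1) x)
      - diffQuot g (n + 1) k (gridFloor n x + gridFloor n x)| ≤ d * (κ * w (n + 1)) := by
    refine abs_sub_le_of_path_zero (diffQuot g (n + 1) k) (fun z j hz => ?_) hκw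
      (gridFloor_succ_sub_double n x)
    rw [diffQuot_step, abs_mul, abs_of_nonneg (by positivity)]
    exact two_pow_mul_secondDiff_le h (gridBox_of_mem_uIcc hm hm' hz) j k
  have h2 : |diffQuot g (n + 1) k (gridFloor n x + gridFloor n x)
      - diffQuot g n k (gridFloor n x)| ≤ κ * w (n + 1) := by
    rw [diffQuot_double, abs_neg, abs_mul, abs_of_nonneg (by positivity)]
    refine le_trans ?_ (two_pow_mul_secondDiff_le h hm k k)
    gcongr
    · norm_num
    · omega
  calc _ ≤ _ := abs_sub_le _ (diffQuot g (n + 1) k (gridFloor n x + gridFloor n x)) _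
    _ ≤ d * (κ * w (n + 1)) + κ * w (n + 1) := add_le_add h1 h2
    _ = _ := by ring

lemma abs_diffQuot_sub {M : ℕ} {κ : ℝ} (hκ : 0 ≤ κ) (hw : ∀ n, 0 ≤ w n)
    (h : SecondDiffBound g w M κ) {x y : Space d} (hx : x ∈ cube d M) (hy : y ∈ cube d M)
    (n : ℕ) (hxy : ∀ i, |x i - y i| ≤ (1 / 2) ^ n) (k : Fin d) :
    |diffQuot g n k (gridFloor n x) - diffQuot g n k (gridFloor n y)| ≤ d * (κ * w n) := by
  refine abs_sub_le_of_path_zero (diffQuot g n k) (fun z j hz => ?_) (mul_nonneg hκ (hw _)) ?_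
  · rw [diffQuot_step, abs_mul, abs_of_nonneg (by positivity)]
    exact two_pow_mul_secondDiff_le h (gridBox_of_mem_uIcc (gridFloor_mem_gridBox hy n)
      (gridFloor_mem_gridBox hx n) hz) j k
  · intro i
    have h0 : |x i * 2 ^ n - y i * 2 ^ n| ≤ 1 := by
      rw [← sub_mul, abs_mul, abs_of_nonneg (by positivity : (0 : ℝ) ≤ 2 ^ n)]
      calc _ ≤ (1 / 2 : ℝ) ^ n * 2 ^ n := by gcongr; exact hxy i
        _ = 1 := by rw [← mul_pow]; norm_num
    rw [abs_le] at h0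
    simp only [gridFloor]
    have h1 := Int.floor_le (x i * 2 ^ n)
    have h2 := Int.lt_floor_add_one (x i * 2 ^ n)
    have h3 := Int.floor_le (y i * 2 ^ n)
    have h4 := Int.lt_floor_add_one (y i * 2 ^ n)
    have h5 : (⌊x i * 2 ^ n⌋ : ℝ) - ⌊y i * 2 ^ n⌋ < 2 := by linarith [h0.2]
    have h6 : (⌊y i * 2 ^ n⌋ : ℝ) - ⌊x i * 2 ^ n⌋ < 2 := by linarith [h0.1]
    have h5' : ⌊x i * 2 ^ n⌋ - ⌊y i * 2 ^ n⌋ < 2 := by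
      rw [← Int.cast_lt (R := ℝ), Int.cast_sub]
      exact h5.trans_eq (Int.cast_ofNat 2).symm
    have h6' : ⌊y i * 2 ^ n⌋ - ⌊x i * 2 ^ n⌋ < 2 := by
      rw [← Int.cast_lt (R := ℝ), Int.cast_sub]
      exact h6.trans_eq (Int.cast_ofNat 2).symm
    rw [abs_le]
    constructor <;> linarith

/-- The margin 1 keeps all points within coordinate distance 1 of x in the same cube, so one
constant κ serves a whole neighbourhood. -/
lemma exists_mem_cube (x : Space d) : ∃ M : ℕ, ∀ i, |x i| + 1 < M := by
  obtain ⟨M, hM⟩ := exists_nat_gt (‖x‖ + 1)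
  refine ⟨M, fun i => lt_of_le_of_lt ?_ hM⟩
  have := PiLp.norm_apply_le x i
  simpa using this

lemma mem_cube_iff {M : ℝ} {x : Space d} : x ∈ cube d M ↔ ∀ i, |x i| ≤ M := by
  simp [cube, abs_le]

/-- The constant of `exists_contDiff_of_secondDiffBound`. -/
def gridConst (d : ℕ) (r : ℕ → ℝ) : ℝ := 2 * ((d + 1) * ∑' m, r (m + 1)) + d

/-- The quotients form a Cauchy sequence because w is summable. Submultiplicativity bounds the tail
Σ_m w (n+m+1) by w n · Σ_m r (m+1), so the error at level n is of the order of w n itself; this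
preserves the exact modulus. The limits D do not depend on M or κ. -/
lemma exists_lim_diffQuot (hw : ∀ n, 0 ≤ w n) (hwr : ∀ n m, w (n + m) ≤ w n * r m)
    (hr : Summable r) (h : ∀ M : ℕ, ∃ κ, 0 ≤ κ ∧ SecondDiffBound g w M κ) :
    ∃ D : Fin d → Space d → ℝ, ∀ (M : ℕ) κ, 0 ≤ κ → SecondDiffBound g w M κ →
      ∀ x ∈ cube d M, ∀ n j,
        |diffQuot g n j (gridFloor n x) - D j x| ≤ ((d + 1) * ∑' m, r (m + 1)) * κ * w n := by
  have hws : Summable w := by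
    refine Summable.of_nonneg_of_le hw (fun n => ?_) (hr.mul_left (w 0))
    simpa using hwr 0 n
  have hr1 : Summable fun m => r (m + 1) := (summable_nat_add_iff 1).2 hr
  have hlim : ∀ j x, ∃ D : ℝ, Tendsto (fun n => diffQuot g n j (gridFloor n x)) atTop (𝓝 D) := by
    intro j x
    obtain ⟨M, hM⟩ := exists_mem_cube x
    obtain ⟨κ, hκ, hb⟩ := h M
    have hx : x ∈ cube d M := mem_cube_iff.2 fun i => by linarith [hM i]
    refine cauchySeq_tendsto_of_complete (cauchySeq_of_dist_le_of_summable
      (fun n => (d + 1) * κ * w (n + 1)) (fun n => ?_)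
      (((summable_nat_add_iff 1).2 hws).mul_left _))
    rw [dist_comm, Real.dist_eq]
    exact abs_diffQuot_succ_sub hκ hw hb hx n j
  choose D hD using hlim
  refine ⟨D, fun M κ hκ hb x hx n j => ?_⟩
  have := dist_le_tsum_of_dist_le_of_tendsto
      (fun n => (d + 1) * κ * w (n + 1)) (fun n => by
        rw [Nat.succ_eq_add_one, dist_comm, Real.dist_eq]
        exact abs_diffQuot_succ_sub hκ hw hb hx n j)
      (((summable_nat_add_iff 1).2 hws).mul_left _) (hD j x) n
  rw [Real.dist_eq] at this
  refine this.trans ?_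
  rw [tsum_mul_left]
  have h2 : ∑' m, w (n + m + 1) ≤ w n * ∑' m, r (m + 1) := by
    rw [← tsum_mul_left]
    refine Summable.tsum_le_tsum (fun m => hwr n (m + 1)) ?_ (hr1.mul_left _)
    have : (fun m => w (n + m + 1)) = fun m => w (m + (n + 1)) := by
      ext m; congr 1; omega
    rw [this]
    exact (summable_nat_add_iff (n + 1)).2 hws
  calc (d + 1) * κ * ∑' m, w (n + m + 1) ≤ (d + 1) * κ * (w n * ∑' m, r (m + 1)) := by gcongr
    _ = _ := by ring

/-- Both limits are compared with their level-n quotients, and these with each other; `gridConst`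
collects the three errors. -/
lemma abs_lim_diffQuot_sub {D : Fin d → Space d → ℝ} (hw : ∀ n, 0 ≤ w n)
    (hD : ∀ (M : ℕ) κ, 0 ≤ κ → SecondDiffBound g w M κ →
      ∀ x ∈ cube d M, ∀ n j,
        |diffQuot g n j (gridFloor n x) - D j x| ≤ ((d + 1) * ∑' m, r (m + 1)) * κ * w n)
    {M : ℕ} {κ : ℝ} (hκ : 0 ≤ κ) (h : SecondDiffBound g w M κ) {x y : Space d}
    (hx : x ∈ cube d M) (hy : y ∈ cube d M)
    (n : ℕ) (hxy : ∀ i, |x i - y i| ≤ (1 / 2) ^ n) (j : Fin d) :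
    |D j x - D j y| ≤ gridConst d r * κ * w n := by
  have h1 := abs_le.1 (hD M κ hκ h x hx n j)
  have h2 := abs_le.1 (hD M κ hκ h y hy n j)
  have h3 := abs_le.1 (abs_diffQuot_sub hκ hw h hx hy n hxy j)
  have e : gridConst d r * κ * w n = ((d + 1) * ∑' m, r (m + 1)) * κ * w n +
    ((d + 1) * ∑' m, r (m + 1)) * κ * w n + d * (κ * w n) := by
    rw [gridConst]; ring
  rw [e, abs_le]
  constructor <;> linarith [h1.1, h1.2, h2.1, h2.2, h3.1, h3.2]

lemma isCompact_cube (M : ℝ) : IsCompact (cube d M) := by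
  refine Metric.isCompact_of_isClosed_isBounded ?_ ?_
  · simp only [cube, Set.ofPred_forall]
    exact isClosed_iInter fun i => isClosed_Icc.preimage (by fun_prop)
  · refine (Metric.isBounded_iff_subset_closedBall 0).2 ⟨√(∑ _i : Fin d, M ^ 2), fun x hx => ?_⟩
    rw [mem_closedBall_zero_iff, EuclideanSpace.norm_eq]
    refine Real.sqrt_le_sqrt (Finset.sum_le_sum fun i _ => ?_)
    rw [mem_cube_iff] at hx
    exact pow_le_pow_left₀ (norm_nonneg _) (hx i) 2

lemma tendsto_gridFloor_div (x : Space d) (i : Fin d) :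
    Tendsto (fun n => (gridFloor n x i : ℝ) / 2 ^ n) atTop (𝓝 (x i)) := by
  have h2 : Tendsto (fun n : ℕ => (1 / 2 : ℝ) ^ n) atTop (𝓝 0) :=
    tendsto_pow_atTop_nhds_zero_of_lt_one (by norm_num) (by norm_num)
  refine tendsto_iff_dist_tendsto_zero.2 (squeeze_zero (fun _ => dist_nonneg) (fun n => ?_) h2)
  have h3 : (0 : ℝ) < 2 ^ n := by positivity
  have h4 := Int.floor_le (x i * 2 ^ n)
  have h5 := Int.lt_floor_add_one (x i * 2 ^ n)
  rw [Real.dist_eq, one_div, inv_pow, gridFloor, abs_le, le_sub_iff_add_le, sub_le_iff_le_add,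
    le_div_iff₀ h3, div_le_iff₀ h3, add_mul, add_mul, neg_mul, inv_mul_cancel₀ h3.ne']
  constructor <;> linarith

lemma tendsto_gridPoint_gridFloor (x : Space d) :
    Tendsto (fun n => gridPoint n (gridFloor n x)) atTop (𝓝 x) :=
  ((PiLp.continuous_toLp 2 (fun _ : Fin d => ℝ)).tendsto _).comp
    (tendsto_pi_nhds.2 fun i => tendsto_gridFloor_div x i)

/-- Only the values of g on dyadic points enter, and g itself need not be continuous. The limits D
of the quotients are continuous, and summing quotients along lattice paths shows that the dyadic
extension v has differential Σ D_j dx_j. -/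
theorem exists_contDiff_of_secondDiffBound (hw : ∀ n, 0 ≤ w n)
    (hwr : ∀ n m, w (n + m) ≤ w n * r m)
    (hr : Summable r) (h : ∀ M : ℕ, ∃ κ, 0 ≤ κ ∧ SecondDiffBound g w M κ) :
    ∃ v : Space d → ℝ,
      (∀ x, Tendsto (fun n => g (gridPoint n (gridFloor n x))) atTop (𝓝 (v x))) ∧
      ContDiff ℝ 1 v ∧
      ∀ (M : ℕ) κ, 0 ≤ κ → SecondDiffBound g w M κ → ∀ j n, ∀ x ∈ cube d M, ∀ y ∈ cube d M,
        ‖x - y‖ ≤ (1 / 2) ^ n →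
          |partialDeriv j v x - partialDeriv j v y| ≤ gridConst d r * κ * w n := by
  obtain ⟨D, hD⟩ := exists_lim_diffQuot hw hwr hr h
  have hws : Summable w := by
    refine Summable.of_nonneg_of_le hw (fun n => ?_) (hr.mul_left (w 0))
    simpa using hwr 0 n
  have hw0 : Tendsto w atTop (𝓝 0) := hws.tendsto_atTop_zero
  have hcoord : ∀ (x y : Space d) i, |x i - y i| ≤ ‖x - y‖ := fun x y i => by
    have := PiLp.norm_apply_le (x - y) i
    simpa using this
  -- continuity of the limits
  have hloc : ∀ (j : Fin d) (x : Space d), ∀ ε > 0, ∃ δ > 0, ∀ y : Space d, (∀ i, |x i - y i| < δ) →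
      |D j x - D j y| ≤ ε := by
    intro j x ε hε
    obtain ⟨M, hM⟩ := exists_mem_cube x
    obtain ⟨κ, hκ, hb⟩ := h M
    have : Tendsto (fun n => gridConst d r * κ * w n) atTop (𝓝 0) := by
      simpa using hw0.const_mul (gridConst d r * κ)
    obtain ⟨n, hn⟩ := (this.eventually (gt_mem_nhds hε)).exists
    refine ⟨(1 / 2) ^ n, by positivity, fun y hy => ?_⟩
    have hn1 : (1 / 2 : ℝ) ^ n ≤ 1 := pow_le_one₀ (by norm_num) (by norm_num)
    refine (abs_lim_diffQuot_sub hw hD hκ hb (mem_cube_iff.2 fun i => by linarith [hM i])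
      (mem_cube_iff.2 fun i => ?_) n (fun i => (hy i).le) j).trans hn.le
    have h1 := abs_le.1 ((hy i).le.trans hn1)
    have h2 := abs_lt.1 (lt_sub_iff_add_lt.2 (hM i))
    rw [abs_le]
    constructor <;> linarith [h1.1, h1.2, h2.1, h2.2]
  have hcont : ∀ j, Continuous (D j) := by
    intro j
    rw [Metric.continuous_iff]
    intro x ε hε
    obtain ⟨δ, hδ, hδ'⟩ := hloc j x (ε / 2) (by positivity)
    refine ⟨δ, hδ, fun y hy => ?_⟩
    rw [dist_comm, Real.dist_eq]
    refine (hδ' y fun i => (hcoord x y i).trans_lt ?_).trans_lt (by linarith)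
    rwa [dist_comm, dist_eq_norm] at hy
  -- convergence along the grid
  have hlim : ∀ x, ∃ l : ℝ, Tendsto (fun n => g (gridPoint n (gridFloor n x))) atTop (𝓝 l) := by
    intro x
    obtain ⟨M, hM⟩ := exists_mem_cube x
    obtain ⟨κ, hκ, hb⟩ := h M
    have hx : x ∈ cube d M := mem_cube_iff.2 fun i => by linarith [hM i]
    -- D is bounded on the compact cube, hence so are the quotients up to a multiple of w; moving
    -- between consecutive dyadic approximations of x then changes g by a summable amount.
    obtain ⟨B, hB⟩ : ∃ B : ℝ, ∀ j, ∀ y ∈ cube d M, |D j y| ≤ B := by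
      have : ∀ j, ∃ B : ℝ, ∀ y ∈ cube d M, |D j y| ≤ B := fun j =>
        (isCompact_cube (M : ℝ)).exists_bound_of_continuousOn (hcont j).continuousOn
      choose B hB using this
      exact ⟨∑ j, |B j|, fun j y hy => (hB j y hy).trans ((le_abs_self _).trans
        (Finset.single_le_sum (f := fun j => |B j|) (fun _ _ => abs_nonneg _)
          (Finset.mem_univ j)))⟩
    have hws' : Summable fun n => (1 / 2 : ℝ) ^ (n + 1)
        * (|B| + |((d + 1) * ∑' m, r (m + 1)) * κ| * w (n + 1)) * d := by
      refine Summable.mul_right _ ?_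
      refine Summable.of_nonneg_of_le (fun n => ?_) (fun n => ?_)
        ((((summable_nat_add_iff 1).2 summable_geometric_two).mul_left |B|).add
          (((summable_nat_add_iff 1).2 hws).mul_left |((d + 1) * ∑' m, r (m + 1)) * κ|))
      · have := hw (n + 1); positivity
      · have hn1 : (1 / 2 : ℝ) ^ (n + 1) ≤ 1 := pow_le_one₀ (by norm_num) (by norm_num)
        rw [mul_add, mul_comm _ |B|]
        exact add_le_add le_rfl (mul_le_of_le_one_left (mul_nonneg (abs_nonneg _) (hw _)) hn1)
    refine cauchySeq_tendsto_of_complete (cauchySeq_of_dist_le_of_summable _ (fun n => ?_) hws')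
    rw [dist_comm, Real.dist_eq, Nat.succ_eq_add_one, ← gridPoint_succ_double n]
    have hm := double_mem_gridBox (gridFloor_mem_gridBox hx n)
    have hm' := gridFloor_mem_gridBox hx (n + 1)
    have := hw (n + 1)
    rw [mul_comm _ (d : ℝ)]
    refine abs_sub_le_of_path_zero (fun z => g (gridPoint (n + 1) z)) (fun z j hz => ?_)
      (by positivity) (gridFloor_succ_sub_double n x)
    have hz' := gridBox_of_mem_uIcc hm hm' hz
    have h1 := hD M κ hκ hb _ (gridPoint_mem_cube hz') (n + 1) j
    rw [gridFloor_gridPoint] at h1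
    have h2 := hB j _ (gridPoint_mem_cube hz')
    have e : g (gridPoint (n + 1) (z + unitVec j)) - g (gridPoint (n + 1) z)
        = (1 / 2) ^ (n + 1) * diffQuot g (n + 1) j z := by
      rw [diffQuot, ← mul_assoc, ← mul_pow]; norm_num
    rw [e, abs_mul, abs_of_nonneg (by positivity : (0 : ℝ) ≤ (1 / 2) ^ (n + 1))]
    gcongr
    have h4 : ((d + 1) * ∑' m, r (m + 1)) * κ * w (n + 1)
        ≤ |((d + 1) * ∑' m, r (m + 1)) * κ| * w (n + 1) := by gcongr; exact le_abs_self _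
    have h5 := le_abs_self B
    rw [abs_le] at h1 h2 ⊢
    constructor <;> linarith [h1.1, h1.2, h2.1, h2.2]
  choose v hv using hlim
  -- first order expansion
  have hexp : ∀ x, ∀ ε > 0, ∃ δ > 0, ∀ y : Space d, (∀ i, |x i - y i| < δ) →
      |v y - v x - ∑ j, D j x * (y j - x j)| ≤ ε * ∑ j, |y j - x j| := by
    intro x ε hε
    have : ∀ j, ∃ δ > 0, ∀ y : Space d, (∀ i, |x i - y i| < δ) → |D j x - D j y| ≤ ε :=
      fun j => hloc j x ε hε
    choose δ hδ hδ' using this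
    obtain ⟨δ₀, hδ₀, hδ₀'⟩ : ∃ δ₀ > 0, ∀ j, δ₀ ≤ δ j := by
      rcases isEmpty_or_nonempty (Fin d) with hd | hd
      · exact ⟨1, one_pos, fun j => (hd.false j).elim⟩
      · exact ⟨Finset.univ.inf' Finset.univ_nonempty δ,
          (Finset.lt_inf'_iff _).2 fun j _ => hδ j, fun j => Finset.inf'_le _ (Finset.mem_univ j)⟩
    -- Half of δ₀ is spent on |x - y| and half on rounding to the grid; the bound 1 keeps y in the
    -- cube chosen for x.
    refine ⟨min (δ₀ / 2) 1, by positivity, fun y hy => ?_⟩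
    obtain ⟨M, hM⟩ := exists_mem_cube x
    obtain ⟨κ, hκ, hb⟩ := h M
    have hx : x ∈ cube d M := mem_cube_iff.2 fun i => by linarith [hM i]
    have hyM : y ∈ cube d M := mem_cube_iff.2 fun i => by
      have h1 := abs_le.1 ((hy i).le.trans (min_le_right _ _))
      have h2 := abs_lt.1 (lt_sub_iff_add_lt.2 (hM i))
      rw [abs_le]
      constructor <;> linarith [h1.1, h1.2, h2.1, h2.2]
    set A := ((d + 1) * ∑' m, r (m + 1)) * κ with hA
    have hn : ∀ᶠ n : ℕ in atTop,
        |g (gridPoint n (gridFloor n y)) - g (gridPoint n (gridFloor n x))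
          - ∑ j, D j x * ((gridFloor n y j : ℝ) / 2 ^ n - (gridFloor n x j : ℝ) / 2 ^ n)|
        ≤ (ε + A * w n) * ∑ j, |(gridFloor n y j : ℝ) / 2 ^ n - (gridFloor n x j : ℝ) / 2 ^ n| := by
      have h1 : ∀ᶠ n : ℕ in atTop, ∀ i, |(gridFloor n x i : ℝ) / 2 ^ n - x i| < δ₀ / 2 ∧
          |(gridFloor n y i : ℝ) / 2 ^ n - y i| < δ₀ / 2 := by
        rw [eventually_all]
        intro i
        have a := (Metric.tendsto_atTop'.1 (tendsto_gridFloor_div x i) (δ₀ / 2) (by positivity))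
        have b := (Metric.tendsto_atTop'.1 (tendsto_gridFloor_div y i) (δ₀ / 2) (by positivity))
        obtain ⟨N1, hN1⟩ := a
        obtain ⟨N2, hN2⟩ := b
        filter_upwards [eventually_gt_atTop N1, eventually_gt_atTop N2] with n n1 n2
        exact ⟨hN1 n n1, hN2 n n2⟩
      filter_upwards [h1] with n hn
      have h3 : (0 : ℝ) < 2 ^ n := by positivity
      -- A unit step has length 2^{-n}, so its expected increment is D_j(x) 2^{-n}. The error
      -- combines the oscillation ε of D near x with the distance A w_n from quotient to limit; the
      -- latter vanishes as n grows.
      have key := abs_sub_le_of_path (fun z => g (gridPoint n z)) (fun j => D j x * (1 / 2) ^ n)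
        (b := (ε + A * w n) * (1 / 2) ^ n) (z₁ := gridFloor n x) (z₂ := gridFloor n y) ?_
      · have e : ∀ a b : ℝ, a / 2 ^ n - b / 2 ^ n = (1 / 2) ^ n * (a - b) := fun a b => by
          rw [one_div, inv_pow]; field_simp
        simp_rw [e, abs_mul, ← mul_assoc, abs_of_nonneg (by positivity : (0 : ℝ) ≤ (1 / 2) ^ n)]
        rw [← Finset.mul_sum, ← mul_assoc]
        exact key
      · intro z j hz
        have hz' := gridBox_of_mem_uIcc (gridFloor_mem_gridBox hx n) (gridFloor_mem_gridBox hyM n) hz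
        have a1 := hD M κ hκ hb _ (gridPoint_mem_cube hz') n j
        rw [gridFloor_gridPoint] at a1
        have a2 := hδ' j (gridPoint n z) fun i => by
          refine lt_of_lt_of_le ?_ (hδ₀' j)
          have b1 := abs_lt.1 (hn i).1
          have b2 := abs_lt.1 (hn i).2
          have b3 := abs_lt.1 ((hy i).trans_le (min_le_left _ _))
          have b4 := hz.1 i
          have b5 := hz.2 i
          simp only [Pi.inf_apply, Pi.sup_apply, inf_le_iff, le_sup_iff] at b4 b5
          rw [gridPoint_apply, abs_lt]
          have mono : ∀ a b : ℤ, a ≤ b → (a : ℝ) / 2 ^ n ≤ (b : ℝ) / 2 ^ n := fun a b hab => by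
            gcongr
          constructor
          · rcases b5 with b5 | b5 <;> have := mono _ _ b5 <;> linarith [b1.1, b1.2, b2.1, b2.2, b3.1, b3.2]
          · rcases b4 with b4 | b4 <;> have := mono _ _ b4 <;> linarith [b1.1, b1.2, b2.1, b2.2, b3.1, b3.2]
        have e : g (gridPoint n (z + unitVec j)) - g (gridPoint n z) - D j x * (1 / 2) ^ n
            = (diffQuot g n j z - D j x) * (1 / 2) ^ n := by
          rw [diffQuot, one_div, inv_pow]; field_simp
        rw [e, abs_mul, abs_of_nonneg (by positivity : (0 : ℝ) ≤ (1 / 2) ^ n)]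
        gcongr
        rw [abs_le] at a1 a2 ⊢
        constructor <;> linarith [a1.1, a1.2, a2.1, a2.2]
    refine le_of_tendsto_of_tendsto ?_ ?_ hn
    · refine (((hv y).sub (hv x)).sub (tendsto_finsetSum _ fun j _ => ?_)).abs
      exact ((tendsto_gridFloor_div y j).sub (tendsto_gridFloor_div x j)).const_mul _
    · have : Tendsto (fun n => ε + A * w n) atTop (𝓝 ε) := by
        simpa using (hw0.const_mul A).const_add ε
      exact this.mul (tendsto_finsetSum _ fun j _ => ((tendsto_gridFloor_div y j).sub (tendsto_gridFloor_div x j)).abs)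
  have hderiv : ∀ x, HasFDerivAt v (∑ j, D j x • (EuclideanSpace.proj j : Space d →L[ℝ] ℝ)) x := by
    intro x
    rw [hasFDerivAt_iff_isLittleO, Asymptotics.isLittleO_iff]
    intro c hc
    -- The ℓ¹ norm is at most d times the Euclidean norm; d + 1 avoids a division by zero when d =
    -- 0.
    obtain ⟨δ, hδ, hδ'⟩ := hexp x (c / (d + 1)) (by positivity)
    filter_upwards [Metric.ball_mem_nhds x hδ] with y hy
    have h1 := hδ' y fun i => (hcoord x y i).trans_lt (by rwa [norm_sub_rev, ← dist_eq_norm])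
    have e : (∑ j, D j x • (EuclideanSpace.proj j : Space d →L[ℝ] ℝ)) (y - x)
        = ∑ j, D j x * (y j - x j) := by
      simp
    rw [e, Real.norm_eq_abs]
    refine h1.trans ?_
    calc c / (d + 1) * ∑ j, |y j - x j| ≤ c / (d + 1) * ∑ _j : Fin d, ‖y - x‖ := by
          gcongr with j; exact hcoord y x j
      _ = c * ‖y - x‖ * (d / (d + 1)) := by simp; ring
      _ ≤ c * ‖y - x‖ * 1 := by
          gcongr
          rw [div_le_one (by positivity)]; linarith
      _ = c * ‖y - x‖ := mul_one _
  have hpd : ∀ j x, partialDeriv j v x = D j x := by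
    intro j x
    rw [partialDeriv, ((hderiv x).hasLineDerivAt _).lineDeriv]
    simp
  refine ⟨v, hv, ?_, fun M κ hκ hb j n x hx y hy hxy => ?_⟩
  · rw [contDiff_one_iff_fderiv]
    refine ⟨fun x => (hderiv x).differentiableAt, ?_⟩
    have : fderiv ℝ v = fun x => ∑ j, D j x • (EuclideanSpace.proj j : Space d →L[ℝ] ℝ) :=
      funext fun x => (hderiv x).fderiv
    rw [this]
    exact continuous_finsetSum _ fun j _ => (hcont j).smul continuous_const
  · rw [hpd, hpd]
    exact abs_lim_diffQuot_sub hw hD hκ hb hx hy n (fun i => (hcoord x y i).trans hxy) j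

end Limit

/-! ### Exponential square moments of Gaussian variables -/

lemma lintegral_exp_sq_gaussianReal_le {v : ℝ≥0} {s : ℝ} (hv : v ≤ s) :
    ∫⁻ x, ENNReal.ofReal (Real.exp (x ^ 2 / (4 * s))) ∂(gaussianReal 0 v) ≤ 2 := by
  have hm : Measurable fun x : ℝ => ENNReal.ofReal (Real.exp (x ^ 2 / (4 * s))) := by fun_prop
  by_cases h0 : v = 0
  · rw [h0, gaussianReal_zero_var, lintegral_dirac' _ hm]
    simp
  have hv0 : (0 : ℝ) < v := by positivity
  rw [gaussianReal_of_var_ne_zero _ h0,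
    lintegral_withDensity_eq_lintegral_mul _ (measurable_gaussianPDF _ _) hm]
  have h2 : (2 * v : ℝ≥0) ≠ 0 := by positivity
  -- Multiplying the N(0,v) density by e^{x²/(4v)} gives √2 times the N(0,2v) density, so the
  -- integral is at most √2; replacing s by the smaller v only increases the integrand.
  calc _ ≤ ∫⁻ x, ENNReal.ofReal √2 * gaussianPDF 0 (2 * v) x := by
        refine lintegral_mono fun x => ?_
        simp only [Pi.mul_apply, gaussianPDF]
        rw [← ENNReal.ofReal_mul (gaussianPDFReal_nonneg _ _ _),
          ← ENNReal.ofReal_mul (Real.sqrt_nonneg _)]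
        refine ENNReal.ofReal_le_ofReal ?_
        simp only [gaussianPDFReal, NNReal.coe_mul, NNReal.coe_ofNat, sub_zero]
        have e : √(2 * Real.pi * (2 * v)) = √2 * √(2 * Real.pi * v) := by
          rw [← Real.sqrt_mul (by norm_num)]; congr 1; ring
        rw [e, mul_inv, mul_assoc (√(2 * Real.pi * v))⁻¹, ← Real.exp_add]
        have h3 : √2 * ((√2)⁻¹ * (√(2 * Real.pi * v))⁻¹ * Real.exp (-x ^ 2 / (2 * (2 * v))))
            = (√(2 * Real.pi * v))⁻¹ * Real.exp (-x ^ 2 / (2 * (2 * v))) := by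
          rw [← mul_assoc, ← mul_assoc, mul_inv_cancel₀ (by positivity), one_mul]
        rw [h3]
        gcongr
        have h4 : x ^ 2 / (4 * s) ≤ x ^ 2 / (4 * v) := by gcongr
        have h5 : -x ^ 2 / (2 * v) = -(x ^ 2 / (4 * v)) - x ^ 2 / (4 * v) := by field_simp; ring
        have h6 : -x ^ 2 / (2 * (2 * v)) = -(x ^ 2 / (4 * v)) := by
          rw [show 2 * (2 * (v : ℝ)) = 4 * v by ring]; ring
        rw [h5, h6]; linarith
    _ = ENNReal.ofReal √2 := by
        rw [lintegral_const_mul _ (measurable_gaussianPDF _ _), lintegral_gaussianPDF_eq_one _ h2,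
          mul_one]
    _ ≤ 2 := by
        rw [ENNReal.ofReal_le_iff_le_toReal (by simp)]
        rw [Real.sqrt_le_left (by simp)]
        norm_num

lemma lintegral_exp_sq_le_of_hasGaussianLaw {Ω : Type*} [MeasurableSpace Ω] {P : Measure Ω}
    {X : Ω → ℝ} (hX : HasGaussianLaw X P) (h0 : ∫ ω, X ω ∂P = 0) {s : ℝ} (hs : 0 < s)
    (hvar : ∫ ω, X ω ^ 2 ∂P ≤ s) :
    ∫⁻ ω, ENNReal.ofReal (Real.exp (X ω ^ 2 / (4 * s))) ∂P ≤ 2 := by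
  have hm : AEMeasurable X P := hX.aemeasurable
  have hv : Var[X; P] = ∫ ω, X ω ^ 2 ∂P := variance_of_integral_eq_zero hm h0
  have hmap : P.map X = gaussianReal 0 (Var[X; P]).toNNReal := by
    have := hX.map_eq_gaussianReal
    rwa [h0] at this
  have hle : ((Var[X; P]).toNNReal : ℝ) ≤ s := by
    rw [hv, Real.coe_toNNReal']
    exact max_le hvar hs.le
  have := lintegral_exp_sq_gaussianReal_le hle
  rw [← hmap, lintegral_map' (by fun_prop) hm] at this
  exact this

/-! ### Elementary Wiener integrals and their limits -/

section Noise

variable {d : ℕ} {T H : ℝ} {Ω : Type*} [MeasurableSpace Ω] {P : Measure Ω}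
  {f : Space d → ℝ} {W : NoiseIndex d T → Ω → ℝ}

lemma IsFracColoredNoise.hasGaussianLaw_elemIntegral (hW : IsFracColoredNoise H f W P)
    (c : NoiseIndex d T →₀ ℝ) : HasGaussianLaw (elemIntegral W c) P := by
  have := (hW.isGaussian.smul c).hasGaussianLaw_fun_sum (I := c.support)
  exact this

lemma IsFracColoredNoise.memLp_two (hW : IsFracColoredNoise H f W P) (i : NoiseIndex d T) :
    MemLp (W i) 2 P := (hW.isGaussian.hasGaussianLaw_eval i).memLp_two

lemma IsFracColoredNoise.memLp_elemIntegral (hW : IsFracColoredNoise H f W P)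
    (c : NoiseIndex d T →₀ ℝ) : MemLp (elemIntegral W c) 2 P :=
  (hW.hasGaussianLaw_elemIntegral c).memLp_two

lemma IsFracColoredNoise.integral_elemIntegral [IsFiniteMeasure P]
    (hW : IsFracColoredNoise H f W P)
    (c : NoiseIndex d T →₀ ℝ) : ∫ ω, elemIntegral W c ω ∂P = 0 := by
  simp only [elemIntegral, Finsupp.sum]
  rw [integral_finsetSum _ fun i _ => ((hW.memLp_two i).integrable one_le_two).const_mul _]
  simp [integral_const_mul, hW.centered]

lemma IsFracColoredNoise.integral_elemIntegral_sq (hW : IsFracColoredNoise H f W P)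
    (c : NoiseIndex d T →₀ ℝ) :
    ∫ ω, elemIntegral W c ω ^ 2 ∂P = ∑ i ∈ c.support, ∑ j ∈ c.support,
      c i * c j * (fbmCov H i.time j.time * ∫ z in i.set, ∫ z' in j.set, f (z - z')) := by
  simp only [elemIntegral, Finsupp.sum, sq, Finset.sum_mul_sum]
  have hint : ∀ i j, Integrable (fun ω => c i * W i ω * (c j * W j ω)) P := fun i j => by
    have := ((hW.memLp_two i).integrable_mul (hW.memLp_two j)).const_mul (c i * c j)
    refine this.congr (Eventually.of_forall fun ω => ?_)
    simp only [Pi.mul_apply]; ring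
  rw [integral_finsetSum _ fun i _ => integrable_finsetSum _ fun j _ => hint i j]
  refine Finset.sum_congr rfl fun i _ => ?_
  rw [integral_finsetSum _ fun j _ => hint i j]
  refine Finset.sum_congr rfl fun j _ => ?_
  rw [← hW.covariance, ← integral_const_mul]
  exact integral_congr_ae (Eventually.of_forall fun ω => by simp only; ring)

end Noise

/-- A Fatou argument: exponential square moments pass to `L²` limits. -/
lemma lintegral_exp_sq_le_of_tendsto {Ω : Type*} [MeasurableSpace Ω] {P : Measure Ω}
    {X : ℕ → Ω → ℝ} {Y : Ω → ℝ} {s : ℝ} (hX : ∀ n, AEStronglyMeasurable (X n) P)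
    (hY : AEStronglyMeasurable Y P)
    (hlim : Tendsto (fun n => eLpNorm (fun ω => X n ω - Y ω) 2 P) atTop (𝓝 0))
    (hb : ∀ᶠ n in atTop, ∫⁻ ω, ENNReal.ofReal (Real.exp (X n ω ^ 2 / (4 * s))) ∂P ≤ 2) :
    ∫⁻ ω, ENNReal.ofReal (Real.exp (Y ω ^ 2 / (4 * s))) ∂P ≤ 2 := by
  obtain ⟨ns, hns, hae⟩ :=
    (tendstoInMeasure_of_tendsto_eLpNorm (p := 2) (by simp) hX hY hlim).exists_seq_tendsto_ae
  calc _ = ∫⁻ ω, liminf (fun k => ENNReal.ofReal (Real.exp (X (ns k) ω ^ 2 / (4 * s)))) atTop ∂P := by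
        refine lintegral_congr_ae ?_
        filter_upwards [hae] with ω hω
        refine (Tendsto.liminf_eq ?_).symm
        exact (ENNReal.continuous_ofReal.tendsto _).comp
          ((Real.continuous_exp.tendsto _).comp ((hω.pow 2).div_const _))
    _ ≤ liminf (fun k => ∫⁻ ω, ENNReal.ofReal (Real.exp (X (ns k) ω ^ 2 / (4 * s))) ∂P) atTop :=
        lintegral_liminf_le' fun k => by
          have := (hX (ns k)).aemeasurable
          fun_prop
    _ ≤ 2 := by
        refine liminf_le_of_le (by isBoundedDefault) fun b hb' => ?_
        obtain ⟨k, h1, h2⟩ := (hb'.and (hns.tendsto_atTop.eventually hb)).exists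
        exact h1.trans h2

/-! ### The fractional time kernel and its energy -/

/-- The time kernel `|r-s|^{2H-2}`. -/
def timeKernel (H r s : ℝ) : ℝ≥0∞ := ENNReal.ofReal (|r - s| ^ (2 * H - 2))

/-- The energy `∫₀ᵀ ∫₀ᵀ |r-s|^{2H-2} φ(r) φ(s) ds dr`. -/
def timeEnergy (H T : ℝ) (φ : ℝ → ℝ≥0∞) : ℝ≥0∞ :=
  ∫⁻ r in Set.Icc 0 T, ∫⁻ s in Set.Icc 0 T, timeKernel H r s * (φ r * φ s)

/-- A convolution square root of the time kernel. -/
def rootKernel (H w r : ℝ) : ℝ≥0∞ := if w < r then ENNReal.ofReal ((r - w) ^ (H - 3 / 2)) else 0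

lemma lintegral_comp_pos_smul {E : Type*} [NormedAddCommGroup E] [NormedSpace ℝ E]
    [MeasurableSpace E] [BorelSpace E] [FiniteDimensional ℝ E] (μ : Measure E)
    [μ.IsAddHaarMeasure] {g : E → ℝ≥0∞} (hg : Measurable g) {r : ℝ} (hr : 0 < r) :
    ∫⁻ x, g (r • x) ∂μ = ENNReal.ofReal ((r ^ Module.finrank ℝ E)⁻¹) * ∫⁻ x, g x ∂μ := by
  rw [← lintegral_map (f := g) (g := (r • ·)) hg (measurable_const_smul r),
    Measure.map_addHaar_smul μ hr.ne',
    lintegral_smul_measure, abs_of_nonneg (by positivity), smul_eq_mul]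

@[fun_prop] lemma measurable_timeKernel (H : ℝ) :
    Measurable fun p : ℝ × ℝ => timeKernel H p.1 p.2 := by
  unfold timeKernel; fun_prop

@[fun_prop] lemma measurable_rootKernel (H : ℝ) :
    Measurable fun p : ℝ × ℝ => rootKernel H p.1 p.2 := by
  unfold rootKernel
  exact Measurable.ite (measurableSet_lt measurable_fst measurable_snd) (by fun_prop) (by fun_prop)

lemma timeKernel_comm (H r s : ℝ) : timeKernel H r s = timeKernel H s r := by
  rw [timeKernel, timeKernel, abs_sub_comm]

/-- The constant `∫₀^∞ v^{H-3/2} (1+v)^{H-3/2} dv`. -/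
def rootConst (H : ℝ) : ℝ≥0∞ :=
  ∫⁻ v : ℝ, if 0 < v then
    ENNReal.ofReal ((1 + v) ^ (H - 3 / 2)) * ENNReal.ofReal (v ^ (H - 3 / 2)) else 0

section Kernel

variable {H : ℝ}

lemma rootConst_ne_zero : rootConst H ≠ 0 := by
  intro h
  have hm : Measurable fun v : ℝ => if 0 < v then
    ENNReal.ofReal ((1 + v) ^ (H - 3 / 2)) * ENNReal.ofReal (v ^ (H - 3 / 2)) else 0 :=
    Measurable.ite (measurableSet_lt measurable_const measurable_id) (by fun_prop) (by fun_prop)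
  rw [rootConst, lintegral_eq_zero_iff hm, EventuallyEq, ae_iff] at h
  have : Set.Ioi (0 : ℝ) ⊆ {v : ℝ | ¬ ((if 0 < v then
    ENNReal.ofReal ((1 + v) ^ (H - 3 / 2)) * ENNReal.ofReal (v ^ (H - 3 / 2)) else 0)
      = (0 : ℝ → ℝ≥0∞) v)} := by
    intro v (hv : 0 < v)
    simp only [Set.mem_ofPred_eq, if_pos hv, Pi.zero_apply, mul_eq_zero, ENNReal.ofReal_eq_zero,
      not_or, not_le]
    exact ⟨Real.rpow_pos_of_pos (by linarith) _, Real.rpow_pos_of_pos hv _⟩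
  have := measure_mono_null this h
  simp at this

lemma lintegral_Ioo_rpow_lt_top {p : ℝ} (hp : -1 < p) (a : ℝ) :
    ∫⁻ v in Set.Ioc 0 a, ENNReal.ofReal (v ^ p) < ∞ := by
  rcases le_or_gt a 0 with ha | ha
  · simp [Set.Ioc_eq_empty_of_le ha]
  have h := (intervalIntegral.intervalIntegrable_rpow' (a := 0) (b := a) hp).1
  exact (hasFiniteIntegral_iff_ofReal
    ((ae_restrict_iff' measurableSet_Ioc).2 (Eventually.of_forall fun v hv =>
      Real.rpow_nonneg hv.1.le _))).1 h.2

lemma lintegral_Ioi_rpow_lt_top {p : ℝ} (hp : p < -1) :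
    ∫⁻ v in Set.Ioi (1 : ℝ), ENNReal.ofReal (v ^ p) < ∞ := by
  have h := integrableOn_Ioi_rpow_of_lt hp zero_lt_one
  exact (hasFiniteIntegral_iff_ofReal
    ((ae_restrict_iff' measurableSet_Ioi).2 (Eventually.of_forall fun v hv =>
      Real.rpow_nonneg (zero_le_one.trans (le_of_lt hv)) _))).1 h.2

/-- Near 0 the integrand is at most v^{H-3/2}, integrable because H > 1/2; beyond 1 it is at most
v^{2H-3}, integrable because H < 1. -/
lemma rootConst_lt_top (hH : H ∈ Set.Ioo (1 / 2 : ℝ) 1) : rootConst H < ∞ := by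
  obtain ⟨h1, h2⟩ := hH
  have e : rootConst H = ∫⁻ v in Set.Ioi (0 : ℝ),
      ENNReal.ofReal ((1 + v) ^ (H - 3 / 2)) * ENNReal.ofReal (v ^ (H - 3 / 2)) := by
    rw [rootConst, ← lintegral_indicator measurableSet_Ioi]
    rfl
  rw [e, ← Set.Ioc_union_Ioi_eq_Ioi (zero_le_one' ℝ)]
  refine (lintegral_union_le _ _ _).trans_lt (ENNReal.add_lt_top.2 ⟨?_, ?_⟩)
  · refine lt_of_le_of_lt (setLIntegral_mono' measurableSet_Ioc fun v hv => ?_)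
      (lintegral_Ioo_rpow_lt_top (p := H - 3 / 2) (by linarith) 1)
    refine mul_le_of_le_one_left' ?_
    rw [ENNReal.ofReal_le_one]
    exact Real.rpow_le_one_of_one_le_of_nonpos (by linarith [hv.1]) (by linarith)
  · refine lt_of_le_of_lt (setLIntegral_mono' measurableSet_Ioi fun v hv => ?_)
      (lintegral_Ioi_rpow_lt_top (p := 2 * H - 3) (by linarith))
    have hv : 1 < v := hv
    rw [← ENNReal.ofReal_mul (by positivity)]
    refine ENNReal.ofReal_le_ofReal ?_
    rw [show 2 * H - 3 = (H - 3 / 2) + (H - 3 / 2) by ring, Real.rpow_add (by linarith)]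
    gcongr ?_ * _
    exact Real.rpow_le_rpow_of_nonpos (by linarith) (by linarith) (by linarith)

/-- The substitution w = s - (r - s) v extracts the power (r - s)^{2H-2} and leaves the integral
`rootConst`. -/
lemma lintegral_rootKernel_mul_of_lt {r s : ℝ} (h : s < r) :
    ∫⁻ w, rootKernel H w r * rootKernel H w s = rootConst H * timeKernel H r s := by
  set F : ℝ → ℝ≥0∞ := fun x => if 0 < x then
    ENNReal.ofReal ((r - s + x) ^ (H - 3 / 2)) * ENNReal.ofReal (x ^ (H - 3 / 2)) else 0 with hF
  have hFm : Measurable F :=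
    Measurable.ite (measurableSet_lt measurable_const measurable_id) (by fun_prop) (by fun_prop)
  have h0 : 0 < r - s := sub_pos.2 h
  have e1 : ∫⁻ w, rootKernel H w r * rootKernel H w s = ∫⁻ x, F x := by
    rw [← lintegral_sub_left_eq_self _ s]
    refine lintegral_congr fun x => ?_
    simp only [rootKernel, hF]
    by_cases hx : 0 < x
    · rw [if_pos (by linarith), if_pos (by linarith), if_pos hx]
      congr 3 <;> ring
    · rw [if_neg (by linarith : ¬ (s - x < s)), if_neg hx, mul_zero]
  have e2 := lintegral_comp_pos_smul volume hFm h0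
  have e3 : ∫⁻ x, F ((r - s) • x) = ENNReal.ofReal ((r - s) ^ (2 * H - 3)) * rootConst H := by
    rw [rootConst, ← lintegral_const_mul']
    · refine lintegral_congr fun x => ?_
      simp only [hF, smul_eq_mul, mul_pos_iff_of_pos_left h0]
      split_ifs with hx
      · rw [← ENNReal.ofReal_mul (by positivity), ← ENNReal.ofReal_mul (by positivity),
          ← ENNReal.ofReal_mul (by positivity)]
        congr 1
        rw [show r - s + (r - s) * x = (r - s) * (1 + x) by ring,
          Real.mul_rpow h0.le (by linarith), Real.mul_rpow h0.le hx.le,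
          show 2 * H - 3 = (H - 3 / 2) + (H - 3 / 2) by ring, Real.rpow_add h0]
        ring
      · simp
    · exact ENNReal.ofReal_ne_top
  rw [e3] at e2
  have e4 : ∫⁻ x, F x = ENNReal.ofReal (r - s) *
      (ENNReal.ofReal ((r - s) ^ Module.finrank ℝ ℝ)⁻¹ * ∫⁻ x, F x) := by
    rw [← mul_assoc, ← ENNReal.ofReal_mul h0.le, Module.finrank_self, pow_one,
      mul_inv_cancel₀ h0.ne', ENNReal.ofReal_one, one_mul]
  rw [e1, e4, ← e2, ← mul_assoc, ← ENNReal.ofReal_mul h0.le, timeKernel, abs_of_pos h0, mul_comm]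
  congr 2
  rw [show 2 * H - 2 = 1 + (2 * H - 3) by ring, Real.rpow_add h0, Real.rpow_one]

lemma lintegral_rootKernel_mul {r s : ℝ} (h : r ≠ s) :
    ∫⁻ w, rootKernel H w r * rootKernel H w s = rootConst H * timeKernel H r s := by
  rcases lt_or_gt_of_ne h with h | h
  · rw [timeKernel_comm, ← lintegral_rootKernel_mul_of_lt h]
    exact lintegral_congr fun w => mul_comm _ _
  · exact lintegral_rootKernel_mul_of_lt h

/-- The convolution root turns the energy into a squared L² norm, from which the quasi-triangle
inequality for energies follows without expanding cross terms. -/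
lemma rootConst_mul_timeEnergy (hH : H ∈ Set.Ioo (1 / 2 : ℝ) 1) (T : ℝ) {φ : ℝ → ℝ≥0∞}
    (hφ : Measurable φ) :
    rootConst H * timeEnergy H T φ
      = ∫⁻ w, (∫⁻ r in Set.Icc 0 T, rootKernel H w r * φ r) ^ 2 := by
  set m : Measure ℝ := volume.restrict (Set.Icc 0 T) with hm
  have hc := (rootConst_lt_top hH).ne
  have e1 : ∀ r, ∫⁻ s, rootConst H * (timeKernel H r s * (φ r * φ s)) ∂m
      = ∫⁻ s, (∫⁻ w, (rootKernel H w r * φ r) * (rootKernel H w s * φ s)) ∂m := by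
    intro r
    refine lintegral_congr_ae ?_
    -- The factorization fails on the diagonal, where the root integral diverges while the real
    -- power of 0 is 0 by convention; a single s is negligible.
    have : ∀ᵐ s ∂m, s ≠ r := ae_restrict_of_ae (by simp [ae_iff, measure_singleton])
    filter_upwards [this] with s hs
    rw [← mul_assoc, ← lintegral_rootKernel_mul hs.symm, ← lintegral_mul_const _ (by
      exact ((measurable_rootKernel H).comp (measurable_id.prodMk measurable_const)).mul
        ((measurable_rootKernel H).comp (measurable_id.prodMk measurable_const)))]
    exact lintegral_congr fun w => by ring
  have e2 : ∀ r, ∫⁻ s, (∫⁻ w, (rootKernel H w r * φ r) * (rootKernel H w s * φ s)) ∂m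
      = ∫⁻ w, (rootKernel H w r * φ r) * ∫⁻ s, rootKernel H w s * φ s ∂m := by
    intro r
    rw [lintegral_lintegral_swap]
    · refine lintegral_congr fun w => ?_
      rw [lintegral_const_mul]
      exact ((measurable_rootKernel H).comp (measurable_const.prodMk measurable_id)).mul hφ
    · refine Measurable.aemeasurable ?_
      exact (((measurable_rootKernel H).comp (measurable_snd.prodMk measurable_const)).mul
        measurable_const).mul
          (((measurable_rootKernel H).comp (measurable_snd.prodMk measurable_fst)).mul
            (hφ.comp measurable_fst))
  have hI : Measurable fun w => ∫⁻ s, rootKernel H w s * φ s ∂m :=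
    Measurable.lintegral_prod_right' (f := fun p : ℝ × ℝ => rootKernel H p.1 p.2 * φ p.2)
      ((measurable_rootKernel H).mul (hφ.comp measurable_snd))
  rw [timeEnergy, ← lintegral_const_mul' _ _ hc]
  simp_rw [← lintegral_const_mul' _ _ hc]
  rw [← hm]
  simp_rw [e1, e2]
  rw [lintegral_lintegral_swap]
  · refine lintegral_congr fun w => ?_
    rw [sq, lintegral_mul_const]
    exact ((measurable_rootKernel H).comp (measurable_const.prodMk measurable_id)).mul hφ
  · refine Measurable.aemeasurable ?_
    exact (((measurable_rootKernel H).comp (measurable_snd.prodMk measurable_fst)).mul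
      (hφ.comp measurable_fst)).mul (hI.comp measurable_snd)

lemma ennreal_add_sq_le (a b : ℝ≥0∞) : (a + b) ^ 2 ≤ 2 * a ^ 2 + 2 * b ^ 2 := by
  have := ENNReal.rpow_add_le_mul_rpow_add_rpow a b (p := 2) (by norm_num)
  norm_num at this
  rwa [mul_add] at this

lemma timeEnergy_add_le (hH : H ∈ Set.Ioo (1 / 2 : ℝ) 1) (T : ℝ) {φ ψ : ℝ → ℝ≥0∞}
    (hφ : Measurable φ) (hψ : Measurable ψ) :
    timeEnergy H T (fun r => φ r + ψ r) ≤ 2 * timeEnergy H T φ + 2 * timeEnergy H T ψ := by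
  have hc := (rootConst_lt_top hH).ne
  have h0 := rootConst_ne_zero (H := H)
  rw [← ENNReal.mul_le_mul_iff_right h0 hc, mul_add, mul_left_comm, mul_left_comm (rootConst H) 2,
    rootConst_mul_timeEnergy hH T hφ, rootConst_mul_timeEnergy hH T hψ,
    rootConst_mul_timeEnergy hH T (φ := fun r => φ r + ψ r) (hφ.add hψ)]
  have hK : ∀ w, Measurable fun r => rootKernel H w r := fun w =>
    (measurable_rootKernel H).comp (measurable_const.prodMk measurable_id)
  have hI : ∀ {φ : ℝ → ℝ≥0∞}, Measurable φ →
      Measurable fun w => (∫⁻ s in Set.Icc 0 T, rootKernel H w s * φ s) ^ 2 := fun hφ =>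
    (Measurable.lintegral_prod_right' (f := fun p : ℝ × ℝ => rootKernel H p.1 p.2 * _)
      ((measurable_rootKernel H).mul (hφ.comp measurable_snd))).pow_const 2
  rw [← lintegral_const_mul _ (hI hφ), ← lintegral_const_mul _ (hI hψ),
    ← lintegral_add_left ((hI hφ).const_mul _)]
  refine lintegral_mono fun w => ?_
  simp only [mul_add]
  rw [lintegral_add_left (f := fun r => rootKernel H w r * φ r) ((hK w).mul hφ)]
  exact ennreal_add_sq_le _ _

lemma timeEnergy_mono {T : ℝ} {φ ψ : ℝ → ℝ≥0∞} (h : ∀ r, φ r ≤ ψ r) :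
    timeEnergy H T φ ≤ timeEnergy H T ψ :=
  lintegral_mono fun r => lintegral_mono fun s => by
    gcongr
    · exact h r
    · exact h s

lemma timeEnergy_const_mul {T : ℝ} {c : ℝ≥0∞} (hc : c ≠ ∞) (φ : ℝ → ℝ≥0∞) :
    timeEnergy H T (fun r => c * φ r) = c ^ 2 * timeEnergy H T φ := by
  have h2 : c ^ 2 ≠ ∞ := ENNReal.pow_ne_top hc
  rw [timeEnergy, timeEnergy, ← lintegral_const_mul' _ _ h2]
  refine lintegral_congr fun r => ?_
  rw [← lintegral_const_mul' _ _ h2]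
  exact lintegral_congr fun s => by ring

end Kernel

/-! ### Fractional covariance as an energy, and the energy of the heat factor -/

section TimeIntegral

variable {β : ℝ}

lemma integral_abs_sub_rpow (hβ : -1 < β) {r s : ℝ} (h0 : 0 ≤ r) (h1 : r ≤ s) :
    IntegrableOn (fun x => |r - x| ^ β) (Set.Icc 0 s) ∧
      ∫ x in Set.Icc 0 s, |r - x| ^ β = (r ^ (β + 1) + (s - r) ^ (β + 1)) / (β + 1) := by
  have hb : 0 < β + 1 := by linarith
  have a1 : IntervalIntegrable (fun x => |r - x| ^ β) volume 0 r := by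
    have : IntervalIntegrable (fun x => (r - x) ^ β) volume 0 r := by
      have := (intervalIntegral.intervalIntegrable_rpow' (a := r) (b := 0) hβ).comp_sub_left r
      simpa using this
    refine this.congr_ae ?_
    refine (ae_restrict_iff' measurableSet_uIoc).2 (Eventually.of_forall fun x hx => ?_)
    rw [Set.uIoc_of_le h0] at hx
    simp only
    rw [abs_of_nonneg (by linarith [hx.2])]
  have a2 : IntervalIntegrable (fun x => |r - x| ^ β) volume r s := by
    have : IntervalIntegrable (fun x => (x - r) ^ β) volume r s := by
      have := (intervalIntegral.intervalIntegrable_rpow' (a := 0) (b := s - r) hβ).comp_sub_right r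
      simpa using this
    refine this.congr_ae ?_
    refine (ae_restrict_iff' measurableSet_uIoc).2 (Eventually.of_forall fun x hx => ?_)
    rw [Set.uIoc_of_le h1] at hx
    simp only
    rw [abs_sub_comm, abs_of_nonneg (by linarith [hx.1])]
  have h2 := h0.trans h1
  refine ⟨by
    rw [integrableOn_Icc_iff_integrableOn_Ioc]
    exact (intervalIntegrable_iff_integrableOn_Ioc_of_le h2).1 (a1.trans a2), ?_⟩
  rw [integral_Icc_eq_integral_Ioc, ← intervalIntegral.integral_of_le h2,
    ← intervalIntegral.integral_add_adjacent_intervals a1 a2]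
  have b1 : ∫ x in (0 : ℝ)..r, |r - x| ^ β = r ^ (β + 1) / (β + 1) := by
    have : ∫ x in (0 : ℝ)..r, |r - x| ^ β = ∫ x in (0 : ℝ)..r, (fun y => y ^ β) (r - x) := by
      refine intervalIntegral.integral_congr fun x hx => ?_
      rw [Set.uIcc_of_le h0] at hx
      simp only
      rw [abs_of_nonneg (by linarith [hx.2])]
    have h' := intervalIntegral.integral_comp_sub_left (a := 0) (b := r) (fun y : ℝ => y ^ β) r
    rw [this]
    refine h'.trans ?_
    rw [sub_self, sub_zero,
      integral_rpow (Or.inl hβ), Real.zero_rpow hb.ne', sub_zero]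
  have b2 : ∫ x in r..s, |r - x| ^ β = (s - r) ^ (β + 1) / (β + 1) := by
    have : ∫ x in r..s, |r - x| ^ β = ∫ x in r..s, (fun y => y ^ β) (x - r) := by
      refine intervalIntegral.integral_congr fun x hx => ?_
      rw [Set.uIcc_of_le h1] at hx
      simp only
      rw [abs_sub_comm, abs_of_nonneg (by linarith [hx.1])]
    have h' := intervalIntegral.integral_comp_sub_right (a := r) (b := s) (fun y : ℝ => y ^ β) r
    rw [this]
    refine h'.trans ?_
    rw [sub_self,
      integral_rpow (Or.inl hβ), Real.zero_rpow hb.ne', sub_zero]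
  rw [b1, b2]
  ring

lemma integrable_abs_sub_rpow (hβ : -1 < β) (T : ℝ) :
    Integrable (fun p : ℝ × ℝ => |p.1 - p.2| ^ β)
      ((volume.restrict (Set.Icc 0 T)).prod (volume.restrict (Set.Icc 0 T))) := by
  have hm : Measurable (fun p : ℝ × ℝ => |p.1 - p.2| ^ β) := by fun_prop
  rw [integrable_prod_iff hm.aestronglyMeasurable]
  constructor
  · refine (ae_restrict_iff' measurableSet_Icc).2 (Eventually.of_forall fun r hr => ?_)
    exact (integral_abs_sub_rpow hβ hr.1 hr.2).1
  · have hc : Continuous fun r : ℝ => (r ^ (β + 1) + (T - r) ^ (β + 1)) / (β + 1) := by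
      have h1 : Continuous fun r : ℝ => r ^ (β + 1) := Real.continuous_rpow_const (by linarith)
      exact (h1.add (h1.comp (continuous_const.sub continuous_id))).div_const _
    refine (hc.integrableOn_Icc (a := 0) (b := T)).congr ?_
    refine (ae_restrict_iff' measurableSet_Icc).2 (Eventually.of_forall fun r hr => ?_)
    refine (integral_abs_sub_rpow hβ hr.1 hr.2).2.symm.trans ?_
    refine integral_congr_ae (Eventually.of_forall fun x => ?_)
    simp only
    rw [Real.norm_of_nonneg (Real.rpow_nonneg (abs_nonneg _) _)]

/-- The kernel H(2H-1)|r-x|^{2H-2} is the mixed derivative of the covariance. With t ≤ s, the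
singularity of the inner integral lies in [0,s] for every r in [0,t], so both integrals are
explicit. -/
lemma fbmCov_eq_integral_of_le {H : ℝ} (hH : H ∈ Set.Ioo (1 / 2 : ℝ) 1) {t s : ℝ} (h0 : 0 ≤ t)
    (hts : t ≤ s) :
    fbmCov H t s = H * (2 * H - 1) *
      ∫ r in Set.Icc 0 t, ∫ x in Set.Icc 0 s, |r - x| ^ (2 * H - 2) := by
  obtain ⟨h1, h2⟩ := hH
  have e : ∫ r in Set.Icc 0 t, ∫ x in Set.Icc 0 s, |r - x| ^ (2 * H - 2)
      = ∫ r in Set.Icc 0 t, (r ^ (2 * H - 1) + (s - r) ^ (2 * H - 1)) / (2 * H - 1) := by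
    refine setIntegral_congr_fun measurableSet_Icc fun r hr => ?_
    rw [(integral_abs_sub_rpow (by linarith) hr.1 (hr.2.trans hts)).2,
      show 2 * H - 2 + 1 = 2 * H - 1 by ring]
  have c1 : Continuous fun r : ℝ => r ^ (2 * H - 1) := Real.continuous_rpow_const (by linarith)
  have c2 : Continuous fun r : ℝ => (s - r) ^ (2 * H - 1) :=
    c1.comp (continuous_const.sub continuous_id)
  have hne : 2 * H - 1 ≠ 0 := by linarith
  have hne2 : 2 * H ≠ 0 := by linarith
  have i2 : ∫ x in (0 : ℝ)..t, (s - x) ^ (2 * H - 1)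
      = (s ^ (2 * H) - (s - t) ^ (2 * H)) / (2 * H) := by
    have := intervalIntegral.integral_comp_sub_left (a := 0) (b := t)
      (fun y : ℝ => y ^ (2 * H - 1)) s
    rw [this, integral_rpow (Or.inl (by linarith)), sub_zero,
      show 2 * H - 1 + 1 = 2 * H by ring]
  rw [e, integral_Icc_eq_integral_Ioc, ← intervalIntegral.integral_of_le h0,
    intervalIntegral.integral_div, intervalIntegral.integral_add (c1.intervalIntegrable _ _)
      (c2.intervalIntegrable _ _), i2, integral_rpow (Or.inl (by linarith)),
    show 2 * H - 1 + 1 = 2 * H by ring, Real.zero_rpow hne2, fbmCov,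
    abs_sub_comm, abs_of_nonneg (sub_nonneg.2 hts)]
  field_simp
  ring

/-- Writing all the covariances over the same square [0,T]² lets the double sum in the variance of
an elementary integral pass under one integral. -/
lemma fbmCov_eq_integral {H : ℝ} (hH : H ∈ Set.Ioo (1 / 2 : ℝ) 1) {T t s : ℝ}
    (ht : t ∈ Set.Icc 0 T) (hs : s ∈ Set.Icc 0 T) :
    fbmCov H t s = H * (2 * H - 1) *
      ∫ p, |p.1 - p.2| ^ (2 * H - 2) *
        ((Set.Icc 0 t).indicator 1 p.1 * (Set.Icc 0 s).indicator 1 p.2)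
      ∂((volume.restrict (Set.Icc 0 T)).prod (volume.restrict (Set.Icc 0 T))) := by
  have hβ : -1 < 2 * H - 2 := by linarith [hH.1]
  have e : ∀ {t s : ℝ}, t ∈ Set.Icc 0 T → s ∈ Set.Icc 0 T →
      ∫ p, |p.1 - p.2| ^ (2 * H - 2) *
        ((Set.Icc 0 t).indicator 1 p.1 * (Set.Icc 0 s).indicator 1 p.2)
      ∂((volume.restrict (Set.Icc 0 T)).prod (volume.restrict (Set.Icc 0 T)))
      = ∫ p, |p.1 - p.2| ^ (2 * H - 2)
        ∂((volume.restrict (Set.Icc 0 t)).prod (volume.restrict (Set.Icc 0 s))) := by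
    intro t s ht hs
    have e1 : ∀ p : ℝ × ℝ, |p.1 - p.2| ^ (2 * H - 2) *
        ((Set.Icc 0 t).indicator 1 p.1 * (Set.Icc 0 s).indicator 1 p.2)
        = (Set.Icc 0 t ×ˢ Set.Icc 0 s).indicator (fun p => |p.1 - p.2| ^ (2 * H - 2)) p := by
      intro p
      rw [Set.indicator_apply, Set.indicator_apply, Set.indicator_apply]
      by_cases h1 : p.1 ∈ Set.Icc 0 t <;> by_cases h2 : p.2 ∈ Set.Icc 0 s <;>
        simp only [Set.mem_prod, h1, h2, and_self, and_true, and_false, if_true, if_false, Pi.one_apply,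
          mul_one, mul_zero]
    simp_rw [e1]
    rw [integral_indicator (measurableSet_Icc.prod measurableSet_Icc), Measure.prod_restrict,
      Measure.prod_restrict, Measure.restrict_restrict (measurableSet_Icc.prod measurableSet_Icc)]
    congr 2
    rw [Set.prod_inter_prod, Set.Icc_inter_Icc, Set.Icc_inter_Icc]
    simp [ht.2, hs.2]
  have hi : ∀ {t s : ℝ}, t ∈ Set.Icc 0 T → s ∈ Set.Icc 0 T →
      Integrable (fun p : ℝ × ℝ => |p.1 - p.2| ^ (2 * H - 2))
        ((volume.restrict (Set.Icc 0 t)).prod (volume.restrict (Set.Icc 0 s))) := by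
    intro t s ht hs
    refine (integrable_abs_sub_rpow hβ T).mono_measure ?_
    exact Measure.prod_mono (Measure.restrict_mono (Set.Icc_subset_Icc_right ht.2) le_rfl)
      (Measure.restrict_mono (Set.Icc_subset_Icc_right hs.2) le_rfl)
  rw [e ht hs]
  rcases le_total t s with h | h
  · rw [fbmCov_eq_integral_of_le hH ht.1 h, integral_prod _ (hi ht hs)]
  · have hsymm : fbmCov H t s = fbmCov H s t := by rw [fbmCov, fbmCov, abs_sub_comm]; ring
    have hsw : ∀ z : ℝ × ℝ, |z.swap.1 - z.swap.2| ^ (2 * H - 2) = |z.1 - z.2| ^ (2 * H - 2) :=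
      fun z => by rw [Prod.fst_swap, Prod.snd_swap, abs_sub_comm]
    rw [hsymm, fbmCov_eq_integral_of_le hH hs.1 h, ← integral_prod_swap]
    simp_rw [hsw]
    rw [integral_prod _ (hi hs ht)]

lemma timeEnergy_one_lt_top {H : ℝ} (hH : H ∈ Set.Ioo (1 / 2 : ℝ) 1) (T : ℝ) :
    timeEnergy H T 1 < ∞ := by
  have h := integrable_abs_sub_rpow (β := 2 * H - 2) (by linarith [hH.1]) T
  have h2 := (hasFiniteIntegral_iff_ofReal (Eventually.of_forall fun p =>
      Real.rpow_nonneg (abs_nonneg _) _)).1 h.2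
  rw [lintegral_prod _ (by fun_prop)] at h2
  simpa [timeEnergy, timeKernel] using h2

/-- The heat semigroup factor `1_{r<t} e^{-λ(t-r)}`. -/
def heatFactor (t lam r : ℝ) : ℝ≥0∞ := if r < t then ENNReal.ofReal (Real.exp (-(lam * (t - r)))) else 0

@[fun_prop] lemma measurable_heatFactor (t lam : ℝ) : Measurable (heatFactor t lam) :=
  Measurable.ite measurableSet_Iio (by fun_prop) (by fun_prop)

lemma lintegral_Ioi_rpow_mul_exp {a r : ℝ} (ha : 0 < a) (hr : 0 < r) :
    ∫⁻ x in Set.Ioi (0 : ℝ), ENNReal.ofReal (x ^ (a - 1) * Real.exp (-(r * x)))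
      = ENNReal.ofReal ((1 / r) ^ a * Real.Gamma a) := by
  rw [← Real.integral_rpow_mul_exp_neg_mul_Ioi ha hr, ofReal_integral_eq_lintegral_ofReal]
  · by_contra h
    have := Real.integral_rpow_mul_exp_neg_mul_Ioi ha hr
    rw [integral_undef h] at this
    have h2 := Real.Gamma_pos_of_pos ha
    have : 0 < (1 / r) ^ a * Real.Gamma a := by positivity
    linarith
  · exact (ae_restrict_iff' measurableSet_Ioi).2 (Eventually.of_forall fun x (hx : 0 < x) =>
      by positivity)

lemma lintegral_heatFactor {t lam : ℝ} (hlam : 0 < lam) :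
    ∫⁻ r, heatFactor t lam r = ENNReal.ofReal (1 / lam) := by
  have h := lintegral_Ioi_rpow_mul_exp (a := 1) one_pos hlam
  simp only [sub_self, Real.rpow_zero, one_mul, Real.rpow_one, Real.Gamma_one, mul_one] at h
  rw [← h, ← lintegral_sub_left_eq_self _ t, ← lintegral_indicator measurableSet_Ioi]
  refine lintegral_congr fun x => ?_
  simp only [heatFactor, Set.indicator, Set.mem_Ioi, sub_lt_self_iff, sub_sub_cancel]

lemma lintegral_timeKernel_mul_exp_le {H lam : ℝ} (hH : H ∈ Set.Ioo (1 / 2 : ℝ) 1)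
    (hlam : 0 < lam) (r : ℝ) :
    ∫⁻ s, timeKernel H r s * ENNReal.ofReal (Real.exp (-(lam * |r - s|)))
      ≤ 2 * ENNReal.ofReal ((1 / lam) ^ (2 * H - 1) * Real.Gamma (2 * H - 1)) := by
  set F : ℝ → ℝ≥0∞ := fun x => ENNReal.ofReal (|x| ^ (2 * H - 2) * Real.exp (-(lam * |x|))) with hF
  have e : ∫⁻ s, timeKernel H r s * ENNReal.ofReal (Real.exp (-(lam * |r - s|))) = ∫⁻ x, F x := by
    rw [← lintegral_sub_left_eq_self F r]
    refine lintegral_congr fun s => ?_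
    rw [timeKernel, ← ENNReal.ofReal_mul (by positivity)]
  have h := lintegral_Ioi_rpow_mul_exp (a := 2 * H - 1) (by linarith [hH.1]) hlam
  have e1 : ∫⁻ x in Set.Ioi (0 : ℝ), F x
      = ENNReal.ofReal ((1 / lam) ^ (2 * H - 1) * Real.Gamma (2 * H - 1)) := by
    rw [← h]
    refine setLIntegral_congr_fun measurableSet_Ioi fun x (hx : 0 < x) => ?_
    simp only [hF]
    rw [abs_of_pos hx]; ring_nf
  have e2 : ∫⁻ x in Set.Iic (0 : ℝ), F x = ∫⁻ x in Set.Ioi (0 : ℝ), F x := by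
    rw [← lintegral_indicator measurableSet_Iic, ← lintegral_indicator measurableSet_Ioi,
      ← lintegral_sub_left_eq_self _ 0]
    have : ∀ᵐ x : ℝ, x ≠ 0 := by simp [ae_iff, measure_singleton]
    refine lintegral_congr_ae ?_
    filter_upwards [this] with x hx
    have : (0 - x ∈ Set.Iic (0 : ℝ)) ↔ x ∈ Set.Ioi (0 : ℝ) := by
      simp only [zero_sub, Set.mem_Iic, Set.mem_Ioi, Left.neg_nonpos_iff]
      exact ⟨fun h => lt_of_le_of_ne h hx.symm, le_of_lt⟩
    by_cases hx2 : x ∈ Set.Ioi (0 : ℝ)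
    · rw [Set.indicator_of_mem hx2, Set.indicator_of_mem (this.2 hx2)]
      simp [hF]
    · rw [Set.indicator_of_notMem hx2, Set.indicator_of_notMem (mt this.1 hx2)]
  rw [e, ← lintegral_add_compl _ measurableSet_Iic, Set.compl_Iic, e2, e1]
  exact (two_mul _).ge

/-- For s ≤ r < t, e^{-λ(t-r)} e^{-λ(t-s)} = e^{-2λ(t-r)} e^{-λ(r-s)}. The first factor has integral
1/(2λ); the second, against the kernel, gives a Gamma integral of order λ^{1-2H}. Symmetry handles s
≥ r, and the product is of order λ^{-2H}. -/
lemma timeEnergy_heatFactor_le {H T t lam : ℝ} (hH : H ∈ Set.Ioo (1 / 2 : ℝ) 1)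
    (hlam : 0 < lam) :
    timeEnergy H T (heatFactor t lam)
      ≤ ENNReal.ofReal (2 * Real.Gamma (2 * H - 1) * (1 / lam) ^ (2 * H)) := by
  set k : ℝ → ℝ → ℝ≥0∞ := fun r s => timeKernel H r s * ENNReal.ofReal (Real.exp (-(lam * |r - s|)))
    with hk
  have hkm : Measurable fun p : ℝ × ℝ => k p.1 p.2 := (measurable_timeKernel H).mul (by fun_prop)
  have hkc : ∀ r s, k r s = k s r := fun r s => by
    simp only [hk]; rw [timeKernel_comm, abs_sub_comm]
  set E := heatFactor t (2 * lam) with hE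
  have hEm : Measurable E := measurable_heatFactor _ _
  have hpt : ∀ r s, timeKernel H r s * (heatFactor t lam r * heatFactor t lam s)
      ≤ E r * k r s + E s * k r s := by
    have key : ∀ r s, s ≤ r → timeKernel H r s * (heatFactor t lam r * heatFactor t lam s)
      ≤ E r * k r s := by
      intro r s hsr
      simp only [heatFactor, hE, hk]
      by_cases hr : r < t
      · rw [if_pos hr, if_pos (lt_of_le_of_lt hsr hr), if_pos hr,
          mul_left_comm (ENNReal.ofReal (Real.exp (-(2 * lam * (t - r))))),
          ← ENNReal.ofReal_mul (by positivity), ← ENNReal.ofReal_mul (by positivity),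
          ← Real.exp_add, ← Real.exp_add, abs_of_nonneg (sub_nonneg.2 hsr)]
        refine le_of_eq ?_
        congr 3
        ring
      · rw [if_neg hr]; simp
    intro r s
    rcases le_total s r with h | h
    · exact (key r s h).trans le_self_add
    · refine le_trans ?_ le_add_self
      rw [timeKernel_comm, mul_comm (heatFactor t lam r), hkc]
      exact key s r h
  set C := ENNReal.ofReal ((1 / lam) ^ (2 * H - 1) * Real.Gamma (2 * H - 1)) with hC
  have hK : ∀ r, ∫⁻ s, k r s ≤ 2 * C := fun r => lintegral_timeKernel_mul_exp_le hH hlam r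
  have hEi : ∫⁻ r, E r = ENNReal.ofReal (1 / (2 * lam)) := lintegral_heatFactor (by positivity)
  clear_value E k
  have h1 : ∫⁻ r, ∫⁻ s, E r * k r s ≤ ENNReal.ofReal (1 / (2 * lam)) * (2 * C) := by
    rw [← hEi, ← lintegral_mul_const _ hEm]
    refine lintegral_mono fun r => ?_
    rw [lintegral_const_mul]
    · exact mul_le_mul_right (hK r) _
    · exact hkm.comp (measurable_const.prodMk measurable_id)
  have h2 : ∫⁻ r, ∫⁻ s, E s * k r s = ∫⁻ r, ∫⁻ s, E r * k r s := by
    have m2 : Measurable (Function.uncurry fun r s => E s * k r s) :=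
      (hEm.comp measurable_snd).mul hkm
    rw [lintegral_lintegral_swap m2.aemeasurable]
    exact lintegral_congr fun r => lintegral_congr fun s => by rw [hkc]
  calc timeEnergy H T (heatFactor t lam)
      ≤ ∫⁻ r, ∫⁻ s, timeKernel H r s * (heatFactor t lam r * heatFactor t lam s) := by
        refine (setLIntegral_le_lintegral _ _).trans (lintegral_mono fun r => ?_)
        exact setLIntegral_le_lintegral _ _
    _ ≤ ∫⁻ r, ∫⁻ s, (E r * k r s + E s * k r s) :=
        lintegral_mono fun r => lintegral_mono fun s => hpt r s
    _ = (∫⁻ r, ∫⁻ s, E r * k r s) + ∫⁻ r, ∫⁻ s, E s * k r s := by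
        have m1 : Measurable fun p : ℝ × ℝ => E p.1 * k p.1 p.2 := (hEm.comp measurable_fst).mul hkm
        rw [← lintegral_add_left m1.lintegral_prod_right']
        refine lintegral_congr fun r => ?_
        rw [lintegral_add_left]
        exact m1.comp (measurable_const.prodMk measurable_id)
    _ ≤ ENNReal.ofReal (1 / (2 * lam)) * (2 * C) + ENNReal.ofReal (1 / (2 * lam)) * (2 * C) := by
        rw [h2]; exact add_le_add h1 h1
    _ = ENNReal.ofReal (2 * Real.Gamma (2 * H - 1) * (1 / lam) ^ (2 * H)) := by
        have hg : 0 < Real.Gamma (2 * H - 1) := Real.Gamma_pos_of_pos (by linarith [hH.1])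
        rw [hC, show (2 : ℝ≥0∞) = ENNReal.ofReal 2 by simp, ← ENNReal.ofReal_mul (by norm_num),
          ← ENNReal.ofReal_mul (by positivity),
          ← ENNReal.ofReal_add (by positivity) (by positivity)]
        congr 1
        rw [show 2 * H = 1 + (2 * H - 1) by ring, Real.rpow_add (by positivity), Real.rpow_one]
        rw [show 1 + (2 * H - 1) - 1 = 2 * H - 1 by ring]
        field_simp
        ring

/-- Interpolation between the bounded and the decaying regime. -/
lemma exists_timeEnergy_heatFactor_le {H T t p : ℝ} (hH : H ∈ Set.Ioo (1 / 2 : ℝ) 1)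
    (hp0 : 0 ≤ p) (hp : p ≤ 2 * H) :
    ∃ C : ℝ≥0, ∀ lam, 0 < lam →
      timeEnergy H T (heatFactor t lam) ≤ C * ENNReal.ofReal (lam ^ (-p)) := by
  have hg : 0 < Real.Gamma (2 * H - 1) := Real.Gamma_pos_of_pos (by linarith [hH.1])
  have h1 := (timeEnergy_one_lt_top hH T).ne
  refine ⟨(timeEnergy H T 1).toNNReal + (2 * Real.Gamma (2 * H - 1)).toNNReal, fun lam hlam => ?_⟩
  rw [ENNReal.coe_add, ENNReal.coe_toNNReal h1, add_mul]
  -- For λ ≤ 1 the heat factor is at most 1 and λ^{-p} ≥ 1; for λ ≥ 1 the decay λ^{-2H} is stronger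
  -- than λ^{-p}.
  rcases le_total lam 1 with h | h
  · refine le_trans ?_ le_self_add
    have : 1 ≤ ENNReal.ofReal (lam ^ (-p)) := by
      rw [ENNReal.one_le_ofReal]
      exact Real.one_le_rpow_of_pos_of_le_one_of_nonpos hlam h (by linarith)
    refine le_trans ?_ (le_mul_of_one_le_right' this)
    refine timeEnergy_mono fun r => ?_
    simp only [heatFactor, Pi.one_apply]
    split_ifs with hr
    · rw [ENNReal.ofReal_le_one, Real.exp_le_one_iff, neg_nonpos]
      exact mul_nonneg hlam.le (by linarith)
    · exact zero_le
  · refine le_trans ?_ le_add_self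
    refine (timeEnergy_heatFactor_le hH hlam).trans ?_
    rw [ENNReal.ofReal_mul (by positivity)]
    refine mul_le_mul' le_rfl (ENNReal.ofReal_le_ofReal ?_)
    rw [one_div, Real.inv_rpow hlam.le, ← Real.rpow_neg hlam.le]
    exact Real.rpow_le_rpow_of_exponent_le h (by linarith)

end TimeIntegral

/-! ### Fourier transforms of heat kernels and of indicators -/

section Fourier

open scoped FourierTransform Convolution ComplexConjugate

variable {d : ℕ}

lemma fourier_eq_fourierTransform (g : Space d → ℂ) (ξ : Space d) :
    fourier g ξ = 𝓕 g ((2 * Real.pi)⁻¹ • ξ) := by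
  rw [Real.fourier_eq', fourier]
  refine integral_congr_ae (Eventually.of_forall fun x => ?_)
  simp only [inner_smul_right, smul_eq_mul]
  rw [real_inner_comm]
  congr 2
  push_cast
  have : (Real.pi : ℂ) ≠ 0 := by exact_mod_cast Real.pi_ne_zero
  field_simp

lemma norm_cexp_neg_I_mul (a : ℝ) : ‖Complex.exp (-(Complex.I * (a : ℂ)))‖ = 1 := by
  rw [show -(Complex.I * (a : ℂ)) = ((-a : ℝ) : ℂ) * Complex.I by push_cast; ring]
  exact Complex.norm_exp_ofReal_mul_I _

lemma integrable_cexp_mul {g : Space d → ℂ} (hg : Integrable g) (ξ : Space d) :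
    Integrable fun x => Complex.exp (-(Complex.I * ((inner ℝ ξ x : ℝ) : ℂ))) * g x := by
  refine hg.bdd_mul (c := 1) (Continuous.aestronglyMeasurable (by fun_prop)) ?_
  exact Eventually.of_forall fun x => (norm_cexp_neg_I_mul _).le

lemma norm_fourier_le (g : Space d → ℂ) (ξ : Space d) : ‖fourier g ξ‖ ≤ ∫ x, ‖g x‖ := by
  refine (norm_integral_le_integral_norm _).trans (le_of_eq ?_)
  refine integral_congr_ae (Eventually.of_forall fun x => ?_)
  simp only
  rw [norm_mul, norm_cexp_neg_I_mul, one_mul]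

lemma continuous_fourier {g : Space d → ℂ} (hg : Integrable g) : Continuous (fourier g) := by
  refine continuous_of_dominated (bound := fun x => ‖g x‖)
    (fun ξ => (integrable_cexp_mul hg ξ).aestronglyMeasurable)
    (fun ξ => Eventually.of_forall fun x => ?_) hg.norm (Eventually.of_forall fun x => by fun_prop)
  rw [norm_mul, norm_cexp_neg_I_mul, one_mul]

lemma fourier_add {g h : Space d → ℂ} (hg : Integrable g) (hh : Integrable h) (ξ : Space d) :
    fourier (fun x => g x + h x) ξ = fourier g ξ + fourier h ξ := by
  simp only [fourier, mul_add]
  exact integral_add (integrable_cexp_mul hg ξ) (integrable_cexp_mul hh ξ)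

lemma fourier_const_mul (c : ℂ) (g : Space d → ℂ) (ξ : Space d) :
    fourier (fun x => c * g x) ξ = c * fourier g ξ := by
  simp only [fourier]
  rw [← integral_const_mul]
  exact integral_congr_ae (Eventually.of_forall fun x => by simp only; ring)

lemma fourier_finset_sum {ι : Type*} (s : Finset ι) (g : ι → Space d → ℂ)
    (hg : ∀ i ∈ s, Integrable (g i)) (ξ : Space d) :
    fourier (fun x => ∑ i ∈ s, g i x) ξ = ∑ i ∈ s, fourier (g i) ξ := by
  simp only [fourier, Finset.mul_sum]
  exact integral_finsetSum _ fun i hi => integrable_cexp_mul (hg i hi) ξ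

/-- The Fourier transform of a translate of the heat kernel. -/
lemma fourier_heatKernel {τ : ℝ} (hτ : 0 < τ) (x ξ : Space d) :
    fourier (fun y => ((heatKernel τ (x - y) : ℝ) : ℂ)) ξ
      = Complex.exp (-(Complex.I * ((inner ℝ ξ x : ℝ) : ℂ)))
        * ((Real.exp (-(τ * (‖ξ‖ ^ 2 / 2))) : ℝ) : ℂ) := by
  have hb : 0 < ((1 / (2 * τ) : ℝ) : ℂ).re := by rw [Complex.ofReal_re]; positivity
  have h := GaussianFourier.integral_cexp_neg_mul_sq_norm_add hb Complex.I ξ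
  have e : fourier (fun y => ((heatKernel τ (x - y) : ℝ) : ℂ)) ξ
      = ∫ y, Complex.exp (-(Complex.I * ((inner ℝ ξ x : ℝ) : ℂ)))
        * ((((2 * Real.pi * τ) ^ (-(d : ℝ) / 2) : ℝ) : ℂ)
          * Complex.exp (-((1 / (2 * τ) : ℝ) : ℂ) * ‖y‖ ^ 2 + Complex.I * ((inner ℝ ξ y : ℝ) : ℂ))) := by
    rw [fourier, ← integral_sub_left_eq_self _ _ x]
    refine integral_congr_ae (Eventually.of_forall fun y => ?_)
    simp only [heatKernel, if_pos hτ, sub_sub_cancel, inner_sub_right]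
    rw [Complex.ofReal_mul, mul_left_comm, mul_left_comm (Complex.exp _), Complex.ofReal_exp,
      ← Complex.exp_add, ← Complex.exp_add]
    congr 2
    push_cast
    have : (τ : ℂ) ≠ 0 := by exact_mod_cast hτ.ne'
    field_simp
    ring
  rw [e, integral_const_mul, integral_const_mul, h]
  congr 1
  have h2 : (Real.pi / ((1 / (2 * τ) : ℝ) : ℂ)) ^ ((Module.finrank ℝ (Space d) : ℂ) / 2)
      = (((2 * Real.pi * τ) ^ ((d : ℝ) / 2) : ℝ) : ℂ) := by
    rw [Complex.ofReal_cpow (by positivity), finrank_euclideanSpace_fin]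
    push_cast
    congr 1
    have : (τ : ℂ) ≠ 0 := by exact_mod_cast hτ.ne'
    field_simp
  rw [h2, ← mul_assoc, ← Complex.ofReal_mul, ← Real.rpow_add (by positivity)]
  rw [show -(d : ℝ) / 2 + d / 2 = 0 by ring, Real.rpow_zero, Complex.ofReal_one, one_mul,
    Complex.ofReal_exp]
  congr 1
  push_cast
  rw [Complex.I_sq]
  have : (τ : ℂ) ≠ 0 := by exact_mod_cast hτ.ne'
  field_simp
  norm_num

lemma integrable_heatKernel (τ : ℝ) (x : Space d) :
    Integrable fun y => heatKernel τ (x - y) := by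
  by_cases hτ : 0 < τ
  · simp only [heatKernel, if_pos hτ]
    refine Integrable.const_mul ?_ _
    have h := GaussianFourier.integrable_cexp_neg_mul_sq_norm_add (V := Space d)
      (b := ((1 / (2 * τ) : ℝ) : ℂ)) (by rw [Complex.ofReal_re]; positivity) 0 0
    have h2 := (h.norm).comp_sub_left x
    refine h2.congr (Eventually.of_forall fun y => ?_)
    simp only [inner_zero_left, Complex.ofReal_zero, mul_zero, add_zero, Complex.norm_exp]
    congr 1
    rw [← Complex.ofReal_pow, ← Complex.ofReal_neg, ← Complex.ofReal_mul, Complex.ofReal_re]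
    field_simp
  · simp [heatKernel, hτ]

/-! ### Indicators and their cross-correlation -/

/-- The complex indicator function of `A`. -/
def indC (A : Set (Space d)) : Space d → ℂ := A.indicator fun _ => 1

/-- The cross-correlation `w ↦ |A ∩ (B + w)|`. -/
def crossCorr (A B : Set (Space d)) : Space d → ℂ :=
  indC A ⋆[ContinuousLinearMap.mul ℂ ℂ, volume] fun y => indC B (-y)

lemma norm_indC_le (A : Set (Space d)) (x : Space d) : ‖indC A x‖ ≤ 1 := by
  by_cases h : x ∈ A <;> simp [indC, h]

variable {A B : Set (Space d)}

lemma integrable_indC (hA : MeasurableSet A) (hA' : Bornology.IsBounded A) :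
    Integrable (indC A) := by
  rw [indC, integrable_indicator_iff hA]
  exact integrableOn_const hA'.measure_lt_top.ne

lemma crossCorr_apply (w : Space d) : crossCorr A B w = ∫ t, indC A t * indC B (t - w) := by
  rw [crossCorr, convolution_def]
  simp

lemma integrable_crossCorr (hA : MeasurableSet A) (hA' : Bornology.IsBounded A)
    (hB : MeasurableSet B) (hB' : Bornology.IsBounded B) : Integrable (crossCorr A B) :=
  (integrable_indC hA hA').integrable_convolution _ (integrable_indC hB hB').comp_neg

lemma integral_norm_indC (hA : MeasurableSet A) : ∫ x, ‖indC A x‖ = volume.real A := by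
  have : ∀ x, ‖indC A x‖ = A.indicator (fun _ => (1 : ℝ)) x := fun x => by
    by_cases h : x ∈ A <;> simp [indC, h]
  simp_rw [this]
  rw [integral_indicator hA]
  simp

lemma norm_crossCorr_le (hA : MeasurableSet A) (hA' : Bornology.IsBounded A) (w : Space d) :
    ‖crossCorr A B w‖ ≤ volume.real A := by
  rw [crossCorr_apply, ← integral_norm_indC hA]
  refine norm_integral_le_of_norm_le (integrable_indC hA hA').norm (Eventually.of_forall fun t => ?_)
  rw [norm_mul]
  exact mul_le_of_le_one_right (norm_nonneg _) (norm_indC_le _ _)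

lemma crossCorr_eq_zero {R : ℝ} (hA : ∀ x ∈ A, ‖x‖ ≤ R) (hB : ∀ x ∈ B, ‖x‖ ≤ R)
    {w : Space d} (hw : 2 * R < ‖w‖) : crossCorr A B w = 0 := by
  rw [crossCorr_apply]
  refine integral_eq_zero_of_ae (Eventually.of_forall fun t => ?_)
  by_cases h : t ∈ A
  · by_cases h' : t - w ∈ B
    · have h1 := hA _ h
      have h2 := hB _ h'
      have h3 := norm_sub_le t (t - w)
      rw [sub_sub_cancel] at h3
      linarith
    · simp [indC, h']
  · simp [indC, h]

lemma fourier_indC_neg (ξ : Space d) :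
    fourier (fun y => indC B (-y)) ξ = conj (fourier (indC B) ξ) := by
  rw [fourier, fourier, ← integral_conj, ← integral_neg_eq_self]
  refine integral_congr_ae (Eventually.of_forall fun y => ?_)
  simp only [neg_neg, map_mul, inner_neg_right]
  rw [← Complex.exp_conj]
  congr 1
  · simp
  · by_cases h : y ∈ B <;> simp [indC, h]

/-- Convolution theorem; the reflection becomes a conjugate because an indicator is real. -/
lemma fourier_crossCorr (hA : MeasurableSet A) (hA' : Bornology.IsBounded A)
    (hB : MeasurableSet B) (hB' : Bornology.IsBounded B) (ξ : Space d) :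
    fourier (crossCorr A B) ξ = fourier (indC A) ξ * conj (fourier (indC B) ξ) := by
  rw [← fourier_indC_neg, fourier_eq_fourierTransform, crossCorr,
    Real.fourier_mul_convolution_eq (integrable_indC hA hA') (integrable_indC hB hB').comp_neg,
    ← fourier_eq_fourierTransform, ← fourier_eq_fourierTransform]

/-- Integrating the Fourier transform against a Gaussian. -/
lemma integral_fourier_mul_gaussian {h : Space d → ℂ} (hh : Integrable h) {c : ℝ}
    (hc : ∀ x, ‖h x‖ ≤ c) {τ : ℝ} (hτ : 0 < τ) :
    ‖∫ ξ, fourier h ξ * ((Real.exp (-(τ * (‖ξ‖ ^ 2 / 2))) : ℝ) : ℂ)‖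
      ≤ (2 * Real.pi) ^ d * c := by
  have hd : Module.finrank ℝ (Space d) = d := finrank_euclideanSpace_fin
  have hb : 0 < ((τ / 2 : ℝ) : ℂ).re := by rw [Complex.ofReal_re]; positivity
  have hG : Integrable fun ξ : Space d => ((Real.exp (-(τ * (‖ξ‖ ^ 2 / 2))) : ℝ) : ℂ) := by
    refine (GaussianFourier.integrable_cexp_neg_mul_sq_norm_add (V := Space d) hb 0 0).congr
      (Eventually.of_forall fun y => ?_)
    simp only [inner_zero_left, Complex.ofReal_zero, mul_zero, add_zero]
    push_cast
    congr 1; ring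
  -- the Fourier transform of the Gaussian
  have hFG : ∀ x : Space d, ∫ ξ, Complex.exp (-(Complex.I * ((inner ℝ ξ x : ℝ) : ℂ)))
      * ((Real.exp (-(τ * (‖ξ‖ ^ 2 / 2))) : ℝ) : ℂ)
      = (((2 * Real.pi / τ) ^ ((d : ℝ) / 2) * Real.exp (-(1 / (2 * τ)) * ‖x‖ ^ 2) : ℝ) : ℂ) := by
    intro x
    have h1 := GaussianFourier.integral_cexp_neg_mul_sq_norm_add hb (-Complex.I) x
    have h2 : (Real.pi / ((τ / 2 : ℝ) : ℂ)) ^ ((Module.finrank ℝ (Space d) : ℂ) / 2)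
        = (((2 * Real.pi / τ) ^ ((d : ℝ) / 2) : ℝ) : ℂ) := by
      rw [Complex.ofReal_cpow (by positivity), hd]
      push_cast
      congr 1
      have : (τ : ℂ) ≠ 0 := by exact_mod_cast hτ.ne'
      field_simp
    rw [h2] at h1
    rw [Complex.ofReal_mul, Complex.ofReal_exp]
    refine Eq.trans ?_ (h1.trans ?_)
    · refine integral_congr_ae (Eventually.of_forall fun y => ?_)
      simp only
      rw [real_inner_comm, Complex.ofReal_exp, ← Complex.exp_add]
      congr 1
      push_cast
      ring
    · congr 2
      push_cast
      rw [neg_sq, Complex.I_sq]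
      have : (τ : ℂ) ≠ 0 := by exact_mod_cast hτ.ne'
      field_simp
      norm_num
  -- Fubini moves the transform onto the Gaussian. The resulting kernel has total mass (2π)^d for
  -- every τ, which makes the bound uniform as τ tends to 0.
  have hswap : ∫ ξ, fourier h ξ * ((Real.exp (-(τ * (‖ξ‖ ^ 2 / 2))) : ℝ) : ℂ)
      = ∫ x, h x * (((2 * Real.pi / τ) ^ ((d : ℝ) / 2)
        * Real.exp (-(1 / (2 * τ)) * ‖x‖ ^ 2) : ℝ) : ℂ) := by
    simp_rw [← hFG, fourier, ← integral_mul_const, ← integral_const_mul]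
    rw [integral_integral_swap]
    · refine integral_congr_ae (Eventually.of_forall fun x => ?_)
      refine integral_congr_ae (Eventually.of_forall fun ξ => ?_)
      simp only; ring
    · have := (hG.mul_prod hh).bdd_mul (c := 1)
        (f := fun p : Space d × Space d => Complex.exp (-(Complex.I * ((inner ℝ p.1 p.2 : ℝ) : ℂ))))
        (Continuous.aestronglyMeasurable (by fun_prop))
        (Eventually.of_forall fun p => (norm_cexp_neg_I_mul _).le)
      refine this.congr (Eventually.of_forall fun p => ?_)
      simp only [Function.uncurry]; ring
  have hGx : Integrable fun x : Space d => Real.exp (-(1 / (2 * τ)) * ‖x‖ ^ 2) := by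
    have h1 := (GaussianFourier.integrable_cexp_neg_mul_sq_norm_add (V := Space d)
      (b := ((1 / (2 * τ) : ℝ) : ℂ)) (by rw [Complex.ofReal_re]; positivity) 0 0).norm
    refine h1.congr (Eventually.of_forall fun y => ?_)
    simp only [inner_zero_left, Complex.ofReal_zero, mul_zero, add_zero, Complex.norm_exp]
    rw [← Complex.ofReal_pow, ← Complex.ofReal_neg, ← Complex.ofReal_mul, Complex.ofReal_re]
  rw [hswap]
  refine (norm_integral_le_of_norm_le (hGx.const_mul (c * (2 * Real.pi / τ) ^ ((d : ℝ) / 2)))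
    (Eventually.of_forall fun x => ?_)).trans (le_of_eq ?_)
  · rw [norm_mul, Complex.norm_real, Real.norm_of_nonneg (by positivity), mul_assoc]
    gcongr
    exact hc x
  · rw [integral_const_mul, GaussianFourier.integral_rexp_neg_mul_sq_norm (by positivity), hd,
      mul_assoc, ← Real.mul_rpow (by positivity) (by positivity), mul_comm c]
    congr 1
    rw [show 2 * Real.pi / τ * (Real.pi / (1 / (2 * τ))) = (2 * Real.pi) ^ 2 by field_simp,
      ← Real.rpow_natCast, ← Real.rpow_mul (by positivity)]
    rw [← Real.rpow_natCast]
    congr 1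
    push_cast; ring

/-- The Fourier transform of a bounded set is square integrable. -/
lemma lintegral_enorm_fourier_indC_sq_lt_top (hA : MeasurableSet A)
    (hA' : Bornology.IsBounded A) : ∫⁻ ξ, ‖fourier (indC A) ξ‖ₑ ^ 2 < ∞ := by
  set c := (2 * Real.pi) ^ d * volume.real A with hc
  have hcont := continuous_fourier (integrable_indC hA hA')
  set G : ℕ → Space d → ℝ := fun n ξ => ‖fourier (indC A) ξ‖ ^ 2
    * Real.exp (-(1 / (n + 1 : ℝ) * (‖ξ‖ ^ 2 / 2))) with hG
  have hGc : ∀ n, Continuous (G n) := fun n => by fun_prop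
  have hG0 : ∀ n ξ, 0 ≤ G n ξ := fun n ξ => by positivity
  -- Half of Plancherel, with τ = 1/(n+1): the autocorrelation of A has transform |ℱ1_A|² and is
  -- bounded by |A|. Fatou then removes the Gaussian.
  have key : ∀ n : ℕ, ∫⁻ ξ, ENNReal.ofReal (G n ξ) ≤ ENNReal.ofReal c := by
    intro n
    have hτ : (0 : ℝ) < 1 / (n + 1) := by positivity
    have h1 := integral_fourier_mul_gaussian (integrable_crossCorr hA hA' hA hA')
      (fun w => norm_crossCorr_le hA hA' w) hτ
    have h2 : ∀ ξ, fourier (crossCorr A A) ξ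
        * ((Real.exp (-(1 / (n + 1 : ℝ) * (‖ξ‖ ^ 2 / 2))) : ℝ) : ℂ) = ((G n ξ : ℝ) : ℂ) := by
      intro ξ
      rw [fourier_crossCorr hA hA' hA hA', Complex.mul_conj, Complex.normSq_eq_norm_sq,
        ← Complex.ofReal_mul]
    simp_rw [h2] at h1
    rw [integral_complex_ofReal, Complex.norm_real] at h1
    have hint : Integrable (G n) := by
      have hE : Integrable fun ξ : Space d => Real.exp (-(1 / (n + 1 : ℝ) * (‖ξ‖ ^ 2 / 2))) := by
        have h1 := (GaussianFourier.integrable_cexp_neg_mul_sq_norm_add (V := Space d)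
          (b := ((1 / (n + 1) / 2 : ℝ) : ℂ)) (by rw [Complex.ofReal_re]; positivity) 0 0).norm
        refine h1.congr (Eventually.of_forall fun y => ?_)
        simp only [inner_zero_left, Complex.ofReal_zero, mul_zero, add_zero, Complex.norm_exp]
        rw [← Complex.ofReal_pow, ← Complex.ofReal_neg, ← Complex.ofReal_mul, Complex.ofReal_re]
        congr 1; ring
      refine hE.bdd_mul (c := (volume.real A) ^ 2) (hcont.norm.pow 2).aestronglyMeasurable ?_
      refine Eventually.of_forall fun ξ => ?_
      rw [norm_pow, norm_norm]
      exact pow_le_pow_left₀ (norm_nonneg _) ((norm_fourier_le _ _).trans_eq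
        (integral_norm_indC hA)) 2
    rw [← ofReal_integral_eq_lintegral_ofReal hint (Eventually.of_forall (hG0 n))]
    exact ENNReal.ofReal_le_ofReal ((le_abs_self _).trans h1)
  have hlim : ∀ ξ, Tendsto (fun n => ENNReal.ofReal (G n ξ)) atTop
      (𝓝 (‖fourier (indC A) ξ‖ₑ ^ 2)) := by
    intro ξ
    rw [← ofReal_norm, ← ENNReal.ofReal_pow (norm_nonneg _)]
    refine (ENNReal.continuous_ofReal.tendsto _).comp ?_
    have h1 : Tendsto (fun n : ℕ => Real.exp (-(1 / (n + 1 : ℝ) * (‖ξ‖ ^ 2 / 2)))) atTop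
        (𝓝 (Real.exp (-(0 * (‖ξ‖ ^ 2 / 2))))) :=
      (Real.continuous_exp.tendsto _).comp
        ((tendsto_one_div_add_atTop_nhds_zero_nat.mul_const _).neg)
    simpa [hG] using h1.const_mul (‖fourier (indC A) ξ‖ ^ 2)
  calc ∫⁻ ξ, ‖fourier (indC A) ξ‖ₑ ^ 2
      = ∫⁻ ξ, liminf (fun n => ENNReal.ofReal (G n ξ)) atTop :=
        lintegral_congr fun ξ => (hlim ξ).liminf_eq.symm
    _ ≤ liminf (fun n => ∫⁻ ξ, ENNReal.ofReal (G n ξ)) atTop :=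
        lintegral_liminf_le fun n => (hGc n).measurable.ennreal_ofReal
    _ ≤ ENNReal.ofReal c := by
        refine liminf_le_of_le (by isBoundedDefault) fun b hb => ?_
        obtain ⟨n, hn⟩ := hb.exists
        exact hn.trans (key n)
    _ < ∞ := ENNReal.ofReal_lt_top

end Fourier

/-! ### The spatial covariance in spectral form -/

section Covariance

open scoped Convolution ComplexConjugate

variable {d : ℕ}

lemma lintegral_ball_norm_rpow_lt_top {p : ℝ} (hd : 0 < d) (hp : -(d : ℝ) < p) :
    ∫⁻ ξ in Metric.ball (0 : Space d) 1, ENNReal.ofReal (‖ξ‖ ^ p) < ∞ := by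
  have : Nonempty (Fin d) := ⟨⟨0, hd⟩⟩
  have h : IntegrableOn (fun ξ : Space d => ‖ξ‖ ^ p) (Metric.ball 0 1) := by
    rw [integrableOn_fun_norm_addHaar (μ := volume) (f := fun y : ℝ => y ^ p)]
    have h1 := (intervalIntegral.intervalIntegrable_rpow' (a := 0) (b := 1)
      (r := (d : ℝ) - 1 + p) (by linarith)).1
    refine (h1.mono_set Set.Ioo_subset_Ioc_self).congr_fun (fun y hy => ?_) measurableSet_Ioo
    have hy0 : 0 < y := hy.1
    simp only [finrank_euclideanSpace_fin, smul_eq_mul]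
    rw [Real.rpow_add hy0, ← Real.rpow_natCast, Nat.cast_sub hd, Nat.cast_one]
  exact (hasFiniteIntegral_iff_ofReal (Eventually.of_forall fun ξ =>
    Real.rpow_nonneg (norm_nonneg _) _)).1 h.2

lemma lintegral_compl_ball_norm_rpow_lt_top {p : ℝ} (hp : (d : ℝ) < p) :
    ∫⁻ ξ in (Metric.ball (0 : Space d) 1)ᶜ, ENNReal.ofReal (‖ξ‖ ^ (-p)) < ∞ := by
  have hp0 : 0 < p := lt_of_le_of_lt (Nat.cast_nonneg d) hp
  have h := integrable_one_add_norm (E := Space d) (μ := volume) (r := p)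
    (by rw [finrank_euclideanSpace_fin]; exact hp)
  have h2 := (hasFiniteIntegral_iff_ofReal (Eventually.of_forall fun ξ : Space d =>
    Real.rpow_nonneg (by positivity : 0 ≤ 1 + ‖ξ‖) (-p))).1 h.2
  have h3 : ∫⁻ ξ in (Metric.ball (0 : Space d) 1)ᶜ, ENNReal.ofReal (‖ξ‖ ^ (-p))
      ≤ ∫⁻ ξ : Space d, ENNReal.ofReal (2 ^ p) * ENNReal.ofReal ((1 + ‖ξ‖) ^ (-p)) := by
    refine le_trans (setLIntegral_mono' measurableSet_ball.compl fun ξ hξ => ?_)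
      (setLIntegral_le_lintegral _ _)
    have h1 : 1 ≤ ‖ξ‖ := by simpa using hξ
    rw [← ENNReal.ofReal_mul (by positivity)]
    refine ENNReal.ofReal_le_ofReal ?_
    calc ‖ξ‖ ^ (-p) = 2 ^ p * (2 * ‖ξ‖) ^ (-p) := by
          rw [Real.mul_rpow (by norm_num) (by positivity), ← mul_assoc,
            ← Real.rpow_add (by norm_num), add_neg_cancel, Real.rpow_zero, one_mul]
      _ ≤ 2 ^ p * (1 + ‖ξ‖) ^ (-p) := by
          gcongr ?_ * ?_
          exact Real.rpow_le_rpow_of_nonpos (by positivity) (by linarith) (by linarith)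
  refine h3.trans_lt ?_
  rw [lintegral_const_mul _ (by fun_prop)]
  exact ENNReal.mul_lt_top ENNReal.ofReal_lt_top h2

variable {A B : Set (Space d)} {α : ℝ} {μ : Measure (Space d)} {C : ℝ≥0}

lemma lintegral_le_of_le_smul (hμ : μ ≤ C • rieszMeasure d α) {g : Space d → ℝ≥0∞}
    (hg : Measurable g) :
    ∫⁻ ξ, g ξ ∂μ ≤ C * ∫⁻ ξ, g ξ * ENNReal.ofReal (‖ξ‖ ^ (-α)) := by
  rw [← lintegral_rieszMeasure α hg]
  refine (lintegral_mono' hμ le_rfl).trans (le_of_eq ?_)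
  rw [lintegral_smul_measure]
  rfl

/-- In the unit ball the transform is bounded and |ξ|^{-α} is integrable since α < d; outside it the
density is at most 1 and the transform is square integrable. -/
lemma lintegral_enorm_fourier_indC_sq_measure_lt_top (hα : α ∈ Set.Ioo (0 : ℝ) d)
    (hμ : μ ≤ C • rieszMeasure d α) (hA : MeasurableSet A) (hA' : Bornology.IsBounded A) :
    ∫⁻ ξ, ‖fourier (indC A) ξ‖ₑ ^ 2 ∂μ < ∞ := by
  have hd : 0 < d := by
    have := hα.1.trans hα.2
    exact_mod_cast this
  have hcont := continuous_fourier (integrable_indC hA hA')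
  refine (lintegral_le_of_le_smul hμ (hcont.enorm.measurable.pow_const 2)).trans_lt
    (ENNReal.mul_lt_top ENNReal.coe_lt_top ?_)
  rw [← lintegral_add_compl _ (measurableSet_ball (x := (0 : Space d)) (ε := 1))]
  refine ENNReal.add_lt_top.2 ⟨?_, ?_⟩
  · refine lt_of_le_of_lt (lintegral_mono fun ξ => ?_) (b := ∫⁻ ξ in Metric.ball (0 : Space d) 1,
      ENNReal.ofReal (volume.real A) ^ 2 * ENNReal.ofReal (‖ξ‖ ^ (-α))) ?_
    · gcongr
      rw [← ofReal_norm]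
      exact ENNReal.ofReal_le_ofReal ((norm_fourier_le _ _).trans_eq (integral_norm_indC hA))
    · rw [lintegral_const_mul _ (measurable_ofReal_norm_rpow _)]
      exact ENNReal.mul_lt_top (ENNReal.pow_lt_top ENNReal.ofReal_lt_top)
        (lintegral_ball_norm_rpow_lt_top hd (by linarith [hα.2]))
  · refine lt_of_le_of_lt ?_ (lintegral_enorm_fourier_indC_sq_lt_top hA hA')
    refine le_trans (setLIntegral_mono' measurableSet_ball.compl fun ξ hξ => ?_)
      (setLIntegral_le_lintegral _ _)
    have h1 : 1 ≤ ‖ξ‖ := by simpa using hξ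
    refine mul_le_of_le_one_right' ?_
    rw [ENNReal.ofReal_le_one]
    exact Real.rpow_le_one_of_one_le_of_nonpos h1 (by linarith [hα.1])

lemma integrable_fourier_indC_mul (hα : α ∈ Set.Ioo (0 : ℝ) d)
    (hμ : μ ≤ C • rieszMeasure d α) (hA : MeasurableSet A) (hA' : Bornology.IsBounded A)
    (hB : MeasurableSet B) (hB' : Bornology.IsBounded B) :
    Integrable (fun ξ => fourier (indC A) ξ * conj (fourier (indC B) ξ)) μ := by
  have h : ∀ {A : Set (Space d)}, MeasurableSet A → Bornology.IsBounded A →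
      MemLp (fourier (indC A)) 2 μ := by
    intro A hA hA'
    refine ⟨(continuous_fourier (integrable_indC hA hA')).aestronglyMeasurable, ?_⟩
    rw [eLpNorm_lt_top_iff_lintegral_rpow_enorm_lt_top (by norm_num) (by norm_num)]
    simpa using lintegral_enorm_fourier_indC_sq_measure_lt_top hα hμ hA hA'
  exact (h hA hA').integrable_mul (h hB hB').star

/-- The integrability clause is tested on a bump function equal to 1 on the ball; |R| keeps the
radii positive for every R. -/
lemma IsFourierTransformOf.integrableOn_closedBall {f : Space d → ℝ}
    (hf : IsFourierTransformOf f μ) (R : ℝ) : IntegrableOn f (Metric.closedBall 0 R) := by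
  let φ : ContDiffBump (0 : Space d) := ⟨|R| + 1, |R| + 2, by positivity, by linarith⟩
  have hc : HasCompactSupport fun x => ((φ x : ℝ) : ℂ) :=
    φ.hasCompactSupport.comp_left (g := fun r : ℝ => (r : ℂ)) Complex.ofReal_zero
  have hs : ContDiff ℝ (⊤ : ℕ∞) fun x => ((φ x : ℝ) : ℂ) :=
    Complex.ofRealCLM.contDiff.comp φ.contDiff
  have h := (hf (hc.toSchwartzMap hs)).1
  have h2 := (h.re).integrableOn (s := Metric.closedBall 0 R)
  refine h2.congr_fun (fun x hx => ?_) measurableSet_closedBall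
  have : φ x = 1 := φ.one_of_mem_closedBall (by
    rw [mem_closedBall_zero_iff] at hx ⊢
    exact hx.trans ((le_abs_self R).trans (by simp [φ])))
  have e : (hc.toSchwartzMap hs) x = 1 := by
    rw [HasCompactSupport.toSchwartzMap_toFun, this, Complex.ofReal_one]
  simp [e]

lemma IsFourierTransformOf.aestronglyMeasurable {f : Space d → ℝ}
    (hf : IsFourierTransformOf f μ) : AEStronglyMeasurable f := by
  have h : LocallyIntegrable f := by
    intro x
    refine ⟨Metric.closedBall 0 (‖x‖ + 1), ?_, hf.integrableOn_closedBall _⟩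
    refine Filter.mem_of_superset (Metric.ball_mem_nhds x one_pos) fun y hy => ?_
    rw [mem_closedBall_zero_iff]
    have h1 := norm_sub_norm_le y x
    rw [Metric.mem_ball, dist_eq_norm] at hy
    linarith
  exact h.aestronglyMeasurable

/-- Mollification of a bounded compactly supported function. -/
lemma tendsto_integral_mul_mollify {f : Space d → ℝ} (hf : IsFourierTransformOf f μ)
    {h : Space d → ℂ} (hh : Integrable h) {c R : ℝ} (hc : ∀ x, ‖h x‖ ≤ c)
    (hR : ∀ x, R < ‖x‖ → h x = 0) (hμ : Integrable (fourier h) μ) :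
    ∫ x, (f x : ℂ) * h x = ∫ ξ, fourier h ξ ∂μ := by
  have hc0 : 0 ≤ c := (norm_nonneg _).trans (hc 0)
  -- The outer radius tends to 0 with ratio 2 to the inner one; the bounded ratio gives almost
  -- everywhere convergence of the mollifications, which is needed since h is not assumed
  -- continuous.
  let φ : ℕ → ContDiffBump (0 : Space d) := fun n =>
    ⟨1 / (n + 1 : ℝ) / 2, 1 / (n + 1 : ℝ), by positivity, half_lt_self (by positivity)⟩
  have hφ : Tendsto (fun n => (φ n).rOut) atTop (𝓝 0) := tendsto_one_div_add_atTop_nhds_zero_nat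
  have hφ1 : ∀ n, (φ n).rOut ≤ 1 := fun n => by
    simp only [φ]
    rw [div_le_one (by positivity)]
    linarith [(Nat.cast_nonneg n : (0 : ℝ) ≤ n)]
  set ρ : ℕ → Space d → ℝ := fun n => (φ n).normed volume with hρ
  set ψ : ℕ → Space d → ℂ := fun n => ρ n ⋆[ContinuousLinearMap.lsmul ℝ ℝ, volume] h with hψ
  have hψa : ∀ n x, ψ n x = ∫ t, ρ n t • h (x - t) := fun n x => by
    simp only [hψ]; rw [convolution_def]; rfl
  have hρ0 : ∀ n x, 0 ≤ ρ n x := fun n x => (φ n).nonneg_normed x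
  have hρi : ∀ n, Integrable (ρ n) := fun n => (φ n).integrable_normed
  have hρ1 : ∀ n, ∫ x, ρ n x = 1 := fun n => (φ n).integral_normed
  have hψb : ∀ n x, ‖ψ n x‖ ≤ c := by
    intro n x
    rw [hψa]
    refine (norm_integral_le_of_norm_le ((hρi n).mul_const c)
      (Eventually.of_forall fun t => ?_)).trans_eq ?_
    · rw [norm_smul, Real.norm_of_nonneg (hρ0 n t)]
      exact mul_le_mul_of_nonneg_left (hc _) (hρ0 n t)
    · rw [integral_mul_const, hρ1, one_mul]
  have hψs : ∀ n x, R + 1 < ‖x‖ → ψ n x = 0 := by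
    intro n x hx
    rw [hψa]
    refine integral_eq_zero_of_ae (Eventually.of_forall fun t => ?_)
    by_cases ht : t ∈ Metric.ball (0 : Space d) (φ n).rOut
    · rw [mem_ball_zero_iff] at ht
      have h1 := norm_sub_norm_le x t
      have h2 : h (x - t) = 0 := hR _ (by linarith [hφ1 n])
      simp [h2]
    · have : ρ n t = 0 := by
        rw [← (φ n).support_normed_eq (μ := volume)] at ht
        simpa using ht
      simp [this]
  have hψc : ∀ n, HasCompactSupport (ψ n) := fun n =>
    HasCompactSupport.intro (isCompact_closedBall (0 : Space d) (R + 1)) fun x hx =>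
      hψs n x (by simpa using hx)
  have hψd : ∀ n, ContDiff ℝ (⊤ : ℕ∞) (ψ n) := fun n =>
    (φ n).hasCompactSupport_normed.contDiff_convolution_left _ (φ n).contDiff_normed
      hh.locallyIntegrable
  have hψF : ∀ n ξ, fourier (ψ n) ξ = fourier (fun x => ((ρ n x : ℝ) : ℂ)) ξ * fourier h ξ := by
    intro n ξ
    have e : ψ n = (fun x => ((ρ n x : ℝ) : ℂ)) ⋆[ContinuousLinearMap.mul ℂ ℂ, volume] h := by
      funext x
      rw [hψa, convolution_def]
      simp
    have hi : Integrable fun x => ((ρ n x : ℝ) : ℂ) := (hρi n).ofReal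
    rw [e, fourier_eq_fourierTransform, Real.fourier_mul_convolution_eq hi hh,
      ← fourier_eq_fourierTransform, ← fourier_eq_fourierTransform]
  have hρF : ∀ n ξ, ‖fourier (fun x => ((ρ n x : ℝ) : ℂ)) ξ‖ ≤ 1 := by
    intro n ξ
    refine (norm_fourier_le _ _).trans_eq ?_
    rw [← hρ1 n]
    refine integral_congr_ae (Eventually.of_forall fun x => ?_)
    simp only
    rw [Complex.norm_real, Real.norm_of_nonneg (hρ0 n x)]
  -- The transform of ρ_n at ξ is the mollification at 0 of the character x ↦ e^{i⟨ξ,x⟩}, whose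
  -- value there is 1.
  have hρlim : ∀ ξ, Tendsto (fun n => fourier (fun x => ((ρ n x : ℝ) : ℂ)) ξ) atTop (𝓝 1) := by
    intro ξ
    have h1 := ContDiffBump.convolution_tendsto_right_of_continuous (μ := (volume : Measure (Space d)))
      (g := fun x : Space d => Complex.exp (Complex.I * ((inner ℝ ξ x : ℝ) : ℂ))) hφ (by fun_prop) 0
    simp only [inner_zero_right, Complex.ofReal_zero, mul_zero, Complex.exp_zero] at h1
    refine h1.congr fun n => ?_
    rw [convolution_def, fourier]
    refine integral_congr_ae (Eventually.of_forall fun x => ?_)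
    simp only [ContinuousLinearMap.lsmul_apply, zero_sub, inner_neg_right, Complex.real_smul, hρ]
    rw [mul_comm]
    push_cast
    ring_nf
  have hn : ∀ n, ∫ x, (f x : ℂ) * ψ n x = ∫ ξ, fourier (ψ n) ξ ∂μ := fun n =>
    (hf ((hψc n).toSchwartzMap (hψd n))).2
  -- Dominated convergence on both sides of the identity: by |ℱh| on the spectral side, by c|f| on a
  -- ball on the spatial side.
  have hlim1 : Tendsto (fun n => ∫ ξ, fourier (ψ n) ξ ∂μ) atTop (𝓝 (∫ ξ, fourier h ξ ∂μ)) := by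
    refine tendsto_integral_of_dominated_convergence (fun ξ => ‖fourier h ξ‖) (fun n => ?_)
      hμ.norm (fun n => Eventually.of_forall fun ξ => ?_) (Eventually.of_forall fun ξ => ?_)
    · exact (continuous_fourier ((hψd n).continuous.integrable_of_hasCompactSupport
        (hψc n))).aestronglyMeasurable
    · rw [hψF, norm_mul]
      exact mul_le_of_le_one_left (norm_nonneg _) (hρF n ξ)
    · simp_rw [hψF]
      simpa using (hρlim ξ).mul_const (fourier h ξ)
  have hlim2 : Tendsto (fun n => ∫ x, (f x : ℂ) * ψ n x) atTop (𝓝 (∫ x, (f x : ℂ) * h x)) := by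
    have hfm := Complex.continuous_ofReal.comp_aestronglyMeasurable hf.aestronglyMeasurable
    have hae := ContDiffBump.ae_convolution_tendsto_right_of_locallyIntegrable
      (μ := (volume : Measure (Space d))) (g := h) (K := 2) hφ
      (Eventually.of_forall fun n => by simp only [φ]; linarith) hh.locallyIntegrable
    refine tendsto_integral_of_dominated_convergence
      (fun x => (Metric.closedBall (0 : Space d) (R + 1)).indicator (fun x => ‖f x‖ * c) x)
      (fun n => hfm.mul (hψd n).continuous.aestronglyMeasurable) ?_
      (fun n => Eventually.of_forall fun x => ?_) ?_
    · rw [integrable_indicator_iff measurableSet_closedBall]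
      exact (hf.integrableOn_closedBall _).norm.mul_const c
    · by_cases hx : x ∈ Metric.closedBall (0 : Space d) (R + 1)
      · rw [Set.indicator_of_mem hx, norm_mul, Complex.norm_real]
        gcongr
        exact hψb n x
      · rw [Set.indicator_of_notMem hx, hψs n x (by simpa using hx)]
        simp
    · filter_upwards [hae] with x hx
      exact hx.const_mul _
  simp_rw [hn] at hlim2
  exact tendsto_nhds_unique hlim2 hlim1

/-- Substitution w = z - z' and Fubini. Boundedness of A and B confines w to a ball of radius 2R,
where f is integrable. -/
lemma integral_integral_sub_eq {f : Space d → ℝ} (hf : IsFourierTransformOf f μ)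
    (hA : MeasurableSet A) (hA' : Bornology.IsBounded A) (hB : MeasurableSet B)
    (hB' : Bornology.IsBounded B) :
    ((∫ z in A, ∫ z' in B, f (z - z') : ℝ) : ℂ) = ∫ w, (f w : ℂ) * crossCorr A B w := by
  obtain ⟨R, hR⟩ := (hA'.union hB').exists_norm_le
  have hRA : ∀ x ∈ A, ‖x‖ ≤ R := fun x hx => hR x (Or.inl hx)
  have hRB : ∀ x ∈ B, ‖x‖ ≤ R := fun x hx => hR x (Or.inr hx)
  have hfm := Complex.continuous_ofReal.comp_aestronglyMeasurable hf.aestronglyMeasurable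
  have e1 : ∫ w, (f w : ℂ) * crossCorr A B w = ∫ w, ∫ t, (f w : ℂ) * (indC A t * indC B (t - w)) := by
    refine integral_congr_ae (Eventually.of_forall fun w => ?_)
    simp only
    rw [crossCorr_apply, integral_const_mul]
  have mA : Measurable (indC A) := measurable_const.indicator hA
  have mB : Measurable (indC B) := measurable_const.indicator hB
  have hI : Integrable (Function.uncurry fun w t => (f w : ℂ) * (indC A t * indC B (t - w)))
      (volume.prod volume) := by
    have hdom : Integrable (fun p : Space d × Space d =>
        (Metric.closedBall (0 : Space d) (2 * R)).indicator (fun x => ‖f x‖) p.1 * ‖indC A p.2‖)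
        (volume.prod volume) := by
      refine Integrable.mul_prod ?_ (integrable_indC hA hA').norm
      rw [integrable_indicator_iff measurableSet_closedBall]
      exact (hf.integrableOn_closedBall _).norm
    refine hdom.mono' ?_ (Eventually.of_forall fun p => ?_)
    · exact hfm.comp_fst.mul ((mA.comp measurable_snd).mul
        (mB.comp (measurable_snd.sub measurable_fst))).aestronglyMeasurable
    · simp only [Function.uncurry]
      rw [norm_mul, norm_mul, Complex.norm_real]
      by_cases hp : p.1 ∈ Metric.closedBall (0 : Space d) (2 * R)
      · rw [Set.indicator_of_mem hp]
        gcongr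
        exact mul_le_of_le_one_right (norm_nonneg _) (norm_indC_le _ _)
      · rw [Set.indicator_of_notMem hp, zero_mul]
        have hp' : 2 * R < ‖p.1‖ := by simpa using hp
        refine le_of_eq ?_
        by_cases h1 : p.2 ∈ A
        · by_cases h2 : p.2 - p.1 ∈ B
          · have h3 := norm_sub_le p.2 (p.2 - p.1)
            rw [sub_sub_cancel] at h3
            linarith [hRA _ h1, hRB _ h2]
          · simp [indC, h2]
        · simp [indC, h1]
  rw [e1, integral_integral_swap hI, ← integral_complex_ofReal, ← integral_indicator hA]
  refine integral_congr_ae (Eventually.of_forall fun t => ?_)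
  simp only
  by_cases ht : t ∈ A
  · rw [Set.indicator_of_mem ht]
    have : ∀ w, (f w : ℂ) * (indC A t * indC B (t - w))
        = (fun z' => (f (t - z') : ℂ) * indC B z') (t - w) := fun w => by
      simp [indC, ht]
    simp_rw [this]
    rw [integral_sub_left_eq_self (fun z' => (f (t - z') : ℂ) * indC B z') volume t,
      ← integral_complex_ofReal, ← integral_indicator hB]
    refine integral_congr_ae (Eventually.of_forall fun z => ?_)
    by_cases hz : z ∈ B <;> simp [indC, hz]
  · rw [Set.indicator_of_notMem ht]
    simp [indC, ht]

/-- The spatial covariance in terms of the spectral measure. -/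
lemma spatialCov_eq {f : Space d → ℝ} (hα : α ∈ Set.Ioo (0 : ℝ) d)
    (hμ : μ ≤ C • rieszMeasure d α) (hf : IsFourierTransformOf f μ)
    (hA : MeasurableSet A) (hA' : Bornology.IsBounded A) (hB : MeasurableSet B)
    (hB' : Bornology.IsBounded B) :
    ((∫ z in A, ∫ z' in B, f (z - z') : ℝ) : ℂ)
      = ∫ ξ, fourier (indC A) ξ * conj (fourier (indC B) ξ) ∂μ := by
  obtain ⟨R, hR⟩ := (hA'.union hB').exists_norm_le
  have hint := integrable_fourier_indC_mul hα hμ hA hA' hB hB'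
  simp_rw [← fourier_crossCorr hA hA' hB hB'] at hint ⊢
  rw [integral_integral_sub_eq hf hA hA' hB hB']
  exact tendsto_integral_mul_mollify hf (integrable_crossCorr hA hA' hB hB')
    (fun w => norm_crossCorr_le hA hA' w)
    (fun w hw => crossCorr_eq_zero (fun x hx => hR x (Or.inl hx)) (fun x hx => hR x (Or.inr hx)) hw)
    hint

end Covariance

/-! ### Norms of integrands and Wiener integrals -/

section Wiener

open scoped ComplexConjugate

variable {d : ℕ} {T H : ℝ}

/-- Integrands whose spatial Fourier transform is defined and jointly measurable. -/
structure IsRegularIntegrand (g : ℝ → Space d → ℝ) : Prop where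
  integrable : ∀ r, Integrable (g r)
  measurable : Measurable fun p : ℝ × Space d => fourier (fun y => (g p.1 y : ℂ)) p.2

lemma IsRegularIntegrand.ofReal_integrable {g : ℝ → Space d → ℝ} (hg : IsRegularIntegrand g)
    (r : ℝ) : Integrable fun y => (g r y : ℂ) := (hg.integrable r).ofReal

lemma IsRegularIntegrand.fourier_add {g h : ℝ → Space d → ℝ} (hg : IsRegularIntegrand g)
    (hh : IsRegularIntegrand h) (r : ℝ) (ξ : Space d) :
    fourier (fun y => ((g r y + h r y : ℝ) : ℂ)) ξ
      = fourier (fun y => (g r y : ℂ)) ξ + fourier (fun y => (h r y : ℂ)) ξ := by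
  rw [← FracHeat.fourier_add (hg.ofReal_integrable r) (hh.ofReal_integrable r)]
  simp only [Complex.ofReal_add]

lemma fourier_neg_ofReal (g : ℝ → Space d → ℝ) (r : ℝ) (ξ : Space d) :
    fourier (fun y => ((-g r y : ℝ) : ℂ)) ξ = -fourier (fun y => (g r y : ℂ)) ξ := by
  have := fourier_const_mul (-1) (fun y => (g r y : ℂ)) ξ
  simpa using this

lemma IsRegularIntegrand.add {g h : ℝ → Space d → ℝ} (hg : IsRegularIntegrand g)
    (hh : IsRegularIntegrand h) : IsRegularIntegrand fun r y => g r y + h r y := by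
  refine ⟨fun r => (hg.integrable r).add (hh.integrable r), ?_⟩
  simp_rw [hg.fourier_add hh]
  exact hg.measurable.add hh.measurable

lemma IsRegularIntegrand.neg {g : ℝ → Space d → ℝ} (hg : IsRegularIntegrand g) :
    IsRegularIntegrand fun r y => -g r y := by
  refine ⟨fun r => (hg.integrable r).neg, ?_⟩
  simp_rw [fourier_neg_ofReal]
  exact hg.measurable.neg

lemma integrandNormSq_eq (μ : Measure (Space d)) (g : ℝ → Space d → ℝ) :
    integrandNormSq H T μ g = ENNReal.ofReal (H * (2 * H - 1)) *
      ∫⁻ ξ, timeEnergy H T (fun r => ‖fourier (fun y => (g r y : ℂ)) ξ‖ₑ) ∂μ := rfl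

lemma measurable_timeEnergy_of_measurable {Φ : ℝ × Space d → ℝ≥0∞} (hΦ : Measurable Φ) :
    Measurable fun ξ => timeEnergy H T (fun r => Φ (r, ξ)) := by
  have a1 : Measurable fun p : (Space d × ℝ) × ℝ => timeKernel H p.1.2 p.2 :=
    (measurable_timeKernel H).comp
      ((measurable_snd.comp measurable_fst).prodMk measurable_snd)
  have a2 : Measurable fun p : (Space d × ℝ) × ℝ => Φ (p.1.2, p.1.1) :=
    hΦ.comp ((measurable_snd.comp measurable_fst).prodMk (measurable_fst.comp measurable_fst))
  have a3 : Measurable fun p : (Space d × ℝ) × ℝ => Φ (p.2, p.1.1) :=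
    hΦ.comp (measurable_snd.prodMk (measurable_fst.comp measurable_fst))
  have h2 := (a1.mul (a2.mul a3)).lintegral_prod_right' (ν := volume.restrict (Set.Icc 0 T))
  exact h2.lintegral_prod_right' (ν := volume.restrict (Set.Icc 0 T))

lemma measurable_left_of_measurable {Φ : ℝ × Space d → ℝ≥0∞} (hΦ : Measurable Φ) (ξ : Space d) :
    Measurable fun r => Φ (r, ξ) :=
  hΦ.comp (measurable_id.prodMk measurable_const)

lemma IsRegularIntegrand.measurable_enorm {g : ℝ → Space d → ℝ} (hg : IsRegularIntegrand g) :
    Measurable fun p : ℝ × Space d => ‖fourier (fun y => (g p.1 y : ℂ)) p.2‖ₑ :=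
  hg.measurable.enorm

lemma IsRegularIntegrand.measurable_timeEnergy {g : ℝ → Space d → ℝ} (hg : IsRegularIntegrand g) :
    Measurable fun ξ => timeEnergy H T (fun r => ‖fourier (fun y => (g r y : ℂ)) ξ‖ₑ) :=
  measurable_timeEnergy_of_measurable
    (Φ := fun p : ℝ × Space d => ‖fourier (fun y => (g p.1 y : ℂ)) p.2‖ₑ) hg.measurable_enorm

lemma IsRegularIntegrand.measurable_enorm_left {g : ℝ → Space d → ℝ} (hg : IsRegularIntegrand g)
    (ξ : Space d) : Measurable fun r => ‖fourier (fun y => (g r y : ℂ)) ξ‖ₑ :=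
  measurable_left_of_measurable
    (Φ := fun p : ℝ × Space d => ‖fourier (fun y => (g p.1 y : ℂ)) p.2‖ₑ) hg.measurable_enorm ξ

lemma integrandNormSq_add_le (hH : H ∈ Set.Ioo (1 / 2 : ℝ) 1) (μ : Measure (Space d))
    {g h : ℝ → Space d → ℝ} (hg : IsRegularIntegrand g) (hh : IsRegularIntegrand h) :
    integrandNormSq H T μ (fun r y => g r y + h r y)
      ≤ 2 * integrandNormSq H T μ g + 2 * integrandNormSq H T μ h := by
  simp only [integrandNormSq_eq]
  rw [mul_left_comm, mul_left_comm 2, ← mul_add]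
  refine mul_le_mul_right ?_ _
  rw [← lintegral_const_mul _ hg.measurable_timeEnergy,
    ← lintegral_const_mul _ hh.measurable_timeEnergy,
    ← lintegral_add_left (hg.measurable_timeEnergy.const_mul _)]
  refine lintegral_mono fun ξ => ?_
  refine le_trans (timeEnergy_mono fun r => ?_)
    (timeEnergy_add_le hH T (hg.measurable_enorm_left ξ) (hh.measurable_enorm_left ξ))
  rw [hg.fourier_add hh]
  exact enorm_add_le _ _

lemma integrandNormSq_neg (μ : Measure (Space d)) (g : ℝ → Space d → ℝ) :
    integrandNormSq H T μ (fun r y => -g r y) = integrandNormSq H T μ g := by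
  simp only [integrandNormSq_eq, fourier_neg_ofReal, enorm_neg]

/-! ### Elementary integrands -/

lemma ofReal_elemFun (c : NoiseIndex d T →₀ ℝ) (r : ℝ) (y : Space d) :
    ((elemFun c r y : ℝ) : ℂ) = ∑ i ∈ c.support,
      ((c i * (Set.Icc 0 i.time).indicator 1 r : ℝ) : ℂ) * indC i.set y := by
  simp only [elemFun, Finsupp.sum]
  rw [Complex.ofReal_sum]
  refine Finset.sum_congr rfl fun i _ => ?_
  classical
  rw [indC, Set.indicator_apply, Set.indicator_apply, Set.indicator_apply]
  by_cases h1 : r ∈ Set.Icc 0 i.time <;> by_cases h2 : y ∈ i.set <;>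
    simp only [Set.mem_prod, h1, h2, and_self, and_true, and_false, if_true, if_false,
      Pi.one_apply, mul_one, mul_zero, Complex.ofReal_zero]

lemma fourier_elemFun (c : NoiseIndex d T →₀ ℝ) (r : ℝ) (ξ : Space d) :
    fourier (fun y => ((elemFun c r y : ℝ) : ℂ)) ξ = ∑ i ∈ c.support,
      ((c i * (Set.Icc 0 i.time).indicator 1 r : ℝ) : ℂ) * fourier (indC i.set) ξ := by
  simp_rw [ofReal_elemFun]
  rw [fourier_finset_sum _ _ fun i _ => (integrable_indC i.measurableSet i.isBounded).const_mul _]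
  exact Finset.sum_congr rfl fun i _ => fourier_const_mul _ _ _

lemma isRegularIntegrand_elemFun (c : NoiseIndex d T →₀ ℝ) : IsRegularIntegrand (elemFun c) := by
  constructor
  · intro r
    have h : Integrable fun y => ((elemFun c r y : ℝ) : ℂ) := by
      simp_rw [ofReal_elemFun]
      exact integrable_finsetSum _ fun i _ =>
        (integrable_indC i.measurableSet i.isBounded).const_mul _
    exact h.re
  · simp_rw [fourier_elemFun]
    refine Finset.measurable_fun_sum _ fun i _ => Measurable.mul ?_ ?_
    · refine Complex.measurable_ofReal.comp (Measurable.const_mul ?_ _)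
      exact (measurable_one.indicator measurableSet_Icc).comp measurable_fst
    · exact (continuous_fourier (integrable_indC i.measurableSet i.isBounded)).measurable.comp
        measurable_snd

lemma elemIntegral_add (c c' : NoiseIndex d T →₀ ℝ) {Ω : Type*} (W : NoiseIndex d T → Ω → ℝ) (ω : Ω) :
    elemIntegral W (c + c') ω = elemIntegral W c ω + elemIntegral W c' ω := by
  classical
  exact Finsupp.sum_add_index' (fun i => by simp) (fun i a b => by ring)

lemma elemIntegral_neg (c : NoiseIndex d T →₀ ℝ) {Ω : Type*} (W : NoiseIndex d T → Ω → ℝ) (ω : Ω) :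
    elemIntegral W (-c) ω = -elemIntegral W c ω := by
  rw [elemIntegral, elemIntegral, Finsupp.sum_neg_index fun i => by simp]
  simp [Finsupp.sum]

variable {Ω : Type*} [MeasurableSpace Ω] {P : Measure Ω} {α : ℝ} {μ : Measure (Space d)} {C : ℝ≥0}
  {f : Space d → ℝ} {W : NoiseIndex d T → Ω → ℝ}

/-- The variance of an elementary Wiener integral is dominated by the norm of its integrand. -/
lemma ofReal_integral_elemIntegral_sq_le (hH : H ∈ Set.Ioo (1 / 2 : ℝ) 1)
    (hα : α ∈ Set.Ioo (0 : ℝ) d) (hμ : μ ≤ C • rieszMeasure d α) (hf : IsFourierTransformOf f μ)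
    (hW : IsFracColoredNoise H f W P) (c : NoiseIndex d T →₀ ℝ) :
    ENNReal.ofReal (∫ ω, elemIntegral W c ω ^ 2 ∂P) ≤ integrandNormSq H T μ (elemFun c) := by
  set m := (volume.restrict (Set.Icc 0 T)).prod (volume.restrict (Set.Icc (0 : ℝ) T)) with hm
  set a := H * (2 * H - 1) with ha
  have ha0 : 0 ≤ a := mul_nonneg (by linarith [hH.1]) (by linarith [hH.1])
  set F : NoiseIndex d T → Space d → ℂ := fun i => fourier (indC i.set) with hF
  set κ : NoiseIndex d T → NoiseIndex d T → ℝ × ℝ → ℝ := fun i j p => |p.1 - p.2| ^ (2 * H - 2) *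
    ((Set.Icc 0 i.time).indicator 1 p.1 * (Set.Icc 0 j.time).indicator 1 p.2) with hκ
  have hκi : ∀ i j, Integrable (κ i j) m := by
    intro i j
    refine (integrable_abs_sub_rpow (by linarith [hH.1]) T).mul_bdd (c := 1) ?_
      (Eventually.of_forall fun p => ?_)
    · exact (((measurable_one.indicator measurableSet_Icc).comp measurable_fst).mul
        ((measurable_one.indicator measurableSet_Icc).comp measurable_snd)).aestronglyMeasurable
    · rw [Set.indicator_apply, Set.indicator_apply]
      split_ifs <;> simp
  -- Each covariance is a time integral times a spectral integral; collecting the double sum puts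
  -- the variance in the form of a single integral against μ.
  have hcov : ((∫ ω, elemIntegral W c ω ^ 2 ∂P : ℝ) : ℂ) = ∫ ξ, ∑ i ∈ c.support, ∑ j ∈ c.support,
      ((c i * c j * (a * ∫ p, κ i j p ∂m) : ℝ) : ℂ) * (F i ξ * conj (F j ξ)) ∂μ := by
    have hint : ∀ i j : NoiseIndex d T, Integrable (fun ξ => F i ξ * conj (F j ξ)) μ := fun i j =>
      integrable_fourier_indC_mul hα hμ i.measurableSet i.isBounded j.measurableSet j.isBounded
    rw [hW.integral_elemIntegral_sq, Complex.ofReal_sum, integral_finsetSum _ fun i _ =>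
      integrable_finsetSum _ fun j _ => (hint i j).const_mul _]
    refine Finset.sum_congr rfl fun i _ => ?_
    rw [Complex.ofReal_sum, integral_finsetSum _ fun j _ => (hint i j).const_mul _]
    refine Finset.sum_congr rfl fun j _ => ?_
    rw [integral_const_mul, ← spatialCov_eq hα hμ hf i.measurableSet i.isBounded j.measurableSet
      j.isBounded, fbmCov_eq_integral hH i.time_mem j.time_mem, ← Complex.ofReal_mul]
    congr 1
    ring
  -- For fixed ξ the double sum is the energy pairing of ℱg(r,·) with its own conjugate. Taking
  -- absolute values inside turns it into the energy of |ℱg|, so only an inequality results.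
  have hpt : ∀ ξ, ∑ i ∈ c.support, ∑ j ∈ c.support,
      ((c i * c j * (a * ∫ p, κ i j p ∂m) : ℝ) : ℂ) * (F i ξ * conj (F j ξ))
      = ∫ p, ((a * |p.1 - p.2| ^ (2 * H - 2) : ℝ) : ℂ) *
        (fourier (fun y => ((elemFun c p.1 y : ℝ) : ℂ)) ξ *
          conj (fourier (fun y => ((elemFun c p.2 y : ℝ) : ℂ)) ξ)) ∂m := by
    intro ξ
    have e : ∀ p : ℝ × ℝ, ((a * |p.1 - p.2| ^ (2 * H - 2) : ℝ) : ℂ) *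
        (fourier (fun y => ((elemFun c p.1 y : ℝ) : ℂ)) ξ *
          conj (fourier (fun y => ((elemFun c p.2 y : ℝ) : ℂ)) ξ))
        = ∑ i ∈ c.support, ∑ j ∈ c.support,
          ((κ i j p : ℝ) : ℂ) * (((c i * c j * a : ℝ) : ℂ) * (F i ξ * conj (F j ξ))) := by
      intro p
      rw [fourier_elemFun, fourier_elemFun, map_sum, Finset.sum_mul_sum, Finset.mul_sum]
      refine Finset.sum_congr rfl fun i _ => ?_
      rw [Finset.mul_sum]
      refine Finset.sum_congr rfl fun j _ => ?_
      simp only [hκ, hF, map_mul, Complex.conj_ofReal]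
      push_cast
      ring
    simp_rw [e]
    have hint : ∀ i j : NoiseIndex d T, Integrable (fun p =>
        ((κ i j p : ℝ) : ℂ) * (((c i * c j * a : ℝ) : ℂ) * (F i ξ * conj (F j ξ)))) m := fun i j =>
      (hκi i j).ofReal.mul_const _
    rw [integral_finsetSum _ fun i _ => integrable_finsetSum _ fun j _ => hint i j]
    refine Finset.sum_congr rfl fun i _ => ?_
    rw [integral_finsetSum _ fun j _ => hint i j]
    refine Finset.sum_congr rfl fun j _ => ?_
    rw [integral_mul_const, integral_complex_ofReal]
    push_cast
    ring
  have hreg := isRegularIntegrand_elemFun c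
  calc ENNReal.ofReal (∫ ω, elemIntegral W c ω ^ 2 ∂P)
      ≤ ‖((∫ ω, elemIntegral W c ω ^ 2 ∂P : ℝ) : ℂ)‖ₑ := by
        rw [← ofReal_norm, Complex.norm_real]
        exact ENNReal.ofReal_le_ofReal (le_abs_self _)
    _ ≤ ∫⁻ ξ, ‖∑ i ∈ c.support, ∑ j ∈ c.support,
      ((c i * c j * (a * ∫ p, κ i j p ∂m) : ℝ) : ℂ) * (F i ξ * conj (F j ξ))‖ₑ ∂μ := by
        rw [hcov]; exact enorm_integral_le_lintegral_enorm _
    _ ≤ ∫⁻ ξ, ENNReal.ofReal a *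
          timeEnergy H T (fun r => ‖fourier (fun y => (elemFun c r y : ℂ)) ξ‖ₑ) ∂μ := by
        refine lintegral_mono fun ξ => ?_
        simp only
        rw [hpt]
        refine (enorm_integral_le_lintegral_enorm _).trans (le_of_eq ?_)
        have hφ := hreg.measurable_enorm_left ξ
        rw [timeEnergy, ← lintegral_prod (f := fun p : ℝ × ℝ => timeKernel H p.1 p.2 *
          (‖fourier (fun y => ((elemFun c p.1 y : ℝ) : ℂ)) ξ‖ₑ *
            ‖fourier (fun y => ((elemFun c p.2 y : ℝ) : ℂ)) ξ‖ₑ)),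
          ← lintegral_const_mul' _ _ ENNReal.ofReal_ne_top]
        · refine lintegral_congr fun p => ?_
          rw [enorm_mul, enorm_mul, RCLike.enorm_conj, ← mul_assoc (ENNReal.ofReal a), timeKernel,
            ← ENNReal.ofReal_mul ha0, ← ofReal_norm (((a * _ : ℝ) : ℂ)), Complex.norm_real,
            Real.norm_of_nonneg (by positivity)]
        · exact ((measurable_timeKernel H).mul ((hφ.comp measurable_fst).mul
            (hφ.comp measurable_snd))).aemeasurable
    _ = _ := by
        rw [lintegral_const_mul' _ _ ENNReal.ofReal_ne_top, integrandNormSq_eq]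

/-! ### Wiener integrals -/

lemma elemFun_add (c c' : NoiseIndex d T →₀ ℝ) (r : ℝ) (y : Space d) :
    elemFun (c + c') r y = elemFun c r y + elemFun c' r y := by
  classical
  exact Finsupp.sum_add_index' (fun i => by simp) (fun i a b => by ring)

lemma elemFun_neg (c : NoiseIndex d T →₀ ℝ) (r : ℝ) (y : Space d) :
    elemFun (-c) r y = -elemFun c r y := by
  rw [elemFun, elemFun, Finsupp.sum_neg_index fun i => by simp]
  simp [Finsupp.sum]

lemma isRegularIntegrand_elemFun_sub (c : NoiseIndex d T →₀ ℝ) {g : ℝ → Space d → ℝ}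
    (hg : IsRegularIntegrand g) : IsRegularIntegrand fun r y => elemFun c r y - g r y := by
  simp_rw [sub_eq_add_neg]
  exact (isRegularIntegrand_elemFun c).add hg.neg

variable {g h : ℝ → Space d → ℝ} {X Y : Ω → ℝ}

/-- Sums and negations suffice to treat first and second differences of the solution. Approximating
sequences are added, using the quasi-triangle inequality for the integrands and the triangle
inequality in L²(P). -/
lemma IsWienerIntegral.add (hH : H ∈ Set.Ioo (1 / 2 : ℝ) 1) (hW : IsFracColoredNoise H f W P)
    (hX : IsWienerIntegral H μ W P g X)
    (hY : IsWienerIntegral H μ W P h Y) (hg : IsRegularIntegrand g) (hh : IsRegularIntegrand h) :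
    IsWienerIntegral H μ W P (fun r y => g r y + h r y) (fun ω => X ω + Y ω) := by
  obtain ⟨mX, c, hc, hcX⟩ := hX
  obtain ⟨mY, c', hc', hcY⟩ := hY
  refine ⟨mX.add mY, fun n => c n + c' n, ?_, ?_⟩
  · have hlim : Tendsto (fun n => 2 * integrandNormSq H T μ (fun r y => elemFun (c n) r y - g r y)
        + 2 * integrandNormSq H T μ (fun r y => elemFun (c' n) r y - h r y)) atTop (𝓝 0) := by
      simpa using (ENNReal.Tendsto.const_mul hc (Or.inr ENNReal.ofNat_ne_top)).add
        (ENNReal.Tendsto.const_mul hc' (Or.inr ENNReal.ofNat_ne_top))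
    refine tendsto_of_tendsto_of_tendsto_of_le_of_le tendsto_const_nhds hlim
      (fun _ => zero_le) fun n => ?_
    have := integrandNormSq_add_le (T := T) hH μ (isRegularIntegrand_elemFun_sub (c n) hg)
      (isRegularIntegrand_elemFun_sub (c' n) hh)
    refine le_trans (le_of_eq ?_) this
    congr 1
    funext r y
    rw [elemFun_add]
    ring
  · have hlim := hcX.add hcY
    rw [add_zero] at hlim
    refine tendsto_of_tendsto_of_tendsto_of_le_of_le tendsto_const_nhds hlim
      (fun _ => zero_le) fun n => ?_
    refine le_trans (le_of_eq ?_) (eLpNorm_add_le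
      ((hW.memLp_elemIntegral (c n)).sub mX).aestronglyMeasurable
      ((hW.memLp_elemIntegral (c' n)).sub mY).aestronglyMeasurable one_le_two)
    congr 1
    funext ω
    simp only [Pi.add_apply, elemIntegral_add]
    ring

lemma IsWienerIntegral.neg (hX : IsWienerIntegral H μ W P g X) :
    IsWienerIntegral H μ W P (fun r y => -g r y) (fun ω => -X ω) := by
  obtain ⟨mX, c, hc, hcX⟩ := hX
  refine ⟨mX.neg, fun n => -c n, ?_, ?_⟩
  · refine hc.congr fun n => ?_
    rw [← integrandNormSq_neg]
    congr 1
    funext r y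
    rw [elemFun_neg]
    ring
  · refine hcX.congr fun n => ?_
    rw [← eLpNorm_neg]
    congr 1
    funext ω
    simp only [Pi.neg_apply, elemIntegral_neg]
    ring

/-- Wiener integrals are subgaussian, with variance proxy given by the norm of the integrand. -/
lemma IsWienerIntegral.lintegral_exp_sq_le [IsFiniteMeasure P] (hH : H ∈ Set.Ioo (1 / 2 : ℝ) 1)
    (hα : α ∈ Set.Ioo (0 : ℝ) d) (hμ : μ ≤ C • rieszMeasure d α) (hf : IsFourierTransformOf f μ)
    (hW : IsFracColoredNoise H f W P) (hX : IsWienerIntegral H μ W P g X)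
    (hg : IsRegularIntegrand g) {b : ℝ} (hb : 0 < b)
    (hgb : integrandNormSq H T μ g ≤ ENNReal.ofReal b) :
    ∫⁻ ω, ENNReal.ofReal (Real.exp (X ω ^ 2 / (12 * b))) ∂P ≤ 2 := by
  obtain ⟨mX, c, hc, hcX⟩ := hX
  -- Eventually the approximants are within b/2 of g in squared norm, so their variance is at most
  -- 2(b/2) + 2b = 3b, and 4 · 3b = 12b. The Gaussian law is used only for the approximants, and the
  -- limit is reached by Fatou.
  have := lintegral_exp_sq_le_of_tendsto (s := 3 * b)
    (fun n => (hW.memLp_elemIntegral (c n)).aestronglyMeasurable) mX.aestronglyMeasurable hcX ?_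
  · rwa [show 4 * (3 * b) = 12 * b by ring] at this
  · have hev : ∀ᶠ n in atTop, integrandNormSq H T μ (fun r y => elemFun (c n) r y - g r y)
        < ENNReal.ofReal (b / 2) :=
      hc.eventually (gt_mem_nhds (by rw [ENNReal.ofReal_pos]; positivity))
    filter_upwards [hev] with n hn
    refine lintegral_exp_sq_le_of_hasGaussianLaw (hW.hasGaussianLaw_elemIntegral (c n))
      (hW.integral_elemIntegral (c n)) (by positivity) ?_
    have h1 := ofReal_integral_elemIntegral_sq_le hH hα hμ hf hW (c n)
    have h2 := integrandNormSq_add_le (T := T) hH μ (isRegularIntegrand_elemFun_sub (c n) hg) hg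
    simp only [sub_add_cancel] at h2
    have h3 : ENNReal.ofReal (∫ ω, elemIntegral W (c n) ω ^ 2 ∂P) ≤ ENNReal.ofReal (3 * b) := by
      calc _ ≤ _ := h1
        _ ≤ _ := h2
        _ ≤ 2 * ENNReal.ofReal (b / 2) + 2 * ENNReal.ofReal b := by gcongr
        _ = ENNReal.ofReal (3 * b) := by
          rw [show (2 : ℝ≥0∞) = ENNReal.ofReal 2 by simp, ← ENNReal.ofReal_mul (by norm_num),
            ← ENNReal.ofReal_mul (by norm_num), ← ENNReal.ofReal_add (by positivity) (by positivity)]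
          congr 1; ring
    exact (ENNReal.ofReal_le_ofReal_iff (by positivity)).1 h3

end Wiener

/-! ### Increments of the mild solution -/

section Heat

variable {d : ℕ} {T H : ℝ}

/-- The character `e^{-i⟨ξ,x⟩}`. -/
def char (x ξ : Space d) : ℂ := Complex.exp (-(Complex.I * ((inner ℝ ξ x : ℝ) : ℂ)))

lemma norm_char (x ξ : Space d) : ‖char x ξ‖ = 1 := norm_cexp_neg_I_mul _

lemma char_add (x y ξ : Space d) : char (x + y) ξ = char x ξ * char y ξ := by
  rw [char, char, char, ← Complex.exp_add, inner_add_right]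
  push_cast
  ring_nf

lemma norm_char_sub_one_le (x ξ : Space d) : ‖char x ξ - 1‖ ≤ min 2 (‖x‖ * ‖ξ‖) := by
  refine le_min ((norm_sub_le _ _).trans_eq (by rw [norm_char]; norm_num)) ?_
  have h := Real.norm_exp_I_mul_ofReal_sub_one_le (x := -(inner ℝ ξ x : ℝ))
  rw [char, show -(Complex.I * ((inner ℝ ξ x : ℝ) : ℂ)) = Complex.I * ((-(inner ℝ ξ x) : ℝ) : ℂ) by
    push_cast; ring]
  refine h.trans ?_
  rw [norm_neg, mul_comm]
  exact norm_inner_le_norm ξ x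

lemma norm_char_sub_char_le (x y ξ : Space d) :
    ‖char x ξ - char y ξ‖ ≤ min 2 (‖x - y‖ * ‖ξ‖) := by
  have : char x ξ - char y ξ = char y ξ * (char (x - y) ξ - 1) := by
    rw [mul_sub, ← char_add, add_sub_cancel, mul_one]
  rw [this, norm_mul, norm_char, one_mul]
  exact norm_char_sub_one_le _ _

/-- The integrand `g` has Fourier transform `m(ξ) 1_{r<t} e^{-(t-r)|ξ|²/2}`. -/
structure IsHeatIntegrand (t : ℝ) (g : ℝ → Space d → ℝ) (m : Space d → ℂ) : Prop where
  regular : IsRegularIntegrand g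
  fourier_eq : ∀ r ξ, fourier (fun y => (g r y : ℂ)) ξ
    = m ξ * (if r < t then ((Real.exp (-((t - r) * (‖ξ‖ ^ 2 / 2))) : ℝ) : ℂ) else 0)

lemma isHeatIntegrand_heatKernel (t : ℝ) (x : Space d) :
    IsHeatIntegrand t (fun r y => heatKernel (t - r) (x - y)) (char x) := by
  have h : ∀ r ξ, fourier (fun y => ((heatKernel (t - r) (x - y) : ℝ) : ℂ)) ξ
    = char x ξ * (if r < t then ((Real.exp (-((t - r) * (‖ξ‖ ^ 2 / 2))) : ℝ) : ℂ) else 0) := by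
    intro r ξ
    by_cases hr : r < t
    · rw [if_pos hr, fourier_heatKernel (sub_pos.2 hr), char]
    · rw [if_neg hr, mul_zero, fourier]
      simp [heatKernel, hr]
  refine ⟨⟨fun r => integrable_heatKernel _ _, ?_⟩, h⟩
  simp_rw [h]
  refine Measurable.mul ?_ (Measurable.ite (measurableSet_lt measurable_fst measurable_const) ?_
    measurable_const)
  · unfold char
    exact Continuous.measurable (by fun_prop)
  · exact Continuous.measurable (by fun_prop)

lemma IsHeatIntegrand.add {t : ℝ} {g h : ℝ → Space d → ℝ} {m m' : Space d → ℂ}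
    (hg : IsHeatIntegrand t g m) (hh : IsHeatIntegrand t h m') :
    IsHeatIntegrand t (fun r y => g r y + h r y) (fun ξ => m ξ + m' ξ) :=
  ⟨hg.regular.add hh.regular, fun r ξ => by
    rw [hg.regular.fourier_add hh.regular, hg.fourier_eq, hh.fourier_eq, add_mul]⟩

lemma IsHeatIntegrand.neg {t : ℝ} {g : ℝ → Space d → ℝ} {m : Space d → ℂ}
    (hg : IsHeatIntegrand t g m) :
    IsHeatIntegrand t (fun r y => -g r y) (fun ξ => -m ξ) :=
  ⟨hg.regular.neg, fun r ξ => by rw [fourier_neg_ofReal, hg.fourier_eq, neg_mul]⟩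

/-- `∫ min(2,|η|)^k |η|^{-s} dη`. -/
def truncIntegral (d : ℕ) (k : ℕ) (s : ℝ) : ℝ≥0∞ :=
  ∫⁻ η : Space d, ENNReal.ofReal (min 2 ‖η‖ ^ k) * ENNReal.ofReal (‖η‖ ^ (-s))

/-- The order k of vanishing controls the origin (s < d + k), the truncation at 2 controls infinity
(s > d). -/
lemma truncIntegral_lt_top {k : ℕ} {s : ℝ} (hd : 0 < d) (h1 : (d : ℝ) < s) (h2 : s < d + k) :
    truncIntegral d k s < ∞ := by
  rw [truncIntegral, ← lintegral_add_compl _ (measurableSet_ball (x := (0 : Space d)) (ε := 1))]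
  refine ENNReal.add_lt_top.2 ⟨?_, ?_⟩
  · refine lt_of_le_of_lt (lintegral_mono_ae (ae_restrict_of_ae ?_))
      (lintegral_ball_norm_rpow_lt_top (p := k - s) hd (by linarith))
    have : Nonempty (Fin d) := ⟨⟨0, hd⟩⟩
    have h0 : ∀ᵐ η : Space d, η ≠ 0 := by simp [ae_iff, measure_singleton]
    filter_upwards [h0] with η hη
    have hη' : 0 < ‖η‖ := norm_pos_iff.2 hη
    rw [← ENNReal.ofReal_mul (by positivity)]
    refine ENNReal.ofReal_le_ofReal ?_
    rw [sub_eq_add_neg, Real.rpow_add hη', Real.rpow_natCast]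
    gcongr
    exact min_le_right _ _
  · refine lt_of_le_of_lt (lintegral_mono fun η => ?_)
      (b := ∫⁻ η in (Metric.ball (0 : Space d) 1)ᶜ,
        ENNReal.ofReal (2 ^ k) * ENNReal.ofReal (‖η‖ ^ (-s))) ?_
    · gcongr
      exact min_le_left _ _
    · rw [lintegral_const_mul _ (measurable_ofReal_norm_rpow _)]
      exact ENNReal.mul_lt_top ENNReal.ofReal_lt_top (lintegral_compl_ball_norm_rpow_lt_top h1)

/-- Scaling η = δξ; the Hölder exponent s - d originates here. -/
lemma lintegral_min_rpow {k : ℕ} {s δ : ℝ} (hδ : 0 < δ) :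
    ∫⁻ ξ : Space d, ENNReal.ofReal (min 2 (δ * ‖ξ‖) ^ k) * ENNReal.ofReal (‖ξ‖ ^ (-s))
      = ENNReal.ofReal (δ ^ (s - d)) * truncIntegral d k s := by
  have hm : Measurable fun η : Space d =>
      ENNReal.ofReal (min 2 ‖η‖ ^ k) * ENNReal.ofReal (‖η‖ ^ (-s)) := by fun_prop
  have h := lintegral_comp_pos_smul volume hm hδ
  rw [← truncIntegral, finrank_euclideanSpace_fin] at h
  have e : ∀ ξ : Space d, ENNReal.ofReal (min 2 (δ * ‖ξ‖) ^ k) * ENNReal.ofReal (‖ξ‖ ^ (-s))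
      = ENNReal.ofReal (δ ^ s) * (ENNReal.ofReal (min 2 ‖δ • ξ‖ ^ k)
        * ENNReal.ofReal (‖δ • ξ‖ ^ (-s))) := by
    intro ξ
    rw [norm_smul, Real.norm_of_nonneg hδ.le, Real.mul_rpow hδ.le (norm_nonneg _), mul_left_comm,
      ← ENNReal.ofReal_mul (p := δ ^ s) (by positivity), ← mul_assoc (δ ^ s), ← Real.rpow_add hδ, add_neg_cancel,
      Real.rpow_zero, one_mul]
  simp_rw [e]
  rw [lintegral_const_mul _ (by fun_prop), h, ← mul_assoc, ← ENNReal.ofReal_mul (by positivity)]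
  congr 2
  rw [Real.rpow_sub hδ, Real.rpow_natCast, div_eq_mul_inv]

variable {α : ℝ} {μ : Measure (Space d)} {C : ℝ≥0}

/-- The norm of a heat integrand whose symbol vanishes to order `k` at the scale `1/δ`. -/
lemma exists_integrandNormSq_heat_le (hH : H ∈ Set.Ioo (1 / 2 : ℝ) 1)
    (hα : α ∈ Set.Ioo (0 : ℝ) d) (hμ : μ ≤ C • rieszMeasure d α) (t : ℝ) {p : ℝ} {k : ℕ}
    (hp0 : 0 ≤ p) (hp : p ≤ 2 * H) (h1 : (d : ℝ) < 2 * p + α) (h2 : 2 * p + α < d + (2 * k : ℕ)) :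
    ∃ K : ℝ, 0 < K ∧ ∀ δ > 0, ∀ g m, IsHeatIntegrand t g m →
      (∀ ξ, ‖m ξ‖ ≤ min 2 (δ * ‖ξ‖) ^ k) →
      integrandNormSq H T μ g ≤ ENNReal.ofReal (K * δ ^ (2 * p + α - d)) := by
  have hd : 0 < d := by
    have := hα.1.trans hα.2
    exact_mod_cast this
  have : Nonempty (Fin d) := ⟨⟨0, hd⟩⟩
  obtain ⟨C₁, hC₁⟩ := exists_timeEnergy_heatFactor_le (T := T) (t := t) hH hp0 hp
  have hJ := truncIntegral_lt_top hd h1 h2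
  set a := ENNReal.ofReal (H * (2 * H - 1)) with ha
  set K₀ : ℝ≥0∞ := a * (C * (C₁ * (ENNReal.ofReal (2 ^ p) * truncIntegral d (2 * k) (2 * p + α))))
    with hK₀
  have hK₀t : K₀ < ∞ := by
    refine ENNReal.mul_lt_top ENNReal.ofReal_lt_top (ENNReal.mul_lt_top ENNReal.coe_lt_top
      (ENNReal.mul_lt_top ENNReal.coe_lt_top (ENNReal.mul_lt_top ENNReal.ofReal_lt_top hJ)))
  refine ⟨K₀.toReal + 1, by positivity, fun δ hδ g m hg hm => ?_⟩
  -- The heat decay rate is λ = |ξ|²/2, so the time energy contributes |ξ|^{-2p}, which joins the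
  -- spectral density |ξ|^{-α}. The point ξ = 0, where λ = 0, is null.
  have hpt : ∀ ξ : Space d, ξ ≠ 0 →
      timeEnergy H T (fun r => ‖fourier (fun y => (g r y : ℂ)) ξ‖ₑ) * ENNReal.ofReal (‖ξ‖ ^ (-α))
      ≤ C₁ * ENNReal.ofReal (2 ^ p) * (ENNReal.ofReal (min 2 (δ * ‖ξ‖) ^ (2 * k)) *
        ENNReal.ofReal (‖ξ‖ ^ (-(2 * p + α)))) := by
    intro ξ hξ
    have hξ' : 0 < ‖ξ‖ := norm_pos_iff.2 hξ
    have e : timeEnergy H T (fun r => ‖fourier (fun y => (g r y : ℂ)) ξ‖ₑ)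
        = ‖m ξ‖ₑ ^ 2 * timeEnergy H T (heatFactor t (‖ξ‖ ^ 2 / 2)) := by
      rw [← timeEnergy_const_mul enorm_ne_top]
      congr 1
      funext r
      rw [hg.fourier_eq, enorm_mul, heatFactor]
      split_ifs with hr
      · rw [← ofReal_norm (((Real.exp _ : ℝ) : ℂ)), Complex.norm_real,
          Real.norm_of_nonneg (Real.exp_pos _).le, mul_comm (t - r)]
      · simp
    rw [e]
    have hm2 : ‖m ξ‖ₑ ^ 2 ≤ ENNReal.ofReal (min 2 (δ * ‖ξ‖) ^ (2 * k)) := by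
      rw [← ofReal_norm, ← ENNReal.ofReal_pow (norm_nonneg _)]
      refine ENNReal.ofReal_le_ofReal ?_
      rw [mul_comm 2 k, pow_mul]
      exact pow_le_pow_left₀ (norm_nonneg _) (hm ξ) 2
    have hpow : ENNReal.ofReal ((‖ξ‖ ^ 2 / 2) ^ (-p)) * ENNReal.ofReal (‖ξ‖ ^ (-α))
        = ENNReal.ofReal (2 ^ p) * ENNReal.ofReal (‖ξ‖ ^ (-(2 * p + α))) := by
      rw [← ENNReal.ofReal_mul (by positivity), ← ENNReal.ofReal_mul (by positivity)]
      congr 1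
      rw [Real.div_rpow (by positivity) (by norm_num), Real.rpow_neg (by norm_num : (0 : ℝ) ≤ 2),
        div_inv_eq_mul, ← Real.rpow_natCast, ← Real.rpow_mul hξ'.le, mul_comm (_ ^ _) (2 ^ p),
        mul_assoc, ← Real.rpow_add hξ']
      congr 2
      push_cast
      ring
    calc _ ≤ ENNReal.ofReal (min 2 (δ * ‖ξ‖) ^ (2 * k)) *
          (C₁ * ENNReal.ofReal ((‖ξ‖ ^ 2 / 2) ^ (-p))) * ENNReal.ofReal (‖ξ‖ ^ (-α)) := by
          gcongr
          exact hC₁ _ (by positivity)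
      _ = ENNReal.ofReal (min 2 (δ * ‖ξ‖) ^ (2 * k)) * C₁ *
          (ENNReal.ofReal ((‖ξ‖ ^ 2 / 2) ^ (-p)) * ENNReal.ofReal (‖ξ‖ ^ (-α))) := by ring
      _ = _ := by rw [hpow]; ring
  have h0 : ∀ᵐ η : Space d, η ≠ 0 := by simp [ae_iff, measure_singleton]
  calc integrandNormSq H T μ g
      ≤ a * (C * ∫⁻ ξ, timeEnergy H T (fun r => ‖fourier (fun y => (g r y : ℂ)) ξ‖ₑ) *
          ENNReal.ofReal (‖ξ‖ ^ (-α))) := by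
        rw [integrandNormSq_eq]
        gcongr
        exact lintegral_le_of_le_smul hμ hg.regular.measurable_timeEnergy
    _ ≤ a * (C * ∫⁻ ξ : Space d, C₁ * ENNReal.ofReal (2 ^ p) *
          (ENNReal.ofReal (min 2 (δ * ‖ξ‖) ^ (2 * k)) *
            ENNReal.ofReal (‖ξ‖ ^ (-(2 * p + α))))) := by
        gcongr _ * (_ * ?_)
        refine lintegral_mono_ae ?_
        filter_upwards [h0] with ξ hξ
        exact hpt ξ hξ
    _ = K₀ * ENNReal.ofReal (δ ^ (2 * p + α - d)) := by
        rw [lintegral_const_mul _ (by fun_prop), lintegral_min_rpow hδ, hK₀]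
        ring
    _ ≤ ENNReal.ofReal ((K₀.toReal + 1) * δ ^ (2 * p + α - d)) := by
        rw [ENNReal.ofReal_mul (by positivity)]
        gcongr
        rw [← ENNReal.ofReal_toReal hK₀t.ne]
        refine ENNReal.ofReal_le_ofReal ?_
        rw [ENNReal.toReal_ofReal ENNReal.toReal_nonneg]
        linarith

variable {Ω : Type*} [MeasurableSpace Ω] {P : Measure Ω} {f : Space d → ℝ}
  {W : NoiseIndex d T → Ω → ℝ} {u : ℝ → Space d → Ω → ℝ} {t : ℝ}

/-- First differences of the mild solution are subgaussian. -/
lemma exists_lintegral_exp_sub_sq_le [IsFiniteMeasure P] (hH : H ∈ Set.Ioo (1 / 2 : ℝ) 1)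
    (hα : α ∈ Set.Ioo (0 : ℝ) d) (hμ : μ ≤ C • rieszMeasure d α) (hf : IsFourierTransformOf f μ)
    (hW : IsFracColoredNoise H f W P) (hu : IsMildSolution H μ W P u) (ht : t ∈ Set.Ioc 0 T)
    (hsmooth : 1 < 2 * H - ((d : ℝ) - α) / 2) :
    ∃ K : ℝ, 0 < K ∧ ∀ x y : Space d, x ≠ y →
      ∫⁻ ω, ENNReal.ofReal (Real.exp ((u t x ω - u t y ω) ^ 2 / (K * ‖x - y‖))) ∂P ≤ 2 := by
  -- The choice p = (d-α+1)/2 makes 2p + α - d = 1. The full decay p = 2H is not available with k =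
  -- 1: then 2p + α - d > 2 and the frequency integral diverges at the origin.
  obtain ⟨K, hK, hb⟩ := exists_integrandNormSq_heat_le (T := T) (p := (d - α + 1) / 2) (k := 1) hH hα hμ t
    (by linarith [hα.2]) (by linarith [hα.2, hH.1]) (by linarith) (by push_cast; linarith)
  refine ⟨12 * K, by positivity, fun x y hxy => ?_⟩
  have hxy' : 0 < ‖x - y‖ := norm_pos_iff.2 (sub_ne_zero.2 hxy)
  have ht' : t ∈ Set.Icc 0 T := ⟨ht.1.le, ht.2⟩
  have hx := isHeatIntegrand_heatKernel t x
  have hy := (isHeatIntegrand_heatKernel t y).neg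
  have hX := (hu t ht' x).add hH hW (hu t ht' y).neg hx.regular hy.regular
  have hbd := hb ‖x - y‖ hxy' _ _ (hx.add hy) fun ξ => by
    rw [← sub_eq_add_neg, pow_one]
    exact norm_char_sub_char_le x y ξ
  rw [show 2 * (((d : ℝ) - α + 1) / 2) + α - d = 1 by ring, Real.rpow_one] at hbd
  have := hX.lintegral_exp_sq_le hH hα hμ hf hW (hx.add hy).regular (by positivity) hbd
  simpa only [← sub_eq_add_neg, mul_assoc] using this

lemma gridPoint_add_unitVec (n : ℕ) (z : Fin d → ℤ) (j : Fin d) :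
    gridPoint n (z + unitVec j) = gridPoint n z + EuclideanSpace.single j ((1 / 2 : ℝ) ^ n) := by
  ext i
  simp only [gridPoint_apply, Pi.add_apply, unitVec, PiLp.add_apply, PiLp.single_apply]
  rcases eq_or_ne i j with rfl | h
  · simp [add_div]
  · simp [h]

/-- Second differences of the mild solution are subgaussian. -/
lemma exists_lintegral_exp_secondDiff_sq_le [IsFiniteMeasure P] (hH : H ∈ Set.Ioo (1 / 2 : ℝ) 1)
    (hα : α ∈ Set.Ioo (0 : ℝ) d) (hμ : μ ≤ C • rieszMeasure d α) (hf : IsFourierTransformOf f μ)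
    (hW : IsFracColoredNoise H f W P) (hu : IsMildSolution H μ W P u) (ht : t ∈ Set.Ioc 0 T)
    (hsmooth : 1 < 2 * H - ((d : ℝ) - α) / 2) :
    ∃ K : ℝ, 0 < K ∧ ∀ n j k z,
      ∫⁻ ω, ENNReal.ofReal (Real.exp ((secondDiff (fun x => u t x ω) n j k z) ^ 2
        / (K * ((1 / 2) ^ n) ^ (4 * H + α - d)))) ∂P ≤ 2 := by
  -- Here the full decay p = 2H is admissible: 4H + α - d is positive, and it stays below 4 because
  -- H < 1 and α < d.
  obtain ⟨K, hK, hb⟩ := exists_integrandNormSq_heat_le (T := T) (p := 2 * H) (k := 2) hH hα hμ t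
    (by linarith [hH.1]) le_rfl (by linarith) (by push_cast; linarith [hα.2, hH.2])
  refine ⟨12 * K, by positivity, fun n j k z => ?_⟩
  set δ : ℝ := (1 / 2) ^ n with hδ
  have hδ0 : 0 < δ := by positivity
  have ht' : t ∈ Set.Icc 0 T := ⟨ht.1.le, ht.2⟩
  set x₀ := gridPoint n z with hx₀
  set x₁ := gridPoint n (z + unitVec k) with hx₁
  set x₂ := gridPoint n (z + unitVec j) with hx₂
  set x₃ := gridPoint n (z + unitVec j + unitVec k) with hx₃
  have h0 := isHeatIntegrand_heatKernel t x₀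
  have h1 := (isHeatIntegrand_heatKernel t x₁).neg
  have h2 := (isHeatIntegrand_heatKernel t x₂).neg
  have h3 := isHeatIntegrand_heatKernel t x₃
  have hX := (((hu t ht' x₃).add hH hW (hu t ht' x₂).neg h3.regular h2.regular).add hH hW
    (hu t ht' x₁).neg (h3.add h2).regular h1.regular).add hH hW (hu t ht' x₀)
    ((h3.add h2).add h1).regular h0.regular
  have hF := ((h3.add h2).add h1).add h0
  have hbd := hb δ hδ0 _ _ hF fun ξ => by
    -- The symbol of a mixed second difference factors into two first-difference symbols, hence the
    -- square of min(2, δ|ξ|).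
    have e : char x₃ ξ + -char x₂ ξ + -char x₁ ξ + char x₀ ξ
        = char x₀ ξ * ((char (EuclideanSpace.single j δ) ξ - 1) *
          (char (EuclideanSpace.single k δ) ξ - 1)) := by
      rw [hx₃, hx₂, hx₁, gridPoint_add_unitVec, gridPoint_add_unitVec, gridPoint_add_unitVec,
        char_add, char_add, char_add]
      ring
    rw [e, norm_mul, norm_char, one_mul, norm_mul, sq]
    have hn : ∀ i : Fin d, ‖char (EuclideanSpace.single i δ) ξ - 1‖ ≤ min 2 (δ * ‖ξ‖) := fun i => by
      have := norm_char_sub_one_le (EuclideanSpace.single i δ) ξ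
      rwa [PiLp.norm_single, Real.norm_of_nonneg hδ0.le] at this
    exact mul_le_mul (hn j) (hn k) (norm_nonneg _) ((norm_nonneg _).trans (hn j))
  rw [show 2 * (2 * H) + α - d = 4 * H + α - d by ring] at hbd
  have := hX.lintegral_exp_sq_le hH hα hμ hf hW hF.regular (by positivity) hbd
  simpa only [secondDiff, sub_eq_add_neg, mul_assoc] using this

end Heat

/-! ### Maximal inequality over the dyadic grids -/

section Chaining

variable {Ω : Type*} [MeasurableSpace Ω] {P : Measure Ω}

/-- One integrable moment of X gives all moments of its logarithm, since (log X)^m ≤ m! X for X ≥ 1.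
-/
lemma memLp_sqrt_log_of_integrable [IsFiniteMeasure P] {X : Ω → ℝ} (hm : Measurable X)
    (h1 : ∀ ω, 1 ≤ X ω) (hX : Integrable X P) (p : ℝ≥0) :
    MemLp (fun ω => √(Real.log (X ω))) p P := by
  obtain ⟨m, hm0⟩ := exists_nat_ge p
  have hmeas : Measurable fun ω => √(Real.log (X ω)) := (Real.measurable_log.comp hm).sqrt
  have key : MemLp (fun ω => √(Real.log (X ω))) ((2 * (m + 1) : ℕ) : ℝ≥0∞) P := by
    refine ⟨hmeas.aestronglyMeasurable, ?_⟩
    rw [eLpNorm_lt_top_iff_lintegral_rpow_enorm_lt_top (by positivity) (ENNReal.natCast_ne_top _)]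
    refine lt_of_le_of_lt (lintegral_mono fun ω => ?_)
      (hX.const_mul ((m + 1).factorial : ℝ)).lintegral_lt_top
    have hl : 0 ≤ Real.log (X ω) := Real.log_nonneg (h1 ω)
    have hpos : 0 < X ω := zero_lt_one.trans_le (h1 ω)
    rw [ENNReal.toReal_natCast, ENNReal.rpow_natCast, ← ofReal_norm,
      Real.norm_of_nonneg (Real.sqrt_nonneg _), ← ENNReal.ofReal_pow (Real.sqrt_nonneg _), pow_mul,
      Real.sq_sqrt hl]
    refine ENNReal.ofReal_le_ofReal ?_
    have := Real.pow_div_factorial_le_exp _ hl (m + 1)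
    rw [Real.exp_log hpos, div_le_iff₀ (by positivity)] at this
    linarith
  refine key.mono_exponent ?_
  have : p ≤ ((2 * (m + 1) : ℕ) : ℝ≥0) := hm0.trans (by exact_mod_cast (by omega))
  exact_mod_cast this

/-- The maximal inequality for a triangular array of subgaussian variables with geometrically many
entries in each row. -/
lemma exists_array_bound [IsFiniteMeasure P] {ι : Type*} (Z : ℕ → ι → Ω → ℝ) (s : ℕ → Finset ι)
    {a : ℕ} (ha : 1 ≤ a) (hs : ∀ n, (s n).card ≤ a ^ (n + 1)) (B : ℕ → ℝ) (hB : ∀ n, 0 < B n)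
    (hZm : ∀ n i, Measurable (Z n i))
    (hZ : ∀ n i, ∫⁻ ω, ENNReal.ofReal (Real.exp (Z n i ω ^ 2 / B n)) ∂P ≤ 2) :
    ∃ κ : Ω → ℝ, Measurable κ ∧ (∀ ω, 0 < κ ω) ∧ (∀ p : ℝ≥0, MemLp κ p P) ∧
      ∀ᵐ ω ∂P, ∀ n, ∀ i ∈ s n, |Z n i ω| ≤ κ ω * √(B n * (n + 1)) := by
  have ha' : (1 : ℝ) ≤ a := by exact_mod_cast ha
  -- Of the weight (2a)^{-(n+1)}, the part a^{-(n+1)} compensates the number of entries in row n and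
  -- the part 2^{-(n+1)} makes the rows summable.
  set q : ℕ → ℝ≥0∞ := fun n => ((2 * a : ℝ≥0∞) ^ (n + 1))⁻¹ with hq
  set E : ℕ → ι → Ω → ℝ≥0∞ := fun n i ω => ENNReal.ofReal (Real.exp (Z n i ω ^ 2 / B n)) with hE
  have hEm : ∀ n i, Measurable (E n i) := fun n i =>
    (Real.measurable_exp.comp (((hZm n i).pow_const 2).div_const _)).ennreal_ofReal
  set Y : Ω → ℝ≥0∞ := fun ω => ∑' n, q n * ∑ i ∈ s n, E n i ω with hY
  have hsm : ∀ n, Measurable fun ω => q n * ∑ i ∈ s n, E n i ω := fun n =>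
    (Finset.measurable_sum _ fun i _ => hEm n i).const_mul _
  have hYm : Measurable Y := Measurable.tsum hsm
  have ha0 : (a : ℝ≥0∞) ≠ 0 := by simpa using (by omega : a ≠ 0)
  have hat : (a : ℝ≥0∞) ≠ ∞ := ENNReal.natCast_ne_top _
  have hYfin : ∫⁻ ω, Y ω ∂P < ∞ := by
    rw [hY, lintegral_tsum fun n => (hsm n).aemeasurable]
    have hb : ∀ n, ∫⁻ ω, q n * ∑ i ∈ s n, E n i ω ∂P ≤ (2⁻¹ : ℝ≥0∞) ^ (n + 1) * 2 := by
      intro n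
      rw [lintegral_const_mul _ (Finset.measurable_sum _ fun i _ => hEm n i),
        lintegral_finsetSum _ fun i _ => hEm n i]
      calc q n * ∑ i ∈ s n, ∫⁻ ω, E n i ω ∂P ≤ q n * ∑ i ∈ s n, 2 := by
            gcongr with i; exact hZ n i
        _ = q n * ((s n).card * 2) := by rw [Finset.sum_const, nsmul_eq_mul]
        _ ≤ q n * ((a : ℝ≥0∞) ^ (n + 1) * 2) := by
            gcongr; exact_mod_cast hs n
        _ = (2⁻¹ : ℝ≥0∞) ^ (n + 1) * (((a : ℝ≥0∞)⁻¹ * a) ^ (n + 1)) * 2 := by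
            simp only [hq]
            rw [ENNReal.inv_pow, ENNReal.mul_inv (by simp) (by simp)]
            ring
        _ = _ := by rw [ENNReal.inv_mul_cancel ha0 hat, one_pow, mul_one]
    refine lt_of_le_of_lt (ENNReal.tsum_le_tsum hb) ?_
    rw [ENNReal.tsum_mul_right, ENNReal.tsum_geometric_add_one]
    exact ENNReal.mul_lt_top (ENNReal.mul_lt_top (by simp) (by simp)) (by simp)
  -- This choice gives (2a)^{n+1} Y ≤ X^{n+1} for every n, so Z²/B_n ≤ (n+1) log X and κ = √(log X)
  -- serves all rows at once; X ≥ 2 keeps κ positive.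
  set X : Ω → ℝ := fun ω => 2 * a * (1 + (Y ω).toReal) with hX
  have hX2 : ∀ ω, 2 ≤ X ω := fun ω => by
    have : 0 ≤ (Y ω).toReal := ENNReal.toReal_nonneg
    simp only [hX]
    nlinarith
  have hXm : Measurable X := (hYm.ennreal_toReal.const_add 1).const_mul _
  have hXi : Integrable X P :=
    ((integrable_const 1).add (integrable_toReal_of_lintegral_ne_top hYm.aemeasurable
      hYfin.ne)).const_mul _
  refine ⟨fun ω => √(Real.log (X ω)), (Real.measurable_log.comp hXm).sqrt,
    fun ω => Real.sqrt_pos.2 (Real.log_pos (by linarith [hX2 ω])),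
    memLp_sqrt_log_of_integrable hXm (fun ω => by linarith [hX2 ω]) hXi, ?_⟩
  filter_upwards [ae_lt_top hYm hYfin.ne] with ω hω n i hi
  have hle : q n * E n i ω ≤ Y ω := by
    refine le_trans ?_ (ENNReal.le_tsum n)
    gcongr
    exact Finset.single_le_sum (f := fun i => E n i ω) (fun _ _ => zero_le) hi
  have hE' : Real.exp (Z n i ω ^ 2 / B n) ≤ X ω ^ (n + 1) := by
    have h1 := ENNReal.toReal_mono hω.ne hle
    rw [ENNReal.toReal_mul, hq, hE, ENNReal.toReal_ofReal (Real.exp_pos _).le, ENNReal.toReal_inv,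
      ENNReal.toReal_pow, ENNReal.toReal_mul, ENNReal.toReal_natCast, ENNReal.toReal_ofNat,
      inv_mul_le_iff₀ (by positivity)] at h1
    have h0 : 0 ≤ (Y ω).toReal := ENNReal.toReal_nonneg
    refine h1.trans ?_
    rw [hX, mul_pow _ (1 + _)]
    gcongr
    exact (le_add_of_nonneg_left zero_le_one).trans
      (le_self_pow₀ (le_add_of_nonneg_right h0) (by omega))
  have hX0 : 0 < X ω := by linarith [hX2 ω]
  have hlog : Z n i ω ^ 2 / B n ≤ (n + 1) * Real.log (X ω) := by
    have := Real.log_le_log (Real.exp_pos _) hE'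
    rw [Real.log_exp, Real.log_pow] at this
    exact_mod_cast this
  have hl0 : 0 ≤ Real.log (X ω) := Real.log_nonneg (by linarith [hX2 ω])
  rw [div_le_iff₀ (hB n)] at hlog
  rw [← Real.sqrt_mul hl0, ← Real.sqrt_sq_eq_abs]
  exact Real.sqrt_le_sqrt (by linarith)

/-- The gauge `2^{-nθ} √(n+1)`. -/
def logGauge (θ : ℝ) (n : ℕ) : ℝ := ((1 / 2) ^ n) ^ θ * √(n + 1)

lemma logGauge_nonneg (θ : ℝ) (n : ℕ) : 0 ≤ logGauge θ n := by unfold logGauge; positivity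

/-- Reduces to n + m + 1 ≤ (n + 1)(m + 1); the gauge can thus serve as its own ratio sequence r in
the dyadic argument. -/
lemma logGauge_add_le (θ : ℝ) (n m : ℕ) :
    logGauge θ (n + m) ≤ logGauge θ n * logGauge θ m := by
  rw [logGauge, logGauge, logGauge, pow_add, Real.mul_rpow (by positivity) (by positivity),
    mul_mul_mul_comm, ← Real.sqrt_mul (by positivity)]
  gcongr
  push_cast
  nlinarith [(Nat.cast_nonneg n : (0 : ℝ) ≤ n), (Nat.cast_nonneg m : (0 : ℝ) ≤ m),
    mul_nonneg (Nat.cast_nonneg n : (0 : ℝ) ≤ n) (Nat.cast_nonneg m : (0 : ℝ) ≤ m)]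

lemma summable_logGauge {θ : ℝ} (hθ : 0 < θ) : Summable (logGauge θ) := by
  set ρ : ℝ := (1 / 2) ^ θ with hρ
  have h0 : 0 ≤ ρ := by positivity
  have h1 : ‖ρ‖ < 1 := by
    rw [Real.norm_of_nonneg h0]
    exact Real.rpow_lt_one (by norm_num) (by norm_num) hθ
  have hs := (summable_pow_mul_geometric_of_norm_lt_one 1 h1).add
    (summable_pow_mul_geometric_of_norm_lt_one 0 h1)
  refine Summable.of_nonneg_of_le (logGauge_nonneg θ) (fun n => ?_) hs
  have e : (((1 / 2 : ℝ)) ^ n) ^ θ = ρ ^ n := by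
    rw [hρ, ← Real.rpow_natCast, ← Real.rpow_mul (by norm_num), mul_comm,
      Real.rpow_mul (by norm_num), Real.rpow_natCast]
  have h2 : √((n : ℝ) + 1) ≤ n + 1 := by
    rw [Real.sqrt_le_left (by positivity)]
    nlinarith [(Nat.cast_nonneg n : (0 : ℝ) ≤ n)]
  rw [logGauge, e]
  calc ρ ^ n * √((n : ℝ) + 1) ≤ ρ ^ n * (n + 1) := by gcongr
    _ = _ := by ring

lemma sqrt_mul_rpow_eq_logGauge {K : ℝ} (hK : 0 < K) (θ : ℝ) (n : ℕ) :
    √(K * ((1 / 2) ^ n) ^ (2 + 2 * θ) * (n + 1)) = √K * logGauge θ n / 2 ^ n := by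
  have h0 : (0 : ℝ) < (1 / 2) ^ n := by positivity
  have e : ((1 / 2 : ℝ) ^ n) ^ (2 + 2 * θ) = ((1 / 2) ^ n * ((1 / 2) ^ n) ^ θ) ^ 2 := by
    rw [mul_pow, Real.rpow_add h0, mul_comm 2 θ, Real.rpow_mul h0.le, Real.rpow_two, Real.rpow_two]
  rw [Real.sqrt_mul (by positivity), Real.sqrt_mul hK.le, e, Real.sqrt_sq (by positivity), logGauge,
    one_div, inv_pow]
  field_simp

/-- The scale n is the one with 2^{-n-1} < ε ≤ 2^{-n}, so that n ≤ log(1/ε)/log 2. The extra 1 in n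
+ 1 is absorbed by log(1/ε)/log(1/ε₀) ≥ 1, where ε₀ < 1 is essential. -/
lemma exists_logGauge_le {θ ε₀ : ℝ} (hθ : 0 ≤ θ) (hε₀ : ε₀ ∈ Set.Ioo (0 : ℝ) 1) :
    ∃ c : ℝ, 0 < c ∧ ∀ ε ∈ Set.Ioc 0 ε₀, ∃ n : ℕ, ε ≤ (1 / 2) ^ n ∧
      logGauge θ n ≤ c * (ε ^ θ * √(Real.log (1 / ε))) := by
  set b : ℝ := 1 / Real.log 2 + 1 / Real.log (1 / ε₀) with hb
  have hl2 : 0 < Real.log 2 := Real.log_pos (by norm_num)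
  have hl0 : 0 < Real.log (1 / ε₀) := Real.log_pos (by rw [lt_div_iff₀ hε₀.1]; linarith [hε₀.2])
  refine ⟨2 ^ θ * √b, by positivity, fun ε hε => ?_⟩
  obtain ⟨n, h1, h2⟩ := exists_nat_pow_near_of_lt_one hε.1 (hε.2.trans hε₀.2.le)
    (by norm_num : (0 : ℝ) < 1 / 2) (by norm_num)
  refine ⟨n, h2, ?_⟩
  have h3 : ((1 / 2 : ℝ) ^ n) ^ θ ≤ 2 ^ θ * ε ^ θ := by
    rw [← Real.mul_rpow (by norm_num) hε.1.le]
    refine Real.rpow_le_rpow (by positivity) ?_ hθ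
    rw [pow_succ] at h1
    linarith
  have hle : Real.log (1 / ε₀) ≤ Real.log (1 / ε) :=
    Real.log_le_log (by have := hε₀.1; positivity) (one_div_le_one_div_of_le hε.1 hε.2)
  have hn : n * Real.log 2 ≤ Real.log (1 / ε) := by
    rw [← Real.log_pow]
    refine Real.log_le_log (by positivity) ?_
    rw [le_div_iff₀ hε.1]
    calc (2 : ℝ) ^ n * ε ≤ 2 ^ n * (1 / 2) ^ n := by gcongr
      _ = 1 := by rw [← mul_pow]; norm_num
  have h4 : (n : ℝ) + 1 ≤ b * Real.log (1 / ε) := by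
    rw [hb, add_mul]
    refine add_le_add ?_ ?_
    · rwa [one_div_mul_eq_div, le_div_iff₀ hl2]
    · rwa [one_div_mul_eq_div, le_div_iff₀ hl0, one_mul]
  calc logGauge θ n ≤ 2 ^ θ * ε ^ θ * √(b * Real.log (1 / ε)) := by
        have := hε.1
        rw [logGauge]
        gcongr
    _ = _ := by rw [Real.sqrt_mul (by positivity)]; ring

lemma cube_subset_cube {d : ℕ} {M M' : ℝ} (h : M ≤ M') : cube d M ⊆ cube d M' := fun _ hx i =>
  Set.Icc_subset_Icc (neg_le_neg h) h (hx i)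

/-- A finite set containing the integer points of `[-M 2^n, M 2^n]^d`. -/
lemma exists_finset_gridBox (d M : ℕ) : ∃ a : ℕ, 1 ≤ a ∧
    ∀ n, ∃ s : Finset ((Fin d → ℤ) × Fin d × Fin d), s.card ≤ a ^ (n + 1) ∧
      ∀ z ∈ gridBox d M n, ∀ j k, (z, j, k) ∈ s := by
  -- Row n has (2M·2^n + 1)^d points and d² direction pairs; adding 1 to d² keeps the base positive
  -- when d = 0.
  refine ⟨(2 * (2 * M + 1)) ^ d * (d * d + 1), Nat.mul_pos (by positivity) (by omega), fun n => ?_⟩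
  refine ⟨(Fintype.piFinset fun _ : Fin d => Finset.Icc (-(M * 2 ^ n : ℤ)) (M * 2 ^ n)) ×ˢ
    Finset.univ, ?_, fun z hz j k => ?_⟩
  · rw [Finset.card_product, Fintype.card_piFinset_const, Int.card_Icc, Finset.card_univ,
      Fintype.card_prod, Fintype.card_fin]
    have e : ((M * 2 ^ n : ℤ) + 1 - -(M * 2 ^ n : ℤ)).toNat = 2 * M * 2 ^ n + 1 := by
      rw [show ((M * 2 ^ n : ℤ) + 1 - -(M * 2 ^ n : ℤ)) = ((2 * M * 2 ^ n + 1 : ℕ) : ℤ) by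
        push_cast; ring, Int.toNat_natCast]
    rw [e, mul_pow _ _ (n + 1)]
    have h1 : 2 * M * 2 ^ n + 1 ≤ (2 * (2 * M + 1)) ^ (n + 1) := by
      have : 1 ≤ (2 * M + 1) ^ n := Nat.one_le_pow _ _ (by omega)
      have h2 : 1 ≤ 2 ^ n := Nat.one_le_two_pow
      calc 2 * M * 2 ^ n + 1 ≤ (2 * M + 1) * 2 ^ n := by nlinarith
        _ ≤ (2 * M + 1) * 2 ^ n * (2 * (2 * M + 1) ^ n) := Nat.le_mul_of_pos_right _ (by omega)
        _ = _ := by rw [pow_succ, mul_pow]; ring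
    refine Nat.mul_le_mul ?_ ((Nat.le_succ _).trans (Nat.le_self_pow (by omega) _))
    rw [← pow_mul, mul_comm d, pow_mul]
    exact Nat.pow_le_pow_left h1 d
  · simp only [Finset.mem_product, Fintype.mem_piFinset, Finset.mem_Icc, Finset.mem_univ, and_true]
    exact fun i => abs_le.1 (hz i)

/-- Random control of the second differences of a subgaussian field on a box. -/
lemma exists_secondDiffBound [IsFiniteMeasure P] {d : ℕ} {U : Space d → Ω → ℝ}
    (hU : ∀ x, Measurable (U x)) {K θ : ℝ} (hK : 0 < K)
    (h : ∀ n j k z, ∫⁻ ω, ENNReal.ofReal (Real.exp ((secondDiff (fun x => U x ω) n j k z) ^ 2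
        / (K * ((1 / 2) ^ n) ^ (2 + 2 * θ)))) ∂P ≤ 2) (M : ℕ) :
    ∃ κ : Ω → ℝ, Measurable κ ∧ (∀ ω, 0 < κ ω) ∧ (∀ p : ℝ≥0, MemLp κ p P) ∧
      ∀ᵐ ω ∂P, SecondDiffBound (fun x => U x ω) (logGauge θ) M (κ ω) := by
  obtain ⟨a, ha, hs⟩ := exists_finset_gridBox d M
  choose s hs hmem using hs
  obtain ⟨κ, hm, hpos, hLp, hb⟩ := exists_array_bound (P := P)
    (fun n (i : (Fin d → ℤ) × Fin d × Fin d) ω => secondDiff (fun x => U x ω) n i.2.1 i.2.2 i.1)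
    s ha hs (fun n => K * ((1 / 2) ^ n) ^ (2 + 2 * θ)) (fun n => by positivity)
    (fun n i => by unfold secondDiff; exact (((hU _).sub (hU _)).sub (hU _)).add (hU _))
    (fun n i => h n _ _ _)
  refine ⟨fun ω => √K * κ ω, hm.const_mul _, fun ω => mul_pos (Real.sqrt_pos.2 hK) (hpos ω),
    fun p => (hLp p).const_mul _, ?_⟩
  filter_upwards [hb] with ω hω n z hz j k
  refine (hω n _ (hmem n z hz j k)).trans_eq ?_
  rw [sqrt_mul_rpow_eq_logGauge hK]
  ring

end Chaining

/-! ### Construction of the smooth modification -/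

section Modification

variable {Ω : Type*} [MeasurableSpace Ω] {P : Measure Ω} {d : ℕ}

/-- Continuity in probability along a sequence, from subgaussian increments. -/
lemma tendstoInMeasure_of_exp_sub_sq_le [IsFiniteMeasure P] {U : Space d → Ω → ℝ}
    (hU : ∀ x, Measurable (U x)) {K : ℝ} (hK : 0 < K)
    (h : ∀ x y, x ≠ y →
      ∫⁻ ω, ENNReal.ofReal (Real.exp ((U x ω - U y ω) ^ 2 / (K * ‖x - y‖))) ∂P ≤ 2)
    {x : ℕ → Space d} {y : Space d} (hx : Tendsto x atTop (𝓝 y)) :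
    TendstoInMeasure P (fun n => U (x n)) atTop (U y) := by
  have hsq : ∀ z, eLpNorm (U z - U y) 2 P ^ (2 : ℝ) ≤ ENNReal.ofReal (2 * K * ‖z - y‖) := by
    intro z
    rcases eq_or_ne z y with rfl | hzy
    · simp
    have hz : 0 < K * ‖z - y‖ := mul_pos hK (norm_pos_iff.2 (sub_ne_zero.2 hzy))
    rw [eLpNorm_eq_lintegral_rpow_enorm_toReal (by norm_num) (by norm_num), ENNReal.toReal_ofNat,
      ← ENNReal.rpow_mul, one_div, inv_mul_cancel₀ (by norm_num), ENNReal.rpow_one]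
    -- The inequality x ≤ e^x turns the exponential bound into E|U z - U y|² ≤ 2K|z - y|.
    calc ∫⁻ ω, ‖(U z - U y) ω‖ₑ ^ (2 : ℝ) ∂P
        ≤ ∫⁻ ω, ENNReal.ofReal (K * ‖z - y‖) *
            ENNReal.ofReal (Real.exp ((U z ω - U y ω) ^ 2 / (K * ‖z - y‖))) ∂P := by
          refine lintegral_mono fun ω => ?_
          rw [← ofReal_norm, ENNReal.ofReal_rpow_of_nonneg (norm_nonneg _) (by norm_num),
            Real.rpow_two, Real.norm_eq_abs, sq_abs, Pi.sub_apply, ← ENNReal.ofReal_mul hz.le]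
          refine ENNReal.ofReal_le_ofReal ?_
          rw [← div_le_iff₀' hz]
          linarith [Real.add_one_le_exp ((U z ω - U y ω) ^ 2 / (K * ‖z - y‖))]
      _ ≤ ENNReal.ofReal (K * ‖z - y‖) * 2 := by
          rw [lintegral_const_mul' _ _ ENNReal.ofReal_ne_top]
          gcongr
          exact h z y hzy
      _ = _ := by
          rw [mul_assoc, ENNReal.ofReal_mul zero_le_two, mul_comm, ENNReal.ofReal_ofNat]
  refine tendstoInMeasure_of_tendsto_eLpNorm (p := 2) (by norm_num)
    (fun n => (hU _).aestronglyMeasurable) (hU _).aestronglyMeasurable ?_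
  have h0 : Tendsto (fun n => ENNReal.ofReal (2 * K * ‖x n - y‖)) atTop (𝓝 0) := by
    have : Tendsto (fun n => 2 * K * ‖x n - y‖) atTop (𝓝 (2 * K * 0)) :=
      (tendsto_iff_norm_sub_tendsto_zero.1 hx).const_mul _
    simpa using ENNReal.tendsto_ofReal this
  have h1 := tendsto_of_tendsto_of_tendsto_of_le_of_le tendsto_const_nhds h0
    (fun _ => zero_le) (fun n => hsq (x n))
  have h2 := (ENNReal.continuous_rpow_const (y := (2⁻¹ : ℝ))).tendsto 0 |>.comp h1
  rw [ENNReal.zero_rpow_of_pos (by norm_num)] at h2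
  refine h2.congr fun n => ?_
  rw [Function.comp_apply, ← ENNReal.rpow_mul, mul_inv_cancel₀ two_ne_zero, ENNReal.rpow_one]

/-- A field with subgaussian first and second differences has a continuously differentiable
modification whose derivatives have a logarithmic Hölder modulus of continuity. -/
theorem exists_contDiff_modification [IsFiniteMeasure P] {u : Space d → Ω → ℝ}
    (hu : ∀ x, AEMeasurable (u x) P) {K K' θ : ℝ} (hθ : 0 < θ) (hK : 0 < K) (hK' : 0 < K')
    (h₁ : ∀ x y, x ≠ y →
      ∫⁻ ω, ENNReal.ofReal (Real.exp ((u x ω - u y ω) ^ 2 / (K * ‖x - y‖))) ∂P ≤ 2)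
    (h₂ : ∀ n j k z, ∫⁻ ω, ENNReal.ofReal (Real.exp ((secondDiff (fun x => u x ω) n j k z) ^ 2
        / (K' * ((1 / 2) ^ n) ^ (2 + 2 * θ)))) ∂P ≤ 2) :
    ∃ v : Space d → Ω → ℝ, (∀ x, Measurable (v x)) ∧ (∀ x, v x =ᵐ[P] u x) ∧
      (∀ᵐ ω ∂P, ContDiff ℝ 1 (fun x => v x ω)) ∧
      ∀ M : ℝ, ∀ ε₀ ∈ Set.Ioo (0 : ℝ) 1,
        ∃ K : Ω → ℝ, Measurable K ∧ (∀ ω, 0 < K ω) ∧ (∀ p : ℝ≥0, MemLp K p P) ∧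
          ∀ᵐ ω ∂P, ∀ j : Fin d, ∀ ε ∈ Set.Ioc 0 ε₀, ∀ x ∈ cube d M, ∀ y ∈ cube d M, ‖x - y‖ ≤ ε →
            |partialDeriv j (fun z => v z ω) x - partialDeriv j (fun z => v z ω) y|
              ≤ K ω * ε ^ θ * √(Real.log (1 / ε)) := by
  set U : Space d → Ω → ℝ := fun x => (hu x).mk (u x) with hUdef
  have hUm : ∀ x, Measurable (U x) := fun x => (hu x).measurable_mk
  have hUe : ∀ x, U x =ᵐ[P] u x := fun x => (hu x).ae_eq_mk.symm
  have hU₁ : ∀ x y, x ≠ y →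
      ∫⁻ ω, ENNReal.ofReal (Real.exp ((U x ω - U y ω) ^ 2 / (K * ‖x - y‖))) ∂P ≤ 2 := by
    intro x y hxy
    refine (lintegral_congr_ae ?_).trans_le (h₁ x y hxy)
    filter_upwards [hUe x, hUe y] with ω h h'
    rw [h, h']
  have hU₂ : ∀ n j k z, ∫⁻ ω, ENNReal.ofReal (Real.exp ((secondDiff (fun x => U x ω) n j k z) ^ 2
      / (K' * ((1 / 2) ^ n) ^ (2 + 2 * θ)))) ∂P ≤ 2 := by
    intro n j k z
    refine (lintegral_congr_ae ?_).trans_le (h₂ n j k z)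
    filter_upwards [hUe (gridPoint n (z + unitVec j + unitVec k)),
      hUe (gridPoint n (z + unitVec j)), hUe (gridPoint n (z + unitVec k)),
      hUe (gridPoint n z)] with ω e1 e2 e3 e4
    rw [secondDiff, secondDiff, e1, e2, e3, e4]
  choose κ hκm hκpos hκLp hκb using exists_secondDiffBound (P := P) hUm hK' hU₂
  -- The good event is the complement of a measurable hull of the exceptional null set, so that
  -- restricting to it preserves measurability.
  set G : Set Ω := (toMeasurable P
    {ω | ¬ ∀ M, SecondDiffBound (fun x => U x ω) (logGauge θ) M (κ M ω)})ᶜ with hG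
  have hGm : MeasurableSet G := (measurableSet_toMeasurable _ _).compl
  have hGae : ∀ᵐ ω ∂P, ω ∈ G := by
    rw [ae_iff]
    simpa [hG, measure_toMeasurable] using ae_iff.1 (ae_all_iff.2 hκb)
  have hGb : ∀ ω ∈ G, ∀ M, SecondDiffBound (fun x => U x ω) (logGauge θ) M (κ M ω) := by
    intro ω hω
    by_contra hcon
    exact hω (subset_toMeasurable _ _ hcon)
  have hex : ∀ ω, ∃ w : Space d → ℝ, ω ∈ G →
      (∀ x, Tendsto (fun n => U (gridPoint n (gridFloor n x)) ω) atTop (𝓝 (w x))) ∧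
      ContDiff ℝ 1 w ∧ ∀ (M : ℕ) k, 0 ≤ k →
        SecondDiffBound (fun x => U x ω) (logGauge θ) M k → ∀ j n, ∀ x ∈ cube d M,
          ∀ y ∈ cube d M, ‖x - y‖ ≤ (1 / 2) ^ n → |partialDeriv j w x - partialDeriv j w y|
            ≤ gridConst d (logGauge θ) * k * logGauge θ n := by
    intro ω
    by_cases hω : ω ∈ G
    · obtain ⟨w, hw⟩ := exists_contDiff_of_secondDiffBound (g := fun x => U x ω)
        (logGauge_nonneg θ) (logGauge_add_le θ) (summable_logGauge hθ)
        fun M => ⟨κ M ω, (hκpos M ω).le, hGb ω hω M⟩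
      exact ⟨w, fun _ => hw⟩
    · exact ⟨0, fun h => absurd h hω⟩
  choose V hV using hex
  -- Paths chosen ω by ω carry no measurability of their own; v x is measurable as the pointwise
  -- limit of grid values cut off to the good event.
  refine ⟨fun x => G.indicator fun ω => V ω x, fun x => ?_, fun x => ?_, ?_, fun M ε₀ hε₀ => ?_⟩
  · refine measurable_of_tendsto_metrizable
      (f := fun n => G.indicator (U (gridPoint n (gridFloor n x)))) (fun n => (hUm _).indicator hGm)
      (tendsto_pi_nhds.2 fun ω => ?_)
    by_cases hω : ω ∈ G
    · simpa [hω] using (hV ω hω).1 x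
    · simp [hω]
  -- The grid values converge to v x on the good event and to U x in probability; along an almost
  -- surely convergent subsequence the two limits agree.
  · obtain ⟨ns, hns, hlim⟩ := (tendstoInMeasure_of_exp_sub_sq_le hUm hK hU₁
      (tendsto_gridPoint_gridFloor x)).exists_seq_tendsto_ae
    filter_upwards [hGae, hlim, hUe x] with ω hω hl he
    rw [Set.indicator_of_mem hω, ← he]
    exact tendsto_nhds_unique (((hV ω hω).1 x).comp hns.tendsto_atTop) hl
  · filter_upwards [hGae] with ω hω
    simpa [hω] using (hV ω hω).2.1
  · obtain ⟨c, hc, hcb⟩ := exists_logGauge_le hθ.le hε₀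
    set M' := ⌈M⌉₊ with hM'
    have hsub : cube d M ⊆ cube d M' := cube_subset_cube (Nat.le_ceil M)
    -- The absolute value plus 1 provides a strictly positive constant without examining the sign of
    -- `gridConst`.
    set A := |gridConst d (logGauge θ)| + 1 with hA
    have hA0 : 0 < A := by positivity
    refine ⟨fun ω => A * c * κ M' ω, (hκm M').const_mul _, fun ω =>
      mul_pos (mul_pos hA0 hc) (hκpos M' ω), fun p => (hκLp M' p).const_mul _, ?_⟩
    filter_upwards [hGae] with ω hω j ε hε x hx y hy hxy
    obtain ⟨n, hn, hwn⟩ := hcb ε hε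
    have hb := (hV ω hω).2.2 M' _ (hκpos M' ω).le (hGb ω hω M') j n x (hsub hx) y (hsub hy)
      (hxy.trans hn)
    simp only [Set.indicator_of_mem hω]
    have hκ := hκpos M' ω
    have hAl : gridConst d (logGauge θ) ≤ A := (le_abs_self _).trans (by simp [hA])
    calc _ ≤ gridConst d (logGauge θ) * κ M' ω * logGauge θ n := hb
      _ ≤ A * κ M' ω * logGauge θ n := by
          have := logGauge_nonneg θ n
          gcongr
      _ ≤ A * κ M' ω * (c * (ε ^ θ * √(Real.log (1 / ε)))) := by gcongr
      _ = _ := by ring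

end Modification

end FracHeat

end

/-! ### Conclusion: the parameters θ and 2 + 2θ = 4H + α - d -/

theorem theorem5 {d : ℕ} {H α T t : ℝ}
    {Ω : Type*} [MeasurableSpace Ω] (P : MeasureTheory.Measure Ω)
    [MeasureTheory.IsProbabilityMeasure P]
    (hH : H ∈ Set.Ioo (1 / 2 : ℝ) 1) (hα : α ∈ Set.Ioo (0 : ℝ) (d : ℝ))
    (μ : MeasureTheory.Measure (FracHeat.Space d)) (hμ : FracHeat.IsTempered μ)
    (hμα : FracHeat.IsComparableRiesz α μ)
    (f : FracHeat.Space d → ℝ) (hf : FracHeat.IsFourierTransformOf f μ)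
    (W : FracHeat.NoiseIndex d T → Ω → ℝ) (hW : FracHeat.IsFracColoredNoise H f W P)
    (u : ℝ → FracHeat.Space d → Ω → ℝ) (hu : FracHeat.IsMildSolution H μ W P u)
    (ht : t ∈ Set.Ioc 0 T)
    (hsmooth : 1 < 2 * H - ((d : ℝ) - α) / 2) :
    ∃ v : FracHeat.Space d → Ω → ℝ,
      (∀ x, Measurable (v x)) ∧
      (∀ x, v x =ᵐ[P] u t x) ∧
      (∀ᵐ ω ∂P, ContDiff ℝ 1 (fun x => v x ω)) ∧
      ∀ M : ℝ, 0 < M → ∀ ε₀ ∈ Set.Ioo (0 : ℝ) 1,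
        ∃ K : Ω → ℝ, Measurable K ∧ (∀ ω, 0 < K ω) ∧
          (∀ p : ℝ≥0, MeasureTheory.MemLp K p P) ∧
          ∀ᵐ ω ∂P, ∀ j : Fin d, ∀ ε ∈ Set.Ioc 0 ε₀,
            ∀ x ∈ FracHeat.cube d M, ∀ y ∈ FracHeat.cube d M, ‖x - y‖ ≤ ε →
              |FracHeat.partialDeriv j (fun z => v z ω) x
                  - FracHeat.partialDeriv j (fun z => v z ω) y|
                ≤ K ω * ε ^ (2 * H - ((d : ℝ) - α) / 2 - 1) * √(Real.log (1 / ε)) := by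
  obtain ⟨C, hC⟩ := hμα.exists_le_smul
  obtain ⟨K, hK, h₁⟩ := FracHeat.exists_lintegral_exp_sub_sq_le hH hα hC hf hW hu ht hsmooth
  obtain ⟨K', hK', h₂⟩ :=
    FracHeat.exists_lintegral_exp_secondDiff_sq_le hH hα hC hf hW hu ht hsmooth
  have ht' : t ∈ Set.Icc 0 T := ⟨ht.1.le, ht.2⟩
  obtain ⟨v, hv, hvu, hvd, hvK⟩ := FracHeat.exists_contDiff_modification
    (θ := 2 * H - ((d : ℝ) - α) / 2 - 1) (fun x => (hu t ht' x).1.aestronglyMeasurable.aemeasurable)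
    (by linarith) hK hK' h₁ (fun n j k z => by
      rw [show 2 + 2 * (2 * H - ((d : ℝ) - α) / 2 - 1) = 4 * H + α - d by ring]
      exact h₂ n j k z)
  exact ⟨v, hv, hvu, hvd, fun M _ ε₀ hε₀ => hvK M ε₀ hε₀⟩
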